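/- Let $$P_5(x_1,x_2)=x_1^5+x_2^5-5x_1x_2(x_1^2+x_2^2)+5x_1x_2(x_1+x_2)+5(x_1^2+x_2^2)-5(x_1+x_2),$$ let $\bar X\subset\mathbb P^4$ over $\mathbb Q$ be the projective closure of the affine threefold $P_5(x_1,x_2)=P_5(x_4,x_5)$, that is, the quintic hypersurface $F_5(z,x_1,x_2,x_4,x_5)=0$, where $F_5$ is the homogenization of $P_5(x_1,x_2)-P_5(x_4,x_5)$ by the variable $z$, and let $\tilde X\to\bar X$ be the blow-up of $\bar X$ along its singular locus (with the reduced structure). Then: 1. $\tilde X$ has good reduction at every prime $p\notin\{2,3,5\}$: it is the generic fibre of a smooth proper scheme over $\mathbb Z_{(p)}$. 2. Let $k$ be a field of characteristic $0$ or of characteristic $p>5$. Every critical point of $P_5$ with coordinates in $k$ is nondegenerate (its Hessian determinant is nonzero). If $k$ is algebraically closed, then $P_5$ has exactly $16$ critical points over $k$: $10$ with critical value $-2$, $4$ with value $-3$ and $2$ with value $6$. The elements $-2$, $-3$ and $6$ of $k$ are pairwise distinct. The hypersurface $F_5=0$ in $\mathbb P^4_k$ has no singularities at infinity: at a point $[z:x_1:x_2:x_4:x_5]$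 with coordinates in $k$, with $z=0$ and $F_5=0$, the partial derivatives of $F_5$ do not all vanish. 3. Let $\mathcal O$ be the ring of integers of $\mathbb Q(\zeta_{15})$. There are exactly $16$ critical points of $P_5$ with coordinates in $\mathcal O$, and every ring homomorphism from $\mathcal O$ to an algebraically closed field $k$ of characteristic $0$ maps them bijectively onto the critical points of $P_5$ over $k$. For every prime ideal $\mathfrak P$ of $\mathcal O$ above a rational prime $p>5$, reduction modulo $\mathfrak P$ maps these $16$ points bijectively onto the critical points of $P_5$ over $\mathcal O/\mathfrak P$; in particular they stay distinct modulo $\mathfrak P$. -/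

import Mathlib

open AlgebraicGeometry CategoryTheory CategoryTheory.Limits

noncomputable section

namespace ChebyshevQuintic

/-! ### The polynomial `P₅` and its critical points -/

/-- The generalized Chebyshev polynomial
`P₅ = x₁⁵ + x₂⁵ - 5x₁x₂(x₁² + x₂²) + 5x₁x₂(x₁ + x₂) + 5(x₁² + x₂²) - 5(x₁ + x₂)`,
with coefficients in the commutative ring `A`; the variables are `x₁ = X 0`, `x₂ = X 1`. -/
def P5 (A : Type*) [CommRing A] : MvPolynomial (Fin 2) A :=
  let x : MvPolynomial (Fin 2) A := MvPolynomial.X 0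
  let y : MvPolynomial (Fin 2) A := MvPolynomial.X 1
  x ^ 5 + y ^ 5 - 5 * x * y * (x ^ 2 + y ^ 2) + 5 * x * y * (x + y)
    + 5 * (x ^ 2 + y ^ 2) - 5 * (x + y)

/-- The critical points of `P₅` with coordinates in `A`. -/
def critPts (A : Type*) [CommRing A] : Set (Fin 2 → A) :=
  {v | ∀ i, MvPolynomial.eval v (MvPolynomial.pderiv i (P5 A)) = 0}

/-- The critical points of `P₅` with coordinates in `A` and critical value `c`. -/
def critPtsWithValue (A : Type*) [CommRing A] (c : A) : Set (Fin 2 → A) :=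
  {v | v ∈ critPts A ∧ MvPolynomial.eval v (P5 A) = c}

/-- The Hessian matrix of `P₅` at the point `v`. -/
def hessian {A : Type*} [CommRing A] (v : Fin 2 → A) : Matrix (Fin 2) (Fin 2) A :=
  Matrix.of fun i j =>
    MvPolynomial.eval v (MvPolynomial.pderiv i (MvPolynomial.pderiv j (P5 A)))

/-! ### The projective closure `X̄` of `P₅(x₁, x₂) = P₅(x₄, x₅)` -/

/-- The affine equation `f₅ = P₅(x₁, x₂) - P₅(x₄, x₅)`, in the variables
`x₁ = X 0`, `x₂ = X 1`, `x₄ = X 2`, `x₅ = X 3`. -/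
def f5 (A : Type*) [CommRing A] : MvPolynomial (Fin 4) A :=
  MvPolynomial.rename ![0, 1] (P5 A) - MvPolynomial.rename ![2, 3] (P5 A)

/-- The homogenization `z⁵ P₅(x / z, y / z)` of `P₅`, written out. -/
def P5hom {B : Type*} [CommRing B] (z x y : B) : B :=
  x ^ 5 + y ^ 5 - 5 * x * y * (x ^ 2 + y ^ 2) * z + 5 * x * y * (x + y) * z ^ 2
    + 5 * (x ^ 2 + y ^ 2) * z ^ 3 - 5 * (x + y) * z ^ 4

/-- The homogenization of `f₅`: the homogeneous quintic equation of `X̄` in `ℙ⁴`, in the variables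
`z = X 0`, `x₁ = X 1`, `x₂ = X 2`, `x₄ = X 3`, `x₅ = X 4`. -/
def F5 (A : Type*) [CommRing A] : MvPolynomial (Fin 5) A :=
  P5hom (MvPolynomial.X 0) (MvPolynomial.X 1) (MvPolynomial.X 2)
    - P5hom (MvPolynomial.X 0) (MvPolynomial.X 3) (MvPolynomial.X 4)

/-- Setting `z = 1` in `F₅` gives back `f₅`. -/
theorem F5_dehomogenize (A : Type*) [CommRing A] :
    MvPolynomial.aeval (Fin.cons 1 MvPolynomial.X : Fin 5 → MvPolynomial (Fin 4) A) (F5 A)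
      = f5 A := by
  have h1 : (Fin.cons 1 MvPolynomial.X : Fin 5 → MvPolynomial (Fin 4) A) 1
      = MvPolynomial.X 0 := rfl
  have h2 : (Fin.cons 1 MvPolynomial.X : Fin 5 → MvPolynomial (Fin 4) A) 2
      = MvPolynomial.X 1 := rfl
  have h3 : (Fin.cons 1 MvPolynomial.X : Fin 5 → MvPolynomial (Fin 4) A) 3
      = MvPolynomial.X 2 := rfl
  have h4 : (Fin.cons 1 MvPolynomial.X : Fin 5 → MvPolynomial (Fin 4) A) 4
      = MvPolynomial.X 3 := rfl
  have h5 : (5 : MvPolynomial (Fin 5) A) = MvPolynomial.C 5 := (map_ofNat MvPolynomial.C 5).symm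
  have h5' : (5 : MvPolynomial (Fin 2) A) = MvPolynomial.C 5 := (map_ofNat MvPolynomial.C 5).symm
  simp [F5, f5, P5, P5hom, h1, h2, h3, h4, h5, h5']

theorem F5_isHomogeneous (A : Type*) [CommRing A] : (F5 A).IsHomogeneous 5 := by
  have hX (i : Fin 5) : (MvPolynomial.X i : MvPolynomial (Fin 5) A).IsHomogeneous 1 :=
    MvPolynomial.isHomogeneous_X _ _
  have h5 : (5 : MvPolynomial (Fin 5) A).IsHomogeneous 0 := by
    rw [← map_ofNat (MvPolynomial.C (σ := Fin 5) (R := A)) 5]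
    exact MvPolynomial.isHomogeneous_C _ _
  have key (i j : Fin 5) : (P5hom (MvPolynomial.X 0) (MvPolynomial.X i)
      (MvPolynomial.X j) : MvPolynomial (Fin 5) A).IsHomogeneous 5 := by
    have hxy := (h5.mul (hX i)).mul (hX j)
    have hs := ((hX i).pow 2).add ((hX j).pow 2)
    have hl := (hX i).add (hX j)
    exact (((((((hX i).pow 5).add ((hX j).pow 5)).sub ((hxy.mul hs).mul (hX 0))).add
      ((hxy.mul hl).mul ((hX 0).pow 2))).add ((h5.mul hs).mul ((hX 0).pow 3))).sub
      ((h5.mul hl).mul ((hX 0).pow 4)))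
  exact (key 1 2).sub (key 3 4)

/-- The ideal of the hypersurface `F₅ = 0`. -/
abbrev quinticIdeal (A : Type*) [CommRing A] : Ideal (MvPolynomial (Fin 5) A) :=
  Ideal.span {F5 A}

/-- The homogeneous coordinate ring `A[z, x₁, x₂, x₄, x₅] / (F₅)` of `X̄`. -/
abbrev CoordRing (A : Type*) [CommRing A] : Type _ :=
  MvPolynomial (Fin 5) A ⧸ quinticIdeal A

/-- The grading of the homogeneous coordinate ring of `X̄` by degree. -/
def grading (A : Type*) [CommRing A] (n : ℕ) : Submodule A (CoordRing A) :=
  (MvPolynomial.homogeneousSubmodule (Fin 5) A n).map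
    (Ideal.Quotient.mkₐ A (quinticIdeal A)).toLinearMap

attribute [local instance] MvPolynomial.gradedAlgebra

theorem quinticIdeal_isHomogeneous (A : Type*) [CommRing A] :
    (quinticIdeal A).IsHomogeneous (MvPolynomial.homogeneousSubmodule (Fin 5) A) := by
  apply Ideal.homogeneous_span
  rintro x rfl
  exact ⟨5, F5_isHomogeneous A⟩

instance (A : Type*) [CommRing A] : SetLike.GradedMonoid (grading A) where
  one_mem := ⟨1, SetLike.GradedOne.one_mem, map_one (Ideal.Quotient.mk (quinticIdeal A))⟩
  mul_mem := by
    rintro i j _ _ ⟨a, ha, rfl⟩ ⟨b, hb, rfl⟩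
    exact ⟨a * b, SetLike.GradedMul.mul_mem ha hb,
      map_mul (Ideal.Quotient.mk (quinticIdeal A)) a b⟩

/-- The class of a homogeneous polynomial, as an element of the graded piece. -/
def toGrading (A : Type*) [CommRing A] (n : ℕ) :
    MvPolynomial.homogeneousSubmodule (Fin 5) A n →+ grading A n :=
  ((Ideal.Quotient.mkₐ A (quinticIdeal A)).toLinearMap.submoduleMap
    (MvPolynomial.homogeneousSubmodule (Fin 5) A n)).toAddMonoidHom

/-- Decomposition of the class of a polynomial into its homogeneous components. -/
def decomposeQuot (A : Type*) [CommRing A] :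
    CoordRing A →+ DirectSum ℕ fun n => grading A n :=
  QuotientAddGroup.lift (quinticIdeal A).toAddSubgroup
    ((DirectSum.map (toGrading A)).comp
      (DirectSum.decomposeAddEquiv
        (MvPolynomial.homogeneousSubmodule (Fin 5) A)).toAddMonoidHom)
    (by
      intro x hx
      refine DFinsupp.ext fun n => Subtype.ext ?_
      exact Ideal.Quotient.eq_zero_iff_mem.mpr (quinticIdeal_isHomogeneous A n hx))

theorem decomposeQuot_mk {A : Type*} [CommRing A] {n : ℕ}
    (a : MvPolynomial.homogeneousSubmodule (Fin 5) A n) :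
    decomposeQuot A (Ideal.Quotient.mk (quinticIdeal A) (a : MvPolynomial (Fin 5) A))
      = DirectSum.of (fun n => grading A n) n (toGrading A n a) := by
  change DirectSum.map (toGrading A) (DirectSum.decompose
    (MvPolynomial.homogeneousSubmodule (Fin 5) A) (a : MvPolynomial (Fin 5) A)) = _
  rw [DirectSum.decompose_coe, DirectSum.map_of]

instance (A : Type*) [CommRing A] : GradedAlgebra (grading A) where
  toDecomposition := DirectSum.Decomposition.ofAddHom _ (decomposeQuot A)
    (by
      ext x
      obtain ⟨x, rfl⟩ := Ideal.Quotient.mk_surjective x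
      induction x using DirectSum.Decomposition.inductionOn
        (MvPolynomial.homogeneousSubmodule (Fin 5) A) with
      | zero => simp
      | homogeneous a =>
        rw [AddMonoidHom.comp_apply, decomposeQuot_mk, DirectSum.coeAddMonoidHom_of]
        rfl
      | add a b ha hb => rw [map_add, map_add, ha, hb, map_add])
    (by
      refine DirectSum.addHom_ext fun n y => ?_
      obtain ⟨_, a, ha, rfl⟩ := y
      rw [AddMonoidHom.comp_apply, DirectSum.coeAddMonoidHom_of]
      exact decomposeQuot_mk ⟨a, ha⟩)

/-- The projective quintic threefold `X̄ = Proj A[z, x₁, x₂, x₄, x₅] / (F₅)` over `A`, that is,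
the projective closure in `ℙ⁴` of the affine threefold `P₅(x₁, x₂) = P₅(x₄, x₅)`. -/
def Xbar (A : Type) [CommRing A] : Scheme.{0} :=
  Proj (grading A)

/-- The structure morphism of `X̄`. -/
def XbarHom (A : Type) [CommRing A] : Xbar A ⟶ Spec (.of A) :=
  Proj.toSpecZero (grading A) ≫ Spec.map (CommRingCat.ofHom (algebraMap A (grading A 0)))

/-! ### Singular locus, blow-up, good reduction -/

/-- The singular locus of a morphism: the closed set of points of the source at which the
morphism is not smooth. -/
def singularLocus {X S : Scheme.{0}} (f : X ⟶ S) : TopologicalSpace.Closeds X where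
  carrier := {x | ∀ U : X.Opens, x ∈ U → ¬ Smooth (U.ι ≫ f)}
  isClosed' := by
    rw [← isOpen_compl_iff, isOpen_iff_forall_mem_open]
    intro x hx
    simp only [Set.mem_compl_iff, Set.mem_ofPred_eq, not_forall, not_not] at hx
    obtain ⟨U, hxU, hU⟩ := hx
    exact ⟨U, fun y hy h => h U hy hU, U.isOpen, hxU⟩

/-- The ideal sheaf `I` is invertible (it is the ideal of an effective Cartier divisor):
locally it is generated by one nonzerodivisor. -/
def IsInvertibleIdeal {X : Scheme.{0}} (I : X.IdealSheafData) : Prop :=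
  ∀ x : X, ∃ U : X.affineOpens, x ∈ U.1 ∧
    ∃ s ∈ nonZeroDivisors Γ(X, U), I.ideal U = Ideal.span {s}

/-- `π : Y ⟶ X` is the blow-up of `X` along (the closed subscheme defined by) the ideal sheaf `I`:
the inverse image ideal sheaf of `I` on `Y` is invertible, and `π` is universal (terminal) among
the morphisms to `X` with this property. -/
structure IsBlowup {X Y : Scheme.{0}} (I : X.IdealSheafData) (π : Y ⟶ X) : Prop where
  isInvertible : IsInvertibleIdeal (I.comap π)
  existsUnique_lift : ∀ {T : Scheme.{0}} (f : T ⟶ X), IsInvertibleIdeal (I.comap f) →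
    ∃! g : T ⟶ Y, g ≫ π = f

/-- `π : Xt ⟶ X̄` is the blow-up of the quintic threefold `X̄` over `ℚ` along its singular locus
with the reduced scheme structure (that is, the blow-up of the nodes). -/
def IsXtilde {Xt : Scheme.{0}} (π : Xt ⟶ Xbar ℚ) : Prop :=
  IsBlowup (Scheme.IdealSheafData.vanishingIdeal (singularLocus (XbarHom ℚ))) π

/-- The scheme `X` over `ℚ` has good reduction at the prime `p`: it is the generic fibre of a
smooth proper scheme over the valuation ring `ℤ_(p) = {x ∈ ℚ : v_p(x) ≥ 0}`. -/
def HasGoodReductionAt {X : Scheme.{0}} (f : X ⟶ Spec (.of ℚ)) (p : ℕ) [Fact p.Prime] : Prop :=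
  ∃ (M : Scheme.{0}) (m : M ⟶ Spec (.of (Rat.padicValuation p).valuationSubring)) (i : X ⟶ M),
    IsProper m ∧ Smooth m ∧
      IsPullback i f m
        (Spec.map (CommRingCat.ofHom (algebraMap (Rat.padicValuation p).valuationSubring ℚ)))

end ChebyshevQuintic

end

open AlgebraicGeometry CategoryTheory CategoryTheory.Limits
noncomputable section
namespace ChebyshevQuintic

attribute [local instance] MvPolynomial.gradedAlgebra

/-! ### Ideal sheaves on spectra -/

/-! Everything rests on one polynomial identity, `quintic_certificate`. Write `q₁`, `q₂` for the
partial derivatives of `P₅` divided by `5`, and `χ(t) = (t + 2)(t + 3)(t - 6)`. Then `χ(P₅)` is a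
quadratic form in `q₁`, `q₂` with integral polynomial coefficients. Hence every critical value is a
root of `χ`. Modulo `q₁`, `q₂`, the matrix of this form (with doubled diagonal) times the Jacobian
matrix of `(q₁, q₂)` is `5χ'(P₅)` times the identity. The numbers `χ'(-2) = -8`, `χ'(-3) = 9` and
`χ'(6) = 72` involve only the primes `2` and `3`, so once `30` is invertible both the Hessian and
the quadratic form are nondegenerate at every critical point.

Subtracting two copies of the identity gives `c * f₅ = gᵀ M g`, where `g` consists of the partial
derivatives of `f₅` up to units and `c`, `det M`, `det (∂g)` do not vanish at the nodes
(`nodeCofactor_mul`, `node_conditions`). In a chart of the blow-up along `(g)` one has `g = T u`,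
`u_j = 1`, and the strict transform is `uᵀ M u = 0`. The Jacobian criterion shows that these
equations are smooth near `T = 0` (`exists_mulVec_eq`, `nodeChart_smooth`). Where `T` is invertible,
a partial derivative of `f₅` is invertible and the hypersurface itself is smooth. This works over
any base in which `30` is a unit (`reesBlowup_smooth`).

Near the hyperplane `z = 0` the quintic is a perturbation of the Fermat form `x₁⁵ + x₂⁵ - x₄⁵ -
x₅⁵`, hence smooth when `5` is invertible. Glueing this part to the affine blow-up gives a smooth
proper scheme over `ℤ_(p)` (`exists_nodeBlowup`). Since `ℚ` is `ℤ_(p)` with `p` inverted, its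
generic fibre is an open restriction and is again the blow-up of the nodes. Over `ℚ` the ideal of
the nodes is the reduced ideal of the singular locus (`vanishingIdeal_singularLocus`): the Jacobian
criterion identifies the supports, and the invertible determinant of `∂g` makes the scheme of nodes
unramified, hence reduced.

The critical points are found by hand. The difference of the two critical equations splits into
linear factors and a conic, and on each branch the remaining equation splits by means of roots of
unity of orders `3` and `5` (`critical_cases`). The resulting sixteen expressions are distinct in
every domain where `30 ≠ 0`. Ring homomorphisms preserve the expressions, which gives the counts and
all the bijections at once (`ncard_critPts`, `bijOn_critPts`). -/

/-- The ideal sheaf on `Spec R` defined by the ideal `J`. -/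
def specIdeal {R : CommRingCat.{0}} (J : Ideal R) : (Spec R).IdealSheafData :=
  (Spec.map (CommRingCat.ofHom (Ideal.Quotient.mk J))).ker

theorem isPushout_quotient_map {R C : CommRingCat.{0}} (φ : R ⟶ C) (J : Ideal R) :
    IsPushout φ (CommRingCat.ofHom (Ideal.Quotient.mk J))
      (CommRingCat.ofHom (Ideal.Quotient.mk (J.map φ.hom)))
      (CommRingCat.ofHom (Ideal.quotientMap (J.map φ.hom) φ.hom Ideal.le_comap_map)) := by
  refine ⟨⟨?_⟩, ⟨PushoutCocone.IsColimit.mk _ (fun s => CommRingCat.ofHom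
    (Ideal.Quotient.lift (J.map φ.hom) s.inl.hom ?_)) ?_ ?_ ?_⟩⟩
  · ext x; simp
  · intro a ha
    have hle : J.map φ.hom ≤ RingHom.ker s.inl.hom := by
      rw [Ideal.map_le_iff_le_comap]
      intro x hx
      have h := congr($(s.condition).hom x)
      simp only [CommRingCat.hom_comp, RingHom.comp_apply, CommRingCat.hom_ofHom,
        Ideal.Quotient.eq_zero_iff_mem.mpr hx, map_zero] at h
      exact h
    exact hle ha
  · intro s; ext x; rfl
  · intro s
    ext x
    exact congr($(s.condition).hom x)
  · intro s m h1 h2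
    ext x
    exact congr($(h1).hom x)

/-- The fibre product of `Spec C` with the closed subscheme of `J` is the spectrum of the pushout `C
⧸ J C`; the pulled back ideal sheaf is the kernel of its inclusion. -/
theorem specIdeal_comap {R C : CommRingCat.{0}} (φ : R ⟶ C) (J : Ideal R) :
    (specIdeal J).comap (Spec.map φ) = specIdeal (J.map φ.hom) := by
  have hp := isPullback_SpecMap_of_isPushout _ _ _ _ (isPushout_quotient_map φ J)
  rw [specIdeal, ← Scheme.IdealSheafData.ker_fst_of_isClosedImmersion, specIdeal,
    ← hp.isoPullback_hom_fst, Scheme.Hom.ker_comp_of_isIso]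

/-- The ideal of global sections of an ideal sheaf on a spectrum. -/
def globalIdeal {R : CommRingCat.{0}} (I : (Spec R).IdealSheafData) : Ideal R :=
  (I.ideal ⟨⊤, isAffineOpen_top _⟩).comap (Scheme.ΓSpecIso R).inv.hom

theorem globalIdeal_specIdeal {R : CommRingCat.{0}} (J : Ideal R) :
    globalIdeal (specIdeal J) = J := by
  ext x
  rw [globalIdeal, specIdeal, Scheme.Hom.ker_apply, Ideal.mem_comap, RingHom.mem_ker]
  have h := Scheme.ΓSpecIso_inv_naturality
    (show R ⟶ CommRingCat.of (R ⧸ J) from CommRingCat.ofHom (Ideal.Quotient.mk J))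
  have h2 := congr($(h).hom x)
  simp only [CommRingCat.hom_comp, RingHom.comp_apply, CommRingCat.hom_ofHom] at h2
  change (Spec.map (CommRingCat.ofHom (Ideal.Quotient.mk J))).appTop.hom _ = 0 ↔ _
  erw [← h2]
  rw [← Ideal.Quotient.eq_zero_iff_mem]
  exact map_eq_zero_iff _ (ConcreteCategory.bijective_of_isIso
    (Scheme.ΓSpecIso (CommRingCat.of (R ⧸ J))).inv).1

theorem specIdeal_globalIdeal {R : CommRingCat.{0}} (I : (Spec R).IdealSheafData) :
    specIdeal (globalIdeal I) = I := by
  apply Scheme.IdealSheafData.ext_of_isAffine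
  have h := globalIdeal_specIdeal (globalIdeal I)
  conv at h => rhs; rw [globalIdeal]
  conv at h => lhs; rw [globalIdeal]
  exact Ideal.comap_injective_of_surjective _
    (ConcreteCategory.bijective_of_isIso (Scheme.ΓSpecIso R).inv).2 h

theorem specIdeal_injective {R : CommRingCat.{0}} {J J' : Ideal R}
    (h : specIdeal J = specIdeal J') : J = J' := by
  rw [← globalIdeal_specIdeal J, h, globalIdeal_specIdeal]

/-- This translates between sections of an ideal sheaf over an affine open and its pullback to a
spectrum, so that later arguments deal with ideals of rings only. -/
theorem comap_fromSpec {X : Scheme.{0}} (I : X.IdealSheafData) {U : X.Opens}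
    (hU : IsAffineOpen U) : I.comap hU.fromSpec = specIdeal (I.ideal ⟨U, hU⟩) := by
  rw [← specIdeal_globalIdeal (I.comap hU.fromSpec)]
  congr 1
  have hW : hU.fromSpec ''ᵁ ⊤ ≤ U := by simp
  have hW' : (⟨hU.fromSpec ''ᵁ ⊤, (isAffineOpen_top _).image_of_isOpenImmersion _⟩ :
      X.affineOpens) ≤ ⟨U, hU⟩ := hW
  rw [globalIdeal, Scheme.IdealSheafData.ideal_comap_of_isOpenImmersion, ← I.map_ideal hW',
    Ideal.comap_comap, ← CommRingCat.hom_comp]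
  have key : (Scheme.ΓSpecIso Γ(X, U)).inv ≫ (hU.fromSpec.appIso ⊤).inv =
      X.presheaf.map (homOfLE hW).op := by
    rw [Iso.comp_inv_eq, Scheme.Hom.appIso_hom, Scheme.Hom.naturality_assoc,
      hU.fromSpec_app_self, Category.assoc, ← Functor.map_comp, ← Functor.map_comp]
    refine (Category.comp_id _).symm.trans ?_
    congr 1
  have hiso : IsIso (X.presheaf.map (homOfLE hW).op) := by
    rw [← key]; infer_instance
  rw [key]
  exact Ideal.comap_map_of_bijective _ (ConcreteCategory.bijective_of_isIso _)

/-! ### Invertible ideal sheaves -/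

theorem ideal_ext_of_cover {X : Scheme.{0}} {I I' : X.IdealSheafData} {ι : Type*}
    (U : ι → Scheme.{0}) (j : ∀ i, U i ⟶ X) [∀ i, IsOpenImmersion (j i)]
    (hj : ∀ x, ∃ i, x ∈ Set.range (j i)) (h : ∀ i, I.comap (j i) = I'.comap (j i)) : I = I' := by
  let W : (Σ i, (U i).affineOpens) → X.affineOpens := fun p =>
    ⟨j p.1 ''ᵁ p.2.1, p.2.2.image_of_isOpenImmersion (j p.1)⟩
  apply Scheme.IdealSheafData.ext_of_iSup_eq_top W
  · rw [eq_top_iff]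
    rintro x -
    obtain ⟨i, y, rfl⟩ := hj x
    obtain ⟨_, ⟨V, hV, rfl⟩, hy, -⟩ :=
      (U i).isBasis_affineOpens.exists_subset_of_mem_open (Set.mem_univ y) isOpen_univ
    exact TopologicalSpace.Opens.mem_iSup.mpr ⟨⟨i, ⟨V, hV⟩⟩, ⟨y, hy, rfl⟩⟩
  · rintro ⟨i, V⟩
    have h1 := congr(Scheme.IdealSheafData.ideal $(h i) V)
    rw [Scheme.IdealSheafData.ideal_comap_of_isOpenImmersion,
      Scheme.IdealSheafData.ideal_comap_of_isOpenImmersion] at h1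
    exact Ideal.comap_injective_of_surjective _
      (ConcreteCategory.bijective_of_isIso ((j i).appIso V.1).inv).2 h1

/-- Arbitrary open immersions from spectra may serve as charts instead of affine opens. In this form
invertibility can be transported through ring homomorphisms. -/
theorem isInvertibleIdeal_iff {X : Scheme.{0}} {I : X.IdealSheafData} :
    IsInvertibleIdeal I ↔ ∀ x : X, ∃ (C : CommRingCat.{0}) (j : Spec C ⟶ X),
      IsOpenImmersion j ∧ x ∈ Set.range j ∧
        ∃ s ∈ nonZeroDivisors C, I.comap j = specIdeal (Ideal.span {s}) := by
  refine ⟨fun h x => ?_, fun h x => ?_⟩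
  · obtain ⟨⟨U, hU : IsAffineOpen U⟩, hx, s, hs, hI⟩ := h x
    refine ⟨Γ(X, U), hU.fromSpec, inferInstance, ?_, s, hs, ?_⟩
    · rw [hU.range_fromSpec]; exact hx
    · rw [comap_fromSpec, hI]
  · obtain ⟨C, j, hj, hx, s, hs, hI⟩ := h x
    have hU : IsAffineOpen j.opensRange := isAffineOpen_opensRange j
    let e : Spec Γ(X, j.opensRange) ≅ Spec C :=
      IsOpenImmersion.isoOfRangeEq hU.fromSpec j (by rw [hU.range_fromSpec]; rfl)
    let φ : C ⟶ Γ(X, j.opensRange) := Spec.preimage e.hom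
    have hφ : Spec.map φ ≫ j = hU.fromSpec := by
      rw [Spec.map_preimage]; exact IsOpenImmersion.isoOfRangeEq_hom_fac _ _ _
    have hiso : IsIso φ := by
      refine ⟨Spec.preimage e.inv, Spec.map_injective ?_, Spec.map_injective ?_⟩ <;> simp [φ]
    refine ⟨⟨_, hU⟩, hx, φ.hom s, ?_, ?_⟩
    · have hb := ConcreteCategory.bijective_of_isIso φ
      rw [mem_nonZeroDivisors_iff_right]
      intro y hy
      obtain ⟨z, rfl⟩ := hb.2 y
      rw [← map_mul, map_eq_zero_iff _ hb.1] at hy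
      rw [(mem_nonZeroDivisors_iff_right.mp hs) z hy, map_zero]
    · apply specIdeal_injective
      rw [← comap_fromSpec, ← hφ, Scheme.IdealSheafData.comap_comp, hI, specIdeal_comap,
        Ideal.map_span, Set.image_singleton]

/-- A point of an affine chart has arbitrarily small basic open neighbourhoods. -/
theorem exists_basicOpen_lift {T X : Scheme.{0}} (k : T ⟶ X) [IsOpenImmersion k] (t : T)
    {C : CommRingCat.{0}} (j : Spec C ⟶ X) (ht : k t ∈ Set.range j) :
    ∃ (r : C) (j' : Spec (CommRingCat.of (Localization.Away r)) ⟶ T),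
      t ∈ Set.range j' ∧
      j' ≫ k = Spec.map (CommRingCat.ofHom (algebraMap C (Localization.Away r))) ≫ j := by
  obtain ⟨y, hy⟩ := ht
  have hopen : IsOpen (j ⁻¹' Set.range k) := k.isOpenEmbedding.isOpen_range.preimage j.continuous
  obtain ⟨_, ⟨_, ⟨r, rfl⟩, rfl⟩, hyr, hle⟩ :=
    PrimeSpectrum.isBasis_basic_opens.exists_subset_of_mem_open
      (show y ∈ j ⁻¹' Set.range k from ⟨t, hy.symm⟩) hopen
  have hrange : Set.range (Spec.map (CommRingCat.ofHom (algebraMap C (Localization.Away r))))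
      = (PrimeSpectrum.basicOpen r : Set (PrimeSpectrum C)) :=
    PrimeSpectrum.localization_away_comap_range _ r
  have hsub : Set.range (Spec.map (CommRingCat.ofHom (algebraMap C (Localization.Away r))) ≫ j)
      ⊆ Set.range k := by
    rintro _ ⟨z, rfl⟩
    rw [Scheme.Hom.comp_apply]
    apply hle
    rw [← hrange]
    exact ⟨z, rfl⟩
  refine ⟨r, IsOpenImmersion.lift k _ hsub, ?_, IsOpenImmersion.lift_fac _ _ _⟩
  have hy' : y ∈ Set.range
      (Spec.map (CommRingCat.ofHom (algebraMap C (Localization.Away r)))) := by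
    rw [hrange]; exact hyr
  obtain ⟨z, hz⟩ := hy'
  refine ⟨z, k.isOpenEmbedding.injective ?_⟩
  rw [← Scheme.Hom.comp_apply, IsOpenImmersion.lift_fac, Scheme.Hom.comp_apply, hz, hy]

theorem algebraMap_mem_nonZeroDivisors_away {C : Type*} [CommRing C] {s : C}
    (hs : s ∈ nonZeroDivisors C) (r : C) :
    algebraMap C (Localization.Away r) s ∈ nonZeroDivisors (Localization.Away r) :=
  IsLocalization.map_nonZeroDivisors_le (Submonoid.powers r) _ (Submonoid.mem_map_of_mem _ hs)

/-- Local generators pass to basic opens inside the smaller scheme, and a nonzerodivisor stays one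
under localization. -/
theorem IsInvertibleIdeal.comap {T X : Scheme.{0}} {I : X.IdealSheafData}
    (h : IsInvertibleIdeal I) (k : T ⟶ X) [IsOpenImmersion k] : IsInvertibleIdeal (I.comap k) := by
  rw [isInvertibleIdeal_iff] at h ⊢
  intro t
  obtain ⟨C, j, hj, ht, s, hs, hI⟩ := h (k t)
  obtain ⟨r, j', htj, hfac⟩ := exists_basicOpen_lift k t j ht
  refine ⟨_, j', ?_, htj, _, algebraMap_mem_nonZeroDivisors_away hs r, ?_⟩
  · have : IsOpenImmersion (j' ≫ k) := by rw [hfac]; infer_instance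
    exact IsOpenImmersion.of_comp j' k
  · rw [← Scheme.IdealSheafData.comap_comp, hfac, Scheme.IdealSheafData.comap_comp, hI,
      specIdeal_comap, Ideal.map_span, Set.image_singleton]
    rfl

theorem isInvertibleIdeal_of_cover {X : Scheme.{0}} {I : X.IdealSheafData} {ι : Type*}
    (U : ι → Scheme.{0}) (j : ∀ i, U i ⟶ X) [∀ i, IsOpenImmersion (j i)]
    (hj : ∀ x, ∃ i, x ∈ Set.range (j i)) (h : ∀ i, IsInvertibleIdeal (I.comap (j i))) :
    IsInvertibleIdeal I := by
  rw [isInvertibleIdeal_iff]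
  intro x
  obtain ⟨i, y, rfl⟩ := hj x
  obtain ⟨C, k, hk, ⟨z, rfl⟩, s, hs, hI⟩ := isInvertibleIdeal_iff.mp (h i) y
  refine ⟨C, k ≫ j i, inferInstance, ⟨z, by rw [Scheme.Hom.comp_apply]⟩, s, hs, ?_⟩
  rw [Scheme.IdealSheafData.comap_comp, hI]

theorem isInvertibleIdeal_top {X : Scheme.{0}} : IsInvertibleIdeal (⊤ : X.IdealSheafData) := by
  intro x
  obtain ⟨_, ⟨V, hV, rfl⟩, hx, -⟩ :=
    X.isBasis_affineOpens.exists_subset_of_mem_open (Set.mem_univ x) isOpen_univ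
  exact ⟨⟨V, hV⟩, hx, 1, one_mem _, by simp [Scheme.IdealSheafData.ideal_top]⟩

/-! ### Formal properties of blow-ups -/

theorem IsBlowup.hom_ext {X Y T : Scheme.{0}} {I : X.IdealSheafData} {π : Y ⟶ X}
    (h : IsBlowup I π) {g₁ g₂ : T ⟶ Y} (hI : IsInvertibleIdeal (I.comap (g₁ ≫ π)))
    (hg : g₁ ≫ π = g₂ ≫ π) : g₁ = g₂ :=
  (h.existsUnique_lift (g₁ ≫ π) hI).unique rfl hg.symm

/-- A test map into the open `V` is also a test map into `X`; its lift to `Y` and the map to `V`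
together give the lift to the fibre product. -/
theorem IsBlowup.of_isPullback {X Y V Y' : Scheme.{0}} {I : X.IdealSheafData} {π : Y ⟶ X}
    (h : IsBlowup I π) {π' : Y' ⟶ V} {k : Y' ⟶ Y} {j : V ⟶ X} [IsOpenImmersion j]
    (hp : IsPullback π' k j π) : IsBlowup (I.comap j) π' where
  isInvertible := by
    have : IsOpenImmersion k := MorphismProperty.of_isPullback hp ‹_›
    rw [← Scheme.IdealSheafData.comap_comp, hp.w, Scheme.IdealSheafData.comap_comp]
    exact h.isInvertible.comap k
  existsUnique_lift := by
    intro T f hf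
    rw [← Scheme.IdealSheafData.comap_comp] at hf
    obtain ⟨g, hg, -⟩ := h.existsUnique_lift (f ≫ j) hf
    refine ⟨hp.lift f g hg.symm, hp.lift_fst _ _ _, fun g' hg' => ?_⟩
    have hw : g' ≫ k ≫ π = f ≫ j := by rw [← hp.w, ← Category.assoc, hg']
    apply hp.hom_ext
    · rw [hg', hp.lift_fst]
    · rw [hp.lift_snd]
      apply h.hom_ext
      · rw [Category.assoc, hw]; exact hf
      · rw [Category.assoc, hw, hg]

theorem isBlowup_of_isIso {X Y : Scheme.{0}} {I : X.IdealSheafData} (π : Y ⟶ X) [IsIso π]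
    (hI : IsInvertibleIdeal I) : IsBlowup I π where
  isInvertible := hI.comap π
  existsUnique_lift f _ := ⟨f ≫ inv π, by simp, fun g hg => by simp [← hg]⟩

/-- When the ideal is already invertible, the identity of `X` is a test map, and its lift is an
inverse of `π`. -/
theorem IsBlowup.isIso {X Y : Scheme.{0}} {I : X.IdealSheafData} {π : Y ⟶ X}
    (h : IsBlowup I π) (hI : IsInvertibleIdeal I) : IsIso π := by
  obtain ⟨s, hs, -⟩ := h.existsUnique_lift (𝟙 X) (by rwa [Scheme.IdealSheafData.comap_id])
  refine ⟨s, h.hom_ext ?_ ?_, hs⟩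
  · rw [Category.assoc, hs, Category.comp_id]; exact h.isInvertible
  · rw [Category.assoc, hs, Category.comp_id, Category.id_comp]

theorem IsBlowup.exists_iso {X Y Y' : Scheme.{0}} {I : X.IdealSheafData} {π : Y ⟶ X}
    {π' : Y' ⟶ X} (h : IsBlowup I π) (h' : IsBlowup I π') : ∃ e : Y ≅ Y', e.hom ≫ π' = π := by
  obtain ⟨a, ha, -⟩ := h'.existsUnique_lift π h.isInvertible
  obtain ⟨b, hb, -⟩ := h.existsUnique_lift π' h'.isInvertible
  refine ⟨⟨a, b, h.hom_ext ?_ ?_, h'.hom_ext ?_ ?_⟩, ha⟩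
  · rw [Category.assoc, hb, ha]; exact h.isInvertible
  · rw [Category.assoc, hb, ha, Category.id_comp]
  · rw [Category.assoc, ha, hb]; exact h'.isInvertible
  · rw [Category.assoc, ha, hb, Category.id_comp]

/-- Uniqueness of lifts and local existence of lifts suffice for the universal property of the
blow-up. -/
theorem isBlowup_of_local {X Y : Scheme.{0}} {I : X.IdealSheafData} {π : Y ⟶ X}
    (hinv : IsInvertibleIdeal (I.comap π))
    (huniq : ∀ {T : Scheme.{0}} (g₁ g₂ : T ⟶ Y), IsInvertibleIdeal (I.comap (g₁ ≫ π)) →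
      g₁ ≫ π = g₂ ≫ π → g₁ = g₂)
    (hex : ∀ {T : Scheme.{0}} (f : T ⟶ X), IsInvertibleIdeal (I.comap f) → ∀ t : T,
      ∃ (T' : Scheme.{0}) (k : T' ⟶ T), IsOpenImmersion k ∧ t ∈ Set.range k ∧
        ∃ g : T' ⟶ Y, g ≫ π = k ≫ f) : IsBlowup I π where
  isInvertible := hinv
  existsUnique_lift := by
    intro T f hf
    choose T' k hk ht g hg using hex f hf
    let 𝒰 : T.OpenCover := Scheme.Cover.mkOfCovers T T' k (fun t => ⟨t, ht t⟩) hk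
    -- On overlaps the pulled back ideal is still invertible, so uniqueness of lifts supplies the
    -- compatibility needed for glueing.
    have hc (x y : T) : pullback.fst (k x) (k y) ≫ g x = pullback.snd (k x) (k y) ≫ g y := by
      apply huniq
      · rw [Category.assoc, hg, ← Category.assoc, Scheme.IdealSheafData.comap_comp]
        exact hf.comap _
      · rw [Category.assoc, Category.assoc, hg, hg, pullback.condition_assoc]
    have hglue : 𝒰.glueMorphisms g hc ≫ π = f := by
      refine 𝒰.hom_ext _ _ fun t => ?_
      exact (Scheme.Cover.ι_glueMorphisms_assoc 𝒰 g hc t π).trans (hg t)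
    refine ⟨𝒰.glueMorphisms g hc, hglue, fun g' hg' => huniq _ _ ?_ ?_⟩
    · rw [hg']; exact hf
    · rw [hg', hglue]

/-- Being the blow-up is local on the base. -/
theorem isBlowup_of_cover {X Y : Scheme.{0}} {I : X.IdealSheafData} {π : Y ⟶ X} {ι : Type*}
    {V W : ι → Scheme.{0}} (j : ∀ i, V i ⟶ X) [∀ i, IsOpenImmersion (j i)]
    (hj : ∀ x, ∃ i, x ∈ Set.range (j i)) (p : ∀ i, W i ⟶ V i) (k : ∀ i, W i ⟶ Y)
    (hp : ∀ i, IsPullback (p i) (k i) (j i) π) (h : ∀ i, IsBlowup (I.comap (j i)) (p i)) :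
    IsBlowup I π := by
  have hk (i) : IsOpenImmersion (k i) := MorphismProperty.of_isPullback (hp i) inferInstance
  have hlift {T : Scheme.{0}} (f : T ⟶ X) (t : T) (i : ι) (hi : f t ∈ Set.range (j i)) :
      t ∈ Set.range (pullback.fst f (j i)) := by
    obtain ⟨v, hv⟩ := hi
    obtain ⟨z, hz, -⟩ := Scheme.Pullback.exists_preimage_pullback t v hv.symm
    exact ⟨z, hz⟩
  have hfst {T : Scheme.{0}} (f : T ⟶ X) (i : ι) : IsOpenImmersion (pullback.fst f (j i)) :=
    inferInstance
  refine isBlowup_of_local ?_ ?_ ?_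
  · refine isInvertibleIdeal_of_cover W k ?_ fun i => ?_
    · intro y
      obtain ⟨i, hi⟩ := hj (π y)
      obtain ⟨v, hv⟩ := hi
      obtain ⟨z, -, hz⟩ := Scheme.exists_preimage_of_isPullback (hp i) v y hv
      exact ⟨i, z, hz⟩
    · rw [← Scheme.IdealSheafData.comap_comp, ← (hp i).w, Scheme.IdealSheafData.comap_comp]
      exact (h i).isInvertible
  · intro T g₁ g₂ hI hg
    let 𝒰 : T.OpenCover := Scheme.Cover.mkOfCovers ι (fun i => pullback (g₁ ≫ π) (j i))
      (fun i => pullback.fst (g₁ ≫ π) (j i))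
      (fun t => by
        obtain ⟨i, hi⟩ := hj ((g₁ ≫ π) t)
        exact ⟨i, hlift _ t i hi⟩)
      (fun i => hfst (g₁ ≫ π) i)
    refine 𝒰.hom_ext _ _ fun i => ?_
    change pullback.fst (g₁ ≫ π) (j i) ≫ g₁ = pullback.fst (g₁ ≫ π) (j i) ≫ g₂
    have e1 : pullback.snd (g₁ ≫ π) (j i) ≫ j i = (pullback.fst (g₁ ≫ π) (j i) ≫ g₁) ≫ π := by
      rw [← pullback.condition, Category.assoc]
    have e2 : pullback.snd (g₁ ≫ π) (j i) ≫ j i = (pullback.fst (g₁ ≫ π) (j i) ≫ g₂) ≫ π := by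
      rw [Category.assoc, ← hg, ← pullback.condition]
    have : (hp i).lift _ _ e1 = (hp i).lift _ _ e2 := by
      apply (h i).hom_ext
      · rw [IsPullback.lift_fst, ← Scheme.IdealSheafData.comap_comp, ← pullback.condition,
          Scheme.IdealSheafData.comap_comp]
        have := hfst (g₁ ≫ π) i
        exact hI.comap _
      · rw [IsPullback.lift_fst, IsPullback.lift_fst]
    rw [← (hp i).lift_snd _ _ e1, this, (hp i).lift_snd]
  · intro T f hf t
    obtain ⟨i, hi⟩ := hj (f t)
    have hinv : IsInvertibleIdeal ((I.comap (j i)).comap (pullback.snd f (j i))) := by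
      rw [← Scheme.IdealSheafData.comap_comp, ← pullback.condition,
        Scheme.IdealSheafData.comap_comp]
      exact hf.comap _
    obtain ⟨g, hg, -⟩ := (h i).existsUnique_lift _ hinv
    refine ⟨_, pullback.fst f (j i), inferInstance, hlift f t i hi, g ≫ k i, ?_⟩
    rw [Category.assoc, ← (hp i).w, ← Category.assoc, hg, pullback.condition]

/-! ### Glueing along open immersions -/

theorem isOpenImmersion_colimit_ι (F : WalkingSpan ⥤ Scheme.{0})
    [∀ {i j : WalkingSpan} (f : i ⟶ j), IsOpenImmersion (F.map f)]
    [(F ⋙ Scheme.forget).IsLocallyDirected] (i : WalkingSpan) :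
    IsOpenImmersion (colimit.ι F i) :=
  inferInstance

theorem exists_pushout_of_isOpenImmersion {W A B : Scheme.{0}} (a : W ⟶ A) (b : W ⟶ B)
    [IsOpenImmersion a] [IsOpenImmersion b] :
    ∃ (P : Scheme.{0}) (i : A ⟶ P) (j : B ⟶ P), IsOpenImmersion i ∧ IsOpenImmersion j ∧
      IsPushout a b i j ∧ ∀ x, x ∈ Set.range i ∨ x ∈ Set.range j := by
  have hF : ∀ {i j : WalkingSpan} (f : i ⟶ j), IsOpenImmersion ((span a b).map f) := by
    rintro _ _ (_ | (_ | _))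
    · infer_instance
    · exact ‹IsOpenImmersion a›
    · exact ‹IsOpenImmersion b›
  have hF' : (span a b ⋙ Scheme.forget).IsLocallyDirected :=
    Scheme.IsLocallyDirected.instIsLocallyDirectedWidePushoutShapeCompForgetOfIsOpenImmersionMap (span a b)
  have : HasPushout a b := Scheme.IsLocallyDirected.instHasColimit (span a b)
  refine ⟨pushout a b, pushout.inl a b, pushout.inr a b,
    isOpenImmersion_colimit_ι (span a b) WalkingSpan.left,
    isOpenImmersion_colimit_ι (span a b) WalkingSpan.right,
    IsPushout.of_hasPushout a b, fun x => ?_⟩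
  obtain ⟨(_ | (_ | _)), y, rfl⟩ := Scheme.IsLocallyDirected.ι_jointly_surjective (span a b) x
  · exact Or.inl ⟨a y, congr($(colimit.w (span a b) WalkingSpan.Hom.fst) y)⟩
  · exact Or.inl ⟨y, rfl⟩
  · exact Or.inr ⟨y, rfl⟩

/-- If the base is covered by two opens, on one of which the ideal is trivial and on the other of
which the blow-up exists, then the blow-up exists. -/
theorem exists_isBlowup_of_cover {X V Y : Scheme.{0}} (I : X.IdealSheafData) (j : V ⟶ X)
    [IsOpenImmersion j] (U : X.Opens) (hcov : ∀ x, x ∈ Set.range j ∨ x ∈ U)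
    (hU : I.comap U.ι = ⊤) (ρ : Y ⟶ V) (hρ : IsBlowup (I.comap j) ρ) :
    ∃ (M : Scheme.{0}) (π : M ⟶ X) (i : Y ⟶ M) (b : U.toScheme ⟶ M), IsBlowup I π ∧
      IsPullback ρ i j π ∧ IsPullback (𝟙 U.toScheme) b U.ι π := by
  let W₀ : V.Opens := j ⁻¹ᵁ U
  -- On the overlap of the two opens the ideal is trivial, so the blow-up is an isomorphism there.
  -- This identifies the part of `Y` over the overlap with an open subscheme of `U`, along which `Y`
  -- and `U` are glued.
  have hW₀ : IsBlowup ((I.comap j).comap W₀.ι) (ρ ∣_ W₀) :=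
    hρ.of_isPullback (isPullback_morphismRestrict ρ W₀)
  have htop : (I.comap j).comap W₀.ι = ⊤ := by
    rw [← Scheme.IdealSheafData.comap_comp, ← morphismRestrict_ι j U,
      Scheme.IdealSheafData.comap_comp, hU, Scheme.IdealSheafData.comap_top]
  have hiso : IsIso (ρ ∣_ W₀) := hW₀.isIso (by rw [htop]; exact isInvertibleIdeal_top)
  let b : (ρ ⁻¹ᵁ W₀).toScheme ⟶ U.toScheme := (ρ ∣_ W₀) ≫ (j ∣_ U)
  have hb : b ≫ U.ι = (ρ ⁻¹ᵁ W₀).ι ≫ ρ ≫ j := by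
    rw [Category.assoc, morphismRestrict_ι, ← Category.assoc, ← Category.assoc, morphismRestrict_ι]
  have hbo : IsOpenImmersion b := by
    infer_instance
  obtain ⟨M, i, b', hi, hb', hP, hsurj⟩ := exists_pushout_of_isOpenImmersion (ρ ⁻¹ᵁ W₀).ι b
  let π : M ⟶ X := hP.desc (ρ ≫ j) U.ι hb.symm
  have h1 : i ≫ π = ρ ≫ j := hP.inl_desc _ _ _
  have h2 : b' ≫ π = U.ι := hP.inr_desc _ _ _
  have hp1 : IsPullback ρ i j π := by
    refine IsOpenImmersion.isPullback _ _ _ _ h1 (le_antisymm ?_ ?_)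
    · intro x hx
      obtain ⟨v, hv⟩ : π x ∈ Set.range j := hx
      rcases hsurj x with ⟨y, rfl⟩ | ⟨u, rfl⟩
      · exact ⟨y, rfl⟩
      · rw [← Scheme.Hom.comp_apply, h2] at hv
        have hvW : v ∈ W₀ := by
          change j v ∈ U
          rw [hv]; exact u.2
        obtain ⟨w, hw⟩ := (ρ ∣_ W₀).surjective ⟨v, hvW⟩
        refine ⟨(ρ ⁻¹ᵁ W₀).ι w, ?_⟩
        rw [← Scheme.Hom.comp_apply, hP.w, Scheme.Hom.comp_apply]
        congr 1
        apply U.ι.isOpenEmbedding.injective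
        rw [← hv, Scheme.Hom.comp_apply, hw]
        exact congr($(morphismRestrict_ι j U) (⟨v, hvW⟩ : W₀.toScheme))
    · rintro _ ⟨y, rfl⟩
      change π (i y) ∈ Set.range j
      rw [← Scheme.Hom.comp_apply, h1]
      exact ⟨ρ y, rfl⟩
  have hp2 : IsPullback (𝟙 U.toScheme) b' U.ι π := by
    refine IsOpenImmersion.isPullback _ _ _ _ (by rw [h2, Category.id_comp]) (le_antisymm ?_ ?_)
    · intro x hx
      rcases hsurj x with ⟨y, rfl⟩ | ⟨u, rfl⟩
      · obtain ⟨u, hu⟩ : π (i y) ∈ Set.range U.ι := hx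
        rw [← Scheme.Hom.comp_apply, h1, Scheme.Hom.comp_apply] at hu
        have hyW : y ∈ ρ ⁻¹ᵁ W₀ := by
          change j (ρ y) ∈ U
          rw [← hu]; exact u.2
        refine ⟨b ⟨y, hyW⟩, ?_⟩
        exact congr($(hP.w) (⟨y, hyW⟩ : (ρ ⁻¹ᵁ W₀).toScheme)).symm
      · exact ⟨u, rfl⟩
    · rintro _ ⟨u, rfl⟩
      change π (b' u) ∈ Set.range U.ι
      rw [← Scheme.Hom.comp_apply, h2]
      exact ⟨u, rfl⟩
  refine ⟨M, π, i, b', ?_, hp1, hp2⟩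
  let Vs : Bool → Scheme.{0} := fun t => bif t then V else U.toScheme
  let Ws : Bool → Scheme.{0} := fun t => bif t then Y else U.toScheme
  let js : ∀ t, Vs t ⟶ X := fun t => match t with | true => j | false => U.ι
  let ps : ∀ t, Ws t ⟶ Vs t := fun t => match t with | true => ρ | false => 𝟙 _
  let ks : ∀ t, Ws t ⟶ M := fun t => match t with | true => i | false => b'
  have hjs : ∀ t, IsOpenImmersion (js t) := by
    rintro (_ | _)
    · exact inferInstanceAs (IsOpenImmersion U.ι)
    · exact inferInstanceAs (IsOpenImmersion j)
  refine isBlowup_of_cover js ?_ ps ks ?_ ?_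
  · intro x
    rcases hcov x with hx | hx
    · exact ⟨true, hx⟩
    · exact ⟨false, ⟨x, hx⟩, rfl⟩
  · rintro (_ | _)
    · exact hp2
    · exact hp1
  · rintro (_ | _)
    · have : IsBlowup (I.comap U.ι) (𝟙 U.toScheme) :=
        isBlowup_of_isIso _ (by rw [hU]; exact isInvertibleIdeal_top)
      exact this
    · exact hρ

/-! ### The affine blow-up -/

section Rees

variable {R : Type} [CommRing R]

open Polynomial

/-- The grading of the Rees algebra by degree. -/
def reesGrading (J : Ideal R) (n : ℕ) : Submodule R (reesAlgebra J) where
  carrier := {f | ∀ i, i ≠ n → (f : R[X]).coeff i = 0}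
  add_mem' hf hg i hi := by simp [hf i hi, hg i hi]
  zero_mem' i _ := by simp
  smul_mem' c f hf i hi := by simp [hf i hi]

theorem eq_monomial_of_mem_reesGrading {J : Ideal R} {n : ℕ} {f : reesAlgebra J}
    (hf : f ∈ reesGrading J n) : (f : R[X]) = monomial n ((f : R[X]).coeff n) := by
  ext i
  rw [coeff_monomial]
  split_ifs with h
  · rw [h]
  · exact hf i (Ne.symm h)

/-- The homogeneous element `r Xⁿ` of the Rees algebra. -/
def reesMonomial {J : Ideal R} (n : ℕ) (r : R) (hr : r ∈ J ^ n) : reesAlgebra J :=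
  ⟨monomial n r, reesAlgebra.monomial_mem.mpr hr⟩

theorem reesMonomial_mem {J : Ideal R} (n : ℕ) (r : R) (hr : r ∈ J ^ n) :
    reesMonomial n r hr ∈ reesGrading J n := fun i hi => by
  simp [reesMonomial, coeff_monomial, hi.symm]

instance (J : Ideal R) : SetLike.GradedMonoid (reesGrading J) where
  one_mem i hi := by simp [coeff_one, hi]
  mul_mem := by
    intro m n a b ha hb i hi
    change ((a : R[X]) * (b : R[X])).coeff i = 0
    rw [coeff_mul]
    refine Finset.sum_eq_zero fun p hp => ?_
    by_cases h : p.1 = m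
    · rw [hb p.2 (by rintro rfl; exact hi (by rw [← h, Finset.HasAntidiagonal.mem_antidiagonal.mp hp])), mul_zero]
    · rw [ha p.1 h, zero_mul]

/-- The decomposition of an element of the Rees algebra into its homogeneous components. -/
def reesDecompose (J : Ideal R) (f : reesAlgebra J) : DirectSum ℕ fun n => reesGrading J n :=
  ∑ i ∈ (f : R[X]).support, DirectSum.of (fun n => reesGrading J n) i
    ⟨reesMonomial i ((f : R[X]).coeff i) (f.2 i), reesMonomial_mem _ _ _⟩

theorem coeAddMonoidHom_reesDecompose (J : Ideal R) (f : reesAlgebra J) :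
    DirectSum.coeAddMonoidHom (reesGrading J) (reesDecompose J f) = f := by
  rw [reesDecompose, map_sum]
  simp_rw [DirectSum.coeAddMonoidHom_of]
  apply Subtype.ext
  rw [AddSubmonoidClass.coe_finsetSum]
  exact (f : R[X]).as_sum_support.symm

theorem coeff_coeAddMonoidHom (J : Ideal R) (x : DirectSum ℕ fun n => reesGrading J n) (n : ℕ) :
    ((DirectSum.coeAddMonoidHom (reesGrading J) x : reesAlgebra J) : R[X]).coeff n
      = ((x n : reesAlgebra J) : R[X]).coeff n := by
  induction x using DirectSum.induction_on with
  | zero => simp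
  | of i a =>
    rw [DirectSum.coeAddMonoidHom_of]
    by_cases h : i = n
    · subst h; rw [DirectSum.of_eq_same]
    · rw [DirectSum.of_eq_of_ne _ _ _ (Ne.symm h), a.2 n (Ne.symm h)]
      simp
  | add a b ha hb => 
    rw [map_add, DirectSum.add_apply]
    simp only [Subalgebra.coe_add, Submodule.coe_add, coeff_add, ha, hb]

instance (J : Ideal R) : GradedAlgebra (reesGrading J) where
  decompose' := reesDecompose J
  left_inv := coeAddMonoidHom_reesDecompose J
  right_inv x := by
    refine DFinsupp.ext fun n => Subtype.ext (Subtype.ext (Polynomial.ext fun i => ?_))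
    by_cases h : i = n
    · subst h
      rw [← coeff_coeAddMonoidHom, coeAddMonoidHom_reesDecompose, coeff_coeAddMonoidHom]
    · rw [(x n).2 i h]
      exact (reesDecompose J _ n).2 i h

variable {ι : Type} (g : ι → R)

/-- The degree one generator of the Rees algebra given by a generator of the ideal. -/
def reesGen (i : ι) : reesAlgebra (Ideal.span (Set.range g)) :=
  reesMonomial 1 (g i) (by rw [pow_one]; exact Ideal.subset_span ⟨i, rfl⟩)

theorem reesGen_mem (i : ι) : reesGen g i ∈ reesGrading (Ideal.span (Set.range g)) 1 :=
  reesMonomial_mem _ _ _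

/-- Generation in degree one makes the charts at the `reesGen g i` cover `Proj`, and it reduces
statements about ring maps on the Rees algebra to these generators. -/
theorem adjoin_reesGen : Algebra.adjoin R (Set.range (reesGen g)) = ⊤ := by
  have hinj := Subalgebra.map_injective
    (f := (reesAlgebra (Ideal.span (Set.range g))).val) Subtype.val_injective
  apply hinj
  rw [AlgHom.map_adjoin, Algebra.map_top, Subalgebra.range_val]
  refine Eq.trans ?_ (adjoin_monomial_eq_reesAlgebra _)
  refine Eq.trans ?_ (congrArg (fun M : Submodule R R[X] => Algebra.adjoin R (M : Set R[X]))
    (Submodule.map_span (monomial 1 : R →ₗ[R] R[X]) (Set.range g))).symm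
  rw [Algebra.adjoin_span, ← Set.range_comp, ← Set.range_comp]
  rfl

theorem adjoin_zero_reesGen :
    Algebra.adjoin (reesGrading (Ideal.span (Set.range g)) 0) (Set.range (reesGen g)) = ⊤ := by
  rw [eq_top_iff]
  intro x _
  have hx : x ∈ Algebra.adjoin R (Set.range (reesGen g)) := by rw [adjoin_reesGen]; trivial
  induction hx using Algebra.adjoin_induction with
  | mem x hx => exact Algebra.subset_adjoin hx
  | algebraMap r => exact Subalgebra.algebraMap_mem (Algebra.adjoin
      (reesGrading (Ideal.span (Set.range g)) 0) _) (algebraMap R (reesGrading _ 0) r)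
  | add x y _ _ hx hy => exact add_mem (hx trivial) (hy trivial)
  | mul x y _ _ hx hy => exact mul_mem (hx trivial) (hy trivial)

instance [Finite ι] : Algebra.FiniteType (reesGrading (Ideal.span (Set.range g)) 0)
    (reesAlgebra (Ideal.span (Set.range g))) := by
  refine ⟨⟨(Set.finite_range (reesGen g)).toFinset, ?_⟩⟩
  rw [Set.Finite.coe_toFinset, adjoin_zero_reesGen]

/-- The affine chart `R[J / g j]` of the blow-up of `Spec R` along the ideal generated by the
family `g`. -/
def ReesChart (j : ι) : Type :=
  HomogeneousLocalization.Away (reesGrading (Ideal.span (Set.range g))) (reesGen g j)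

instance (j : ι) : CommRing (ReesChart g j) :=
  inferInstanceAs (CommRing (HomogeneousLocalization.Away
    (reesGrading (Ideal.span (Set.range g))) (reesGen g j)))

/-- The inclusion of the chart in the localized Rees algebra. -/
def chartVal (j : ι) : ReesChart g j →+* Localization.Away (reesGen g j) :=
  @algebraMap (HomogeneousLocalization.Away
    (reesGrading (Ideal.span (Set.range g))) (reesGen g j)) (Localization.Away (reesGen g j)) _ _
    HomogeneousLocalization.homogeneousLocalizationAlgebra

theorem chartVal_injective (j : ι) : Function.Injective (chartVal g j) :=
  HomogeneousLocalization.val_injective _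

/-- The structure map of the chart. -/
def chartMap (j : ι) : R →+* ReesChart g j :=
  (HomogeneousLocalization.fromZeroRingHom _ _).comp (algebraMap R (reesGrading _ 0))

/-- The quotient `g i / g j` in the chart. -/
def chartVar (j i : ι) : ReesChart g j :=
  HomogeneousLocalization.Away.mk _ (reesGen_mem g j) 1 (reesGen g i)
    (by rw [one_smul]; exact reesGen_mem g i)

theorem chartVal_chartMap (j : ι) (r : R) :
    chartVal g j (chartMap g j r) = Localization.mk (algebraMap R _ r) 1 := rfl

theorem chartVal_chartVar (j i : ι) :
    chartVal g j (chartVar g j i) = Localization.mk (reesGen g i)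
      (⟨reesGen g j ^ 1, ⟨1, rfl⟩⟩ : Submonoid.powers (reesGen g j)) := rfl

theorem algebraMap_mul_reesGen (i j : ι) :
    algebraMap R (reesAlgebra (Ideal.span (Set.range g))) (g i) * reesGen g j
      = algebraMap R _ (g j) * reesGen g i := by
  apply Subtype.ext
  change C (g i) * monomial 1 (g j) = C (g j) * monomial 1 (g i)
  rw [C_mul_monomial, C_mul_monomial, mul_comm]

theorem chartMap_mul_chartVar (j i : ι) :
    chartMap g j (g j) * chartVar g j i = chartMap g j (g i) := by
  apply chartVal_injective
  rw [map_mul, chartVal_chartMap, chartVal_chartVar, chartVal_chartMap,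
    Localization.mk_mul, Localization.mk_eq_mk_iff, Localization.r_iff_exists]
  refine ⟨1, ?_⟩
  simp only [OneMemClass.coe_one, one_mul, pow_one]
  rw [← algebraMap_mul_reesGen, mul_comm]

/-- A homogeneous element of degree `n` of the Rees algebra is a monomial `r Xⁿ`, so elements of the
chart are fractions `r / g_jⁿ` with `r` in the `n`-th power of the ideal. -/
theorem exists_chart_eq (j : ι) (c : ReesChart g j) :
    ∃ (n : ℕ) (r : R) (hr : r ∈ Ideal.span (Set.range g) ^ n),
      chartVal g j c = Localization.mk (reesMonomial n r hr)
        (⟨reesGen g j ^ n, ⟨n, rfl⟩⟩ : Submonoid.powers (reesGen g j)) := by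
  obtain ⟨n, a, ha, rfl⟩ := HomogeneousLocalization.Away.mk_surjective _ (reesGen_mem g j) c
  have ha' : a ∈ reesGrading (Ideal.span (Set.range g)) n := by simpa using ha
  refine ⟨n, (a : R[X]).coeff n, a.2 n, ?_⟩
  refine (HomogeneousLocalization.Away.val_mk (reesGrading (Ideal.span (Set.range g))) n
    (reesGen_mem g j) a ha).trans ?_
  congr 1
  exact Subtype.ext (eq_monomial_of_mem_reesGrading ha')

theorem reesGen_pow_mul (j : ι) (n : ℕ) (r : R) (hr : r ∈ Ideal.span (Set.range g) ^ n) :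
    reesGen g j ^ n * algebraMap R _ r = algebraMap R _ (g j ^ n) * reesMonomial n r hr := by
  apply Subtype.ext
  change (monomial 1 (g j)) ^ n * C r = C (g j ^ n) * monomial n r
  rw [monomial_pow, C_mul_monomial, one_mul, monomial_mul_C]

theorem exists_chartMap_pow_mul (j : ι) (c : ReesChart g j) :
    ∃ (n : ℕ) (r : R), r ∈ Ideal.span (Set.range g) ^ n ∧
      chartMap g j (g j) ^ n * c = chartMap g j r := by
  obtain ⟨n, r, hr, h⟩ := exists_chart_eq g j c
  refine ⟨n, r, hr, chartVal_injective g j ?_⟩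
  rw [← map_pow, map_mul, h, chartVal_chartMap, chartVal_chartMap,
    Localization.mk_mul, Localization.mk_eq_mk_iff, Localization.r_iff_exists]
  refine ⟨1, ?_⟩
  simp only [OneMemClass.coe_one, one_mul]
  exact (reesGen_pow_mul g j n r hr).symm

/-- If `g_j` kills the fraction with numerator `r Xⁿ`, then `g_j^(m + 1) r = 0` for some `m`. So the
power `(g_j X)^(m + 1)` of the inverted element already kills the numerator. -/
theorem chartMap_mem_nonZeroDivisors (j : ι) :
    chartMap g j (g j) ∈ nonZeroDivisors (ReesChart g j) := by
  rw [mem_nonZeroDivisors_iff_right]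
  intro c hc
  obtain ⟨n, r, hr, h⟩ := exists_chart_eq g j c
  apply chartVal_injective
  have := congrArg (chartVal g j) hc
  rw [map_mul, h, chartVal_chartMap, Localization.mk_mul,
    map_zero, ← Localization.mk_zero 1, Localization.mk_eq_mk_iff,
    Localization.r_iff_exists] at this
  obtain ⟨⟨_, m, rfl⟩, hm⟩ := this
  rw [h, map_zero, ← Localization.mk_zero 1, Localization.mk_eq_mk_iff,
    Localization.r_iff_exists]
  refine ⟨⟨_, m + 1, rfl⟩, ?_⟩
  simp only [OneMemClass.coe_one, one_mul, mul_zero] at hm ⊢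
  apply Subtype.ext
  have h2 := congrArg (Subtype.val) hm
  have e1 : ∀ k, ((reesGen g j ^ k : reesAlgebra _) : R[X]) = monomial k (g j ^ k) := by
    intro k
    change (monomial 1 (g j)) ^ k = _
    rw [monomial_pow, one_mul]
  simp only [MulMemClass.coe_mul, e1] at h2 ⊢
  change monomial m (g j ^ m) * (monomial n r * C (g j)) = 0 at h2
  change monomial (m + 1) (g j ^ (m + 1)) * monomial n r = 0
  rw [monomial_mul_C, monomial_mul_monomial, monomial_eq_zero_iff] at h2
  rw [monomial_mul_monomial, monomial_eq_zero_iff, ← h2]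
  ring

/-- Multiplication by a power of `g_j` brings an element of the chart into the image of `R`, and
this power can be cancelled in the target. -/
theorem chart_ringHom_ext {C : Type*} [CommRing C] {j : ι} {χ₁ χ₂ : ReesChart g j →+* C}
    (hs : χ₁ (chartMap g j (g j)) ∈ nonZeroDivisors C)
    (h : ∀ r, χ₁ (chartMap g j r) = χ₂ (chartMap g j r)) : χ₁ = χ₂ := by
  ext c
  obtain ⟨n, r, -, hr⟩ := exists_chartMap_pow_mul g j c
  have h1 := congrArg χ₁ hr
  have h2 := congrArg χ₂ hr
  rw [map_mul, map_pow] at h1 h2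
  rw [← h, ← h, ← h1] at h2
  exact ((mul_cancel_left_mem_nonZeroDivisors (pow_mem hs n)).mp h2).symm

/-- Evaluate the Rees algebra at `X = 1 / ψ(g_j)` in `C[1 / ψ(g_j)]`. By divisibility the generators
land in `C`, which embeds there because `ψ(g_j)` is a nonzerodivisor; and `g_j X` goes to `1`. -/
theorem exists_chart_lift {C : Type} [CommRing C] {j : ι} (ψ : R →+* C)
    (hs : ψ (g j) ∈ nonZeroDivisors C) (hd : ∀ i, ψ (g j) ∣ ψ (g i)) :
    ∃ χ : ReesChart g j →+* C, ∀ r, χ (chartMap g j r) = ψ r := by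
  let L := Localization.Away (ψ (g j))
  have hu : IsUnit (algebraMap C L (ψ (g j))) := IsLocalization.Away.algebraMap_isUnit _
  have hinj : Function.Injective (algebraMap C L) :=
    IsLocalization.injective L (Submonoid.powers_le.mpr hs)
  let θ : reesAlgebra (Ideal.span (Set.range g)) →+* L :=
    (Polynomial.eval₂RingHom ((algebraMap C L).comp ψ) ↑(hu.unit⁻¹)).comp
      (reesAlgebra (Ideal.span (Set.range g))).val.toRingHom
  have hθgen (i : ι) : θ (reesGen g i) = algebraMap C L (ψ (g i)) * ↑(hu.unit⁻¹) := by
    change Polynomial.eval₂ _ _ (monomial 1 (g i)) = _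
    rw [eval₂_monomial, pow_one]; rfl
  have hθr (r : R) : θ (algebraMap R _ r) = algebraMap C L (ψ r) := by
    change Polynomial.eval₂ _ _ (Polynomial.C r) = _
    rw [eval₂_C]; rfl
  have hθ1 : θ (reesGen g j) = 1 := by
    rw [hθgen]; exact hu.mul_val_inv
  have hrange (x) : θ x ∈ (algebraMap C L).range := by
    have hx : x ∈ Algebra.adjoin R (Set.range (reesGen g)) := by rw [adjoin_reesGen]; trivial
    induction hx using Algebra.adjoin_induction with
    | mem x hx =>
      obtain ⟨i, rfl⟩ := hx
      obtain ⟨d, hd⟩ := hd i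
      refine ⟨d, ?_⟩
      rw [hθgen, hd, map_mul, mul_comm (algebraMap C L (ψ (g j))), mul_assoc, hu.mul_val_inv,
        mul_one]
    | algebraMap r => exact ⟨ψ r, (hθr r).symm⟩
    | add x y _ _ hx hy => rw [map_add]; exact add_mem hx hy
    | mul x y _ _ hx hy => rw [map_mul]; exact mul_mem hx hy
  let e : C ≃+* (algebraMap C L).range := RingEquiv.ofBijective (algebraMap C L).rangeRestrict
    ⟨fun a b h => hinj (congrArg Subtype.val h), (algebraMap C L).rangeRestrict_surjective⟩
  let θ' : reesAlgebra (Ideal.span (Set.range g)) →+* C :=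
    (e.symm : _ →+* C).comp (θ.codRestrict (algebraMap C L).range hrange)
  have hθ' (x) (c : C) (h : θ x = algebraMap C L c) : θ' x = c := by
    change e.symm _ = c
    rw [RingEquiv.symm_apply_eq]
    exact Subtype.ext h
  let χ : Localization.Away (reesGen g j) →+* C :=
    IsLocalization.Away.lift (reesGen g j) (g := θ')
      (by rw [hθ' _ 1 (by rw [hθ1, map_one])]; exact isUnit_one)
  refine ⟨χ.comp (chartVal g j), fun r => ?_⟩
  rw [RingHom.comp_apply, chartVal_chartMap,
    Localization.mk_one_eq_algebraMap, IsLocalization.Away.lift_eq]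
  exact hθ' _ _ (hθr r)

end Rees

/-! ### The blow-up as `Proj` of the Rees algebra, and its universal property. -/

section Rees

variable {R : Type} [CommRing R] {ι : Type} (g : ι → R)

/-- The inclusion of the base ring in the Rees algebra as the component of degree zero. -/
def reesZeroMap (J : Ideal R) : CommRingCat.of R ⟶ CommRingCat.of (reesGrading J 0) :=
  CommRingCat.ofHom (algebraMap R (reesGrading J 0))

theorem reesZeroMap_surjective (J : Ideal R) : Function.Surjective (reesZeroMap J) := fun f =>
  ⟨((f : reesAlgebra J) : Polynomial R).coeff 0,
    Subtype.ext (Subtype.ext (eq_monomial_of_mem_reesGrading f.2).symm)⟩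

/-- The blow-up of `Spec R` along the ideal generated by the family `g`. -/
def reesBlowup : Scheme.{0} :=
  Proj (reesGrading (Ideal.span (Set.range g)))

/-- The structure morphism of the blow-up. -/
def reesBlowupHom : reesBlowup g ⟶ Spec (.of R) :=
  Proj.toSpecZero (reesGrading (Ideal.span (Set.range g))) ≫
    Spec.map (reesZeroMap (Ideal.span (Set.range g)))

/-- `Proj` of a finitely generated algebra is proper over its degree zero part, and the degree zero
part is a quotient of `R`. -/
instance [Finite ι] : IsProper (reesBlowupHom g) := by
  have : IsClosedImmersion (Spec.map (reesZeroMap (Ideal.span (Set.range g)))) :=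
    IsClosedImmersion.spec_of_surjective _ (reesZeroMap_surjective _)
  have h : IsProper (Proj.toSpecZero (reesGrading (Ideal.span (Set.range g)))) := inferInstance
  exact MorphismProperty.comp_mem @IsProper _ _ h inferInstance

/-- The inclusion of an affine chart in the blow-up. -/
def chartι (j : ι) : Spec (.of (ReesChart g j)) ⟶ reesBlowup g :=
  Proj.awayι _ _ (reesGen_mem g j) one_pos

instance (j : ι) : IsOpenImmersion (chartι g j) :=
  inferInstanceAs (IsOpenImmersion (Proj.awayι _ _ (reesGen_mem g j) one_pos))

theorem chartι_comp (j : ι) :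
    chartι g j ≫ reesBlowupHom g = Spec.map (CommRingCat.ofHom (chartMap g j)) := by
  have h := Proj.awayι_toSpecZero_assoc _ _ (reesGen_mem g j) one_pos (Spec.map
    (reesZeroMap (Ideal.span (Set.range g))))
  refine h.trans ?_
  rw [← Spec.map_comp]
  rfl

theorem exists_mem_range_chartι (x : reesBlowup g) : ∃ j, x ∈ Set.range (chartι g j) := by
  have h := Proj.iSup_basicOpen_eq_top' (reesGrading (Ideal.span (Set.range g))) (reesGen g)
    (fun i => ⟨1, reesGen_mem g i⟩) (adjoin_zero_reesGen g)
  have hx : x ∈ ⨆ i, Proj.basicOpen (reesGrading (Ideal.span (Set.range g))) (reesGen g i) := by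
    rw [h]; trivial
  obtain ⟨j, hj⟩ := TopologicalSpace.Opens.mem_iSup.mp hx
  refine ⟨j, ?_⟩
  rw [← Proj.opensRange_awayι _ _ (reesGen_mem g j) one_pos] at hj
  exact hj

/-- Inside the chart `j`, the chart `k` is the basic open of `g_k / g_j`. -/
theorem range_subset_of_isUnit {C : Type} [CommRing C] {j k : ι} (χ : ReesChart g j →+* C)
    (hu : IsUnit (χ (chartVar g j k))) :
    Set.range (Spec.map (CommRingCat.ofHom χ) ≫ chartι g j) ⊆ Set.range (chartι g k) := by
  have h := Proj.awayι_preimage_basicOpen (reesGrading (Ideal.span (Set.range g)))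
    (reesGen_mem g j) one_pos (reesGen_mem g k) one_pos
  have hk := Proj.opensRange_awayι _ _ (reesGen_mem g k) one_pos
  rintro _ ⟨y, rfl⟩
  rw [Scheme.Hom.comp_apply]
  suffices hs : Spec.map (CommRingCat.ofHom χ) y ∈ (chartι g j) ⁻¹ᵁ Proj.basicOpen
      (reesGrading (Ideal.span (Set.range g))) (reesGen g k) by
    rw [← hk] at hs
    exact hs
  have h' : (chartι g j) ⁻¹ᵁ Proj.basicOpen
      (reesGrading (Ideal.span (Set.range g))) (reesGen g k) = _ := h
  rw [h']
  intro hmem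
  have e : HomogeneousLocalization.Away.isLocalizationElem (reesGen_mem g j) (reesGen_mem g k)
      = chartVar g j k := by
    apply HomogeneousLocalization.val_injective
    rw [HomogeneousLocalization.Away.val_mk]
    refine Eq.trans ?_ (chartVal_chartVar g j k).symm
    simp only [pow_one]
  rw [e] at hmem
  exact y.2.ne_top (Ideal.eq_top_of_isUnit_mem _ hmem hu)

theorem exists_spec_nhds {T : Scheme.{0}} {I : T.IdealSheafData} (hI : IsInvertibleIdeal I)
    (W : T.Opens) {t : T} (ht : t ∈ W) :
    ∃ (C : CommRingCat.{0}) (j : Spec C ⟶ T), IsOpenImmersion j ∧ t ∈ Set.range j ∧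
      Set.range j ⊆ W ∧ ∃ s ∈ nonZeroDivisors C, I.comap j = specIdeal (Ideal.span {s}) := by
  obtain ⟨C, j, hj, ⟨y, hy⟩, s, hs, hC⟩ := isInvertibleIdeal_iff.mp (hI.comap W.ι) ⟨t, ht⟩
  refine ⟨C, j ≫ W.ι, inferInstance, ⟨y, ?_⟩, ?_, s, hs, ?_⟩
  · rw [Scheme.Hom.comp_apply, hy]; rfl
  · rintro _ ⟨z, rfl⟩
    rw [Scheme.Hom.comp_apply]
    exact (j z).2
  · rw [Scheme.IdealSheafData.comap_comp, hC]

theorem comap_specMap_span {C : Type} [CommRing C] (ψ : R →+* C) :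
    (specIdeal (R := .of R) (Ideal.span (Set.range g))).comap (Spec.map (CommRingCat.ofHom ψ))
      = specIdeal (R := .of C) (Ideal.span (Set.range (ψ ∘ g))) := by
  rw [specIdeal_comap]
  congr 1
  refine (Ideal.map_span _ _).trans ?_
  rw [← Set.range_comp]
  rfl

theorem span_range_eq_of_dvd {C : Type} [CommRing C] {a : ι → C} {j : ι} (h : ∀ i, a j ∣ a i) :
    Ideal.span (Set.range a) = Ideal.span {a j} := by
  apply le_antisymm
  · rw [Ideal.span_le]
    rintro _ ⟨i, rfl⟩
    exact Ideal.mem_span_singleton.mpr (h i)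
  · rw [Ideal.span_le, Set.singleton_subset_iff]
    exact Ideal.subset_span ⟨j, rfl⟩

theorem chartMap_dvd (j i : ι) : chartMap g j (g j) ∣ chartMap g j (g i) :=
  ⟨_, (chartMap_mul_chartVar g j i).symm⟩

theorem mem_nonZeroDivisors_of_span_eq {C : Type} [CommRing C] {s a : C}
    (hs : s ∈ nonZeroDivisors C) (h : Ideal.span {a} = Ideal.span {s}) :
    a ∈ nonZeroDivisors C := by
  obtain ⟨x, hx⟩ := Ideal.mem_span_singleton.mp (h.ge (Ideal.mem_span_singleton_self s))
  rw [hx] at hs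
  exact (mul_mem_nonZeroDivisors.mp hs).1

/-- On the chart `j` every `g_i` is a multiple of `g_j`, and `g_j` is a nonzerodivisor. -/
theorem reesBlowup_isInvertibleIdeal :
    IsInvertibleIdeal ((specIdeal (R := .of R) (Ideal.span (Set.range g))).comap
      (reesBlowupHom g)) := by
  refine isInvertibleIdeal_of_cover _ (chartι g) (exists_mem_range_chartι g) fun j => ?_
  rw [← Scheme.IdealSheafData.comap_comp, chartι_comp, comap_specMap_span,
    span_range_eq_of_dvd (a := chartMap g j ∘ g) (j := j) (chartMap_dvd g j),
    isInvertibleIdeal_iff]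
  intro x
  refine ⟨_, 𝟙 _, inferInstance, ⟨x, rfl⟩, _, chartMap_mem_nonZeroDivisors g j, ?_⟩
  rw [Scheme.IdealSheafData.comap_id]
  rfl

/-- Write `ψ(g_i) = s b_i` and `s = ∑ c_i ψ(g_i)`. Cancelling `s` gives `∑ c_i b_i = 1`, so some
`b_j` lies outside `𝔭`. After inverting it, `ψ(g_j)` generates the ideal and the chart `j` receives
the lift. -/
theorem exists_reesBlowup_lift [Finite ι] {C : Type} [CommRing C] (ψ : R →+* C) {s : C}
    (hs : s ∈ nonZeroDivisors C) (h : Ideal.span (Set.range (ψ ∘ g)) = Ideal.span {s})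
    (𝔭 : Ideal C) [𝔭.IsPrime] :
    ∃ r ∉ 𝔭, ∃ (j : ι) (χ : ReesChart g j →+* Localization.Away r),
      ∀ a, χ (chartMap g j a) = algebraMap C _ (ψ a) := by
  cases nonempty_fintype ι
  have hb (i) : ∃ b, ψ (g i) = s * b :=
    Ideal.mem_span_singleton.mp (h.le (Ideal.subset_span ⟨i, rfl⟩))
  choose b hb using hb
  obtain ⟨c, hc⟩ := Ideal.mem_span_range_iff_exists_fun.mp (h.ge (Ideal.mem_span_singleton_self s))
  have h1 : ∑ i, c i * b i = 1 := by
    refine (mul_cancel_left_mem_nonZeroDivisors hs).mp ?_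
    rw [mul_one, Finset.mul_sum]
    conv_rhs => rw [← hc]
    refine Finset.sum_congr rfl fun i _ => ?_
    rw [Function.comp_apply, hb]; ring
  obtain ⟨j, hj⟩ : ∃ j, b j ∉ 𝔭 := by
    by_contra! hcon
    refine (inferInstance : 𝔭.IsPrime).one_notMem ?_
    rw [← h1]
    exact Ideal.sum_mem _ fun i _ => Ideal.mul_mem_left _ _ (hcon i)
  have hu : IsUnit (algebraMap C (Localization.Away (b j)) (b j)) :=
    IsLocalization.Away.algebraMap_isUnit _
  refine ⟨b j, hj, j, exists_chart_lift g ((algebraMap C _).comp ψ) ?_ fun i => ?_⟩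
  · rw [RingHom.comp_apply, hb, map_mul]
    exact mul_mem (algebraMap_mem_nonZeroDivisors_away hs _) hu.mem_nonZeroDivisors
  · rw [RingHom.comp_apply, RingHom.comp_apply, hb, hb, map_mul, map_mul]
    exact mul_dvd_mul_left _ (hu.dvd)

/-- Locally the two maps land in charts `a` and `b`. The images of `g_a` and `g_b` generate the same
invertible ideal, so their ratio is a unit and the first map lands in the chart `b` as well. There a
map is determined by its restriction to `R`. -/
theorem reesBlowup_hom_ext {T : Scheme.{0}} (g₁ g₂ : T ⟶ reesBlowup g)
    (hI : IsInvertibleIdeal ((specIdeal (R := .of R) (Ideal.span (Set.range g))).comap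
      (g₁ ≫ reesBlowupHom g)))
    (hg : g₁ ≫ reesBlowupHom g = g₂ ≫ reesBlowupHom g) : g₁ = g₂ := by
  have key (t : T) : ∃ (C : CommRingCat.{0}) (j : Spec C ⟶ T), IsOpenImmersion j ∧
      t ∈ Set.range j ∧ j ≫ g₁ = j ≫ g₂ := by
    obtain ⟨a, ha⟩ := exists_mem_range_chartι g (g₁ t)
    obtain ⟨b, hb⟩ := exists_mem_range_chartι g (g₂ t)
    obtain ⟨C, j, hj, htj, hW, s, hs, hC⟩ := exists_spec_nhds hI
      (g₁ ⁻¹ᵁ (chartι g a).opensRange ⊓ g₂ ⁻¹ᵁ (chartι g b).opensRange) (t := t) ⟨ha, hb⟩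
    refine ⟨C, j, hj, htj, ?_⟩
    have r1 : Set.range (j ≫ g₁) ⊆ Set.range (chartι g a) := by
      rintro _ ⟨z, rfl⟩
      rw [Scheme.Hom.comp_apply]
      exact (hW ⟨z, rfl⟩).1
    have r2 : Set.range (j ≫ g₂) ⊆ Set.range (chartι g b) := by
      rintro _ ⟨z, rfl⟩
      rw [Scheme.Hom.comp_apply]
      exact (hW ⟨z, rfl⟩).2
    have lift {k : ι} {h : Spec C ⟶ reesBlowup g} (r : Set.range h ⊆ Set.range (chartι g k)) :
        ∃ χ : ReesChart g k →+* C, Spec.map (CommRingCat.ofHom χ) ≫ chartι g k = h := by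
      obtain ⟨χ, hχ⟩ := Spec.map_surjective (IsOpenImmersion.lift (chartι g k) h r)
      exact ⟨χ.hom, by
        rw [CommRingCat.ofHom_hom, hχ, IsOpenImmersion.lift_fac]⟩
    obtain ⟨ψ, hψ⟩ : ∃ ψ : R →+* C, Spec.map (CommRingCat.ofHom ψ) = j ≫ g₁ ≫ reesBlowupHom g := by
      obtain ⟨ψ, hψ⟩ := Spec.map_surjective (j ≫ g₁ ≫ reesBlowupHom g)
      exact ⟨ψ.hom, by rw [CommRingCat.ofHom_hom, hψ]⟩
    have hcomp {k : ι} {h : Spec C ⟶ reesBlowup g} {χ : ReesChart g k →+* C}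
        (hχ : Spec.map (CommRingCat.ofHom χ) ≫ chartι g k = h)
        (hh : h ≫ reesBlowupHom g = j ≫ g₁ ≫ reesBlowupHom g) (r : R) :
        χ (chartMap g k r) = ψ r := by
      have e : CommRingCat.ofHom (χ.comp (chartMap g k)) = CommRingCat.ofHom ψ := by
        apply Spec.map_injective
        rw [hψ, ← hh, ← hχ, Category.assoc, chartι_comp, ← Spec.map_comp, CommRingCat.ofHom_comp]
      exact congr($(e).hom r)
    obtain ⟨χ₁, hχ₁⟩ := lift r1
    obtain ⟨χ₂, hχ₂⟩ := lift r2
    have e1 := hcomp hχ₁ (Category.assoc _ _ _)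
    have e2 := hcomp hχ₂ (by rw [Category.assoc, hg])
    have hspan : Ideal.span (Set.range (ψ ∘ g)) = Ideal.span {s} := by
      rw [← Scheme.IdealSheafData.comap_comp, ← hψ, comap_specMap_span] at hC
      exact specIdeal_injective hC
    have d1 (i) : ψ (g a) ∣ ψ (g i) := by
      rw [← e1, ← e1]; exact map_dvd _ (chartMap_dvd g a i)
    have d2 (i) : ψ (g b) ∣ ψ (g i) := by
      rw [← e2, ← e2]; exact map_dvd _ (chartMap_dvd g b i)
    have n1 : ψ (g a) ∈ nonZeroDivisors C := mem_nonZeroDivisors_of_span_eq hs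
      ((span_range_eq_of_dvd (a := ψ ∘ g) d1).symm.trans hspan)
    have n2 : ψ (g b) ∈ nonZeroDivisors C := mem_nonZeroDivisors_of_span_eq hs
      ((span_range_eq_of_dvd (a := ψ ∘ g) d2).symm.trans hspan)
    have hu : IsUnit (χ₁ (chartVar g a b)) := by
      obtain ⟨v, hv⟩ := d2 a
      have hb' : ψ (g a) * χ₁ (chartVar g a b) = ψ (g b) := by
        rw [← e1, ← e1, ← map_mul, chartMap_mul_chartVar]
      refine IsUnit.of_mul_eq_one v ((mul_cancel_left_mem_nonZeroDivisors n1).mp ?_)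
      rw [← mul_assoc, hb', ← hv, mul_one]
    obtain ⟨χ₃, hχ₃⟩ := lift (hχ₁ ▸ range_subset_of_isUnit g χ₁ hu)
    have e3 := hcomp hχ₃ (Category.assoc _ _ _)
    have : χ₃ = χ₂ := chart_ringHom_ext g (by rw [e3]; exact n2) fun r => by rw [e3, e2]
    rw [← hχ₃, this, hχ₂]
  choose C j hj htj h using key
  exact (Scheme.Cover.mkOfCovers T (fun t => Spec (C t)) j (fun t => ⟨t, htj t⟩) hj :
    T.OpenCover).hom_ext _ _ h

theorem reesBlowup_isBlowup [Finite ι] :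
    IsBlowup (specIdeal (R := .of R) (Ideal.span (Set.range g))) (reesBlowupHom g) := by
  refine isBlowup_of_local (reesBlowup_isInvertibleIdeal g) (reesBlowup_hom_ext g) ?_
  intro T f hf t
  obtain ⟨C, j, hj, ⟨y, hy⟩, s, hs, hC⟩ := isInvertibleIdeal_iff.mp hf t
  obtain ⟨ψ, hψ⟩ : ∃ ψ : R →+* C, Spec.map (CommRingCat.ofHom ψ) = j ≫ f := by
    obtain ⟨ψ, hψ⟩ := Spec.map_surjective (j ≫ f)
    exact ⟨ψ.hom, by rw [CommRingCat.ofHom_hom, hψ]⟩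
  rw [← Scheme.IdealSheafData.comap_comp, ← hψ, comap_specMap_span] at hC
  have hyp : (y : PrimeSpectrum C).asIdeal.IsPrime := (y : PrimeSpectrum C).2
  obtain ⟨r, hr, i, χ, hχ⟩ := exists_reesBlowup_lift g ψ hs (specIdeal_injective hC)
    (y : PrimeSpectrum C).asIdeal
  refine ⟨_, Spec.map (CommRingCat.ofHom (algebraMap C (Localization.Away r))) ≫ j,
    inferInstance, ?_, Spec.map (CommRingCat.ofHom χ) ≫ chartι g i, ?_⟩
  · have hy' : y ∈ Set.range (Spec.map (CommRingCat.ofHom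
        (algebraMap C (Localization.Away r)))) :=
      (PrimeSpectrum.localization_away_comap_range (Localization.Away r) r).ge hr
    obtain ⟨z, hz⟩ := hy'
    exact ⟨z, by rw [Scheme.Hom.comp_apply, hz, hy]⟩
  · rw [Category.assoc, Category.assoc, chartι_comp, ← hψ, ← Spec.map_comp, ← Spec.map_comp,
      ← CommRingCat.ofHom_comp, ← CommRingCat.ofHom_comp]
    congr 2
    ext a
    exact hχ a

end Rees

/-! ### A Jacobian criterion -/

section Jacobian

open MvPolynomial

/-- This is the Taylor expansion, which stops after the linear term when the increments multiply to
zero. -/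
theorem aeval_add_of_mul_eq_zero {B T σ : Type} [CommRing B] [CommRing T] [Algebra B T] [Fintype σ]
    (t n : σ → T) (hn : ∀ s s', n s * n s' = 0) (P : MvPolynomial σ B) :
    aeval (fun s => t s + n s) P = aeval t P + ∑ s, aeval t (pderiv s P) * n s := by
  classical
  induction P using MvPolynomial.induction_on with
  | C a => simp
  | add P Q hP hQ =>
    simp only [map_add, hP, hQ, add_mul, Finset.sum_add_distrib]
    ring
  | mul_X P i hP =>
    have h0 : (∑ s, aeval t (pderiv s P) * n s) * n i = 0 := by
      rw [Finset.sum_mul]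
      exact Finset.sum_eq_zero fun s _ => by rw [mul_assoc, hn, mul_zero]
    have h1 : ∑ s, aeval t (pderiv s (P * X i)) * n s
        = (∑ s, aeval t (pderiv s P) * n s) * t i + aeval t P * n i := by
      simp only [pderiv_mul, pderiv_X, map_add, map_mul, aeval_X, add_mul, Finset.sum_add_distrib,
        Finset.sum_mul]
      congr 1
      · exact Finset.sum_congr rfl fun s _ => by ring
      · rw [Finset.sum_eq_single i]
        · simp
        · intro s _ hs; simp [Pi.single_eq_of_ne hs.symm]
        · simp
    rw [map_mul, aeval_X, hP, h1, map_mul, aeval_X, add_mul, mul_add, mul_add, h0]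
    ring

variable {B σ ι : Type} [CommRing B]

/-- The algebra `(B[σ] / (r))[1 / W]`. -/
abbrev QuotLoc (r : ι → MvPolynomial σ B) (W : MvPolynomial σ B) : Type :=
  Localization.Away (Ideal.Quotient.mk (Ideal.span (Set.range r)) W)

/-- The canonical map to the algebra `(B[σ] / (r))[1 / W]`. -/
def toQuotLoc (r : ι → MvPolynomial σ B) (W : MvPolynomial σ B) :
    MvPolynomial σ B →ₐ[B] QuotLoc r W :=
  (IsScalarTower.toAlgHom B (MvPolynomial σ B ⧸ Ideal.span (Set.range r)) _).comp
    (Ideal.Quotient.mkₐ B _)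

variable (r : ι → MvPolynomial σ B) (W : MvPolynomial σ B)

theorem toQuotLoc_apply (P : MvPolynomial σ B) :
    toQuotLoc r W P
      = algebraMap _ (QuotLoc r W) (Ideal.Quotient.mk (Ideal.span (Set.range r)) P) := rfl

theorem toQuotLoc_relation (k : ι) : toQuotLoc r W (r k) = 0 := by
  have h : r k ∈ Ideal.span (Set.range r) := Ideal.subset_span ⟨k, rfl⟩
  rw [toQuotLoc_apply, Ideal.Quotient.eq_zero_iff_mem.mpr h, map_zero]

theorem isUnit_toQuotLoc : IsUnit (toQuotLoc r W W) :=
  IsLocalization.Away.algebraMap_isUnit (Ideal.Quotient.mk (Ideal.span (Set.range r)) W)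

theorem exists_quotLoc_lift {T : Type*} [CommRing T] (f : MvPolynomial σ B →+* T)
    (hr : ∀ k, f (r k) = 0) (hW : IsUnit (f W)) :
    ∃ g : QuotLoc r W →+* T, ∀ P, g (toQuotLoc r W P) = f P := by
  have hle : ∀ a ∈ Ideal.span (Set.range r), f a = 0 := fun a ha => by
    have : Ideal.span (Set.range r) ≤ RingHom.ker f := by
      rw [Ideal.span_le]; rintro _ ⟨k, rfl⟩; exact hr k
    exact this ha
  refine ⟨IsLocalization.Away.lift (Ideal.Quotient.mk (Ideal.span (Set.range r)) W)
    (g := Ideal.Quotient.lift _ f hle) (by simpa using hW), fun P => ?_⟩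
  rw [toQuotLoc_apply, IsLocalization.Away.lift_eq, Ideal.Quotient.lift_mk]

theorem quotLoc_ringHom_ext {T : Type*} [CommRing T] {g₁ g₂ : QuotLoc r W →+* T}
    (h : ∀ P, g₁ (toQuotLoc r W P) = g₂ (toQuotLoc r W P)) : g₁ = g₂ := by
  apply IsLocalization.ringHom_ext (Submonoid.powers (Ideal.Quotient.mk (Ideal.span (Set.range r)) W))
  ext x
  · exact h _
  · exact h _

/-- The assumption says that the Jacobian map is surjective. To lift a map through a square-zero
ideal, lift the coordinates arbitrarily and correct them by one Newton step, using a right inverse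
of the Jacobian. -/
theorem quotLoc_formallySmooth [Fintype σ] [Finite ι]
    (h : ∀ v : ι → QuotLoc r W, ∃ c : σ → QuotLoc r W,
      ∀ k, ∑ s, toQuotLoc r W (pderiv s (r k)) * c s = v k) :
    Algebra.FormallySmooth B (QuotLoc r W) := by
  classical
  cases nonempty_fintype ι
  choose N hN using fun l : ι => h (Pi.single l 1)
  refine Algebra.FormallySmooth.of_comp_surjective fun T _ _ I hI φ => ?_
  have hI2 (a b : T) (ha : a ∈ I) (hb : b ∈ I) : a * b = 0 := by
    have := Ideal.mul_mem_mul ha hb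
    rwa [← pow_two, hI] at this
  choose t ht using fun s => Ideal.Quotient.mk_surjective (φ (toQuotLoc r W (X s)))
  choose ν hν using fun l s => Ideal.Quotient.mk_surjective (φ (N l s))
  have hmk (P : MvPolynomial σ B) :
      Ideal.Quotient.mk I (aeval t P) = φ (toQuotLoc r W P) := by
    have : (Ideal.Quotient.mkₐ B I).comp (aeval t) = φ.comp (toQuotLoc r W) :=
      MvPolynomial.algHom_ext fun s => by
        rw [AlgHom.comp_apply, aeval_X]; exact ht s
    exact congr($this P)
  have hrI (k : ι) : aeval t (r k) ∈ I := by
    rw [← Ideal.Quotient.eq_zero_iff_mem, hmk, toQuotLoc_relation, map_zero]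
  -- This is the Newton correction. The `ν l` lift a right inverse of the Jacobian only modulo `I`,
  -- but the values `aeval t (r l)` lie in `I`, so the error lies in `I² = 0`.
  let n : σ → T := fun s => -∑ l, aeval t (r l) * ν l s
  have hnI (s) : n s ∈ I := neg_mem (Ideal.sum_mem _ fun l _ => Ideal.mul_mem_right _ _ (hrI l))
  have htay := aeval_add_of_mul_eq_zero (B := B) t n fun s s' => hI2 _ _ (hnI s) (hnI s')
  have hzero (k : ι) : aeval (fun s => t s + n s) (r k) = 0 := by
    have h1 : ∑ s, aeval t (pderiv s (r k)) * n s
        = -∑ l, aeval t (r l) * ∑ s, aeval t (pderiv s (r k)) * ν l s := by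
      simp only [n, mul_neg, Finset.sum_neg_distrib, Finset.mul_sum]
      rw [Finset.sum_comm]
      refine congrArg _ (Finset.sum_congr rfl fun l _ => Finset.sum_congr rfl fun s _ => by ring)
    have h2 (l : ι) : aeval t (r l) * ∑ s, aeval t (pderiv s (r k)) * ν l s
        = aeval t (r l) * (Pi.single l 1 : ι → T) k := by
      rw [← sub_eq_zero, ← mul_sub]
      refine hI2 _ _ (hrI l) ?_
      rw [← Ideal.Quotient.eq_zero_iff_mem, map_sub, map_sum, sub_eq_zero]
      simp only [map_mul, hmk, hν]
      have h3 : ∑ s, φ (toQuotLoc r W (pderiv s (r k))) * φ (N l s)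
          = φ ((Pi.single l 1 : ι → QuotLoc r W) k) := by
        rw [← hN l k, map_sum]
        exact Finset.sum_congr rfl fun s _ => (map_mul φ _ _).symm
      rw [h3]
      by_cases hkl : k = l
      · subst hkl; simp
      · simp [Pi.single_eq_of_ne hkl]
    rw [htay, h1, Finset.sum_congr rfl fun l _ => h2 l, Finset.sum_eq_single k]
    · simp
    · intro l _ hl; simp [Pi.single_eq_of_ne hl.symm]
    · simp
  have hnil : IsNilpotent I := ⟨2, hI⟩
  have hunit : IsUnit (aeval (fun s => t s + n s) W) := by
    have hu : IsUnit (Ideal.Quotient.mk I (aeval (fun s => t s + n s) W)) := by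
      rw [htay, map_add, hmk, Ideal.Quotient.eq_zero_iff_mem.mpr
        (Ideal.sum_mem _ fun s _ => Ideal.mul_mem_left _ _ (hnI s)), add_zero]
      exact (isUnit_toQuotLoc r W).map φ
    exact (IsNilpotent.isUnit_quotient_mk_iff hnil).mp hu
  obtain ⟨g, hg⟩ := exists_quotLoc_lift r W
    (aeval (fun s => t s + n s) : MvPolynomial σ B →ₐ[B] T).toRingHom hzero hunit
  let g' : QuotLoc r W →ₐ[B] T := { g with
    commutes' := fun b => by
      have := hg (C b)
      change g _ = _ at this
      rw [AlgHom.toRingHom_eq_coe, RingHom.coe_coe, aeval_C] at this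
      rw [← this]
      change g _ = g _
      rw [← MvPolynomial.algebraMap_eq, AlgHom.commutes] }
  refine ⟨g', AlgHom.coe_ringHom_injective (quotLoc_ringHom_ext r W fun P => ?_)⟩
  change Ideal.Quotient.mk I (g _) = φ _
  rw [hg]
  change Ideal.Quotient.mk I (aeval (fun s => t s + n s) P) = _
  rw [htay, map_add, hmk, Ideal.Quotient.eq_zero_iff_mem.mpr
        (Ideal.sum_mem _ fun s _ => Ideal.mul_mem_left _ _ (hnI s)), add_zero]

theorem quotLoc_smooth [Fintype σ] [Finite ι]
    (h : ∀ v : ι → QuotLoc r W, ∃ c : σ → QuotLoc r W,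
      ∀ k, ∑ s, toQuotLoc r W (pderiv s (r k)) * c s = v k) :
    Algebra.Smooth B (QuotLoc r W) where
  formallySmooth := quotLoc_formallySmooth r W h
  finitePresentation := by
    have h1 : Algebra.FinitePresentation B (MvPolynomial σ B ⧸ Ideal.span (Set.range r)) :=
      Algebra.FinitePresentation.quotient (Submodule.fg_span (Set.finite_range r))
    have h2 : Algebra.FinitePresentation (MvPolynomial σ B ⧸ Ideal.span (Set.range r))
      (QuotLoc r W) := IsLocalization.Away.finitePresentation (Ideal.Quotient.mk _ W)
    exact Algebra.FinitePresentation.trans B (MvPolynomial σ B ⧸ Ideal.span (Set.range r)) _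

end Jacobian

/-! ### Smoothness of the charts of the blow-up of a family of nodes -/

/-! ### The linearized equations of a chart of the blow-up. -/

section LinearAlgebra

open Matrix

/-- The first equation gives `ξ = H⁻¹(α + T η)`, and what remains is a linear condition `L` on `η`
with prescribed entry `η_j`. The vector `c = adj(M) e_j - adj(M)_jj u` satisfies `c_j = 0` and,
because `uᵀ M u = 0` and `u_j = 1`, also `(M u) · c = det M`. The element assumed to be a unit is `L
c * det H`, so moving `η` along `c` solves the last equation. -/
theorem exists_mulVec_eq {E n : Type} [CommRing E] [Fintype n] [DecidableEq n]
    (H M : Matrix n n E) (u s : n → E) (T : E) (j : n) (hu : u j = 1) (hq : u ⬝ᵥ (M *ᵥ u) = 0)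
    (hM : Mᵀ = M) (hH : IsUnit H.det)
    (hw : IsUnit (2 * M.det * H.det + T * (s ⬝ᵥ (H.adjugate *ᵥ
      (M.adjugate *ᵥ Pi.single j 1 - M.adjugate j j • u))))) (α : n → E) (β γ : E) :
    ∃ ξ η : n → E, H *ᵥ ξ - T • η = α ∧ η j = β ∧ s ⬝ᵥ ξ + 2 * ((M *ᵥ u) ⬝ᵥ η) = γ := by
  set c := M.adjugate *ᵥ Pi.single j 1 - M.adjugate j j • u with hc
  have hcj : c j = 0 := by
    rw [hc, Pi.sub_apply, Pi.smul_apply, hu, mulVec_single_one]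
    simp
  have huc : (M *ᵥ u) ⬝ᵥ c = M.det := by
    rw [hc, dotProduct_sub, dotProduct_smul, dotProduct_comm _ u, hq, smul_zero, sub_zero,
      dotProduct_mulVec, ← vecMul_transpose, hM, vecMul_vecMul, mul_adjugate]
    rw [vecMul_smul, vecMul_one, dotProduct_single_one, Pi.smul_apply, hu, smul_eq_mul, mul_one]
  let L : (n → E) → E := fun η => s ⬝ᵥ (H⁻¹ *ᵥ (T • η)) + 2 * ((M *ᵥ u) ⬝ᵥ η)
  have hL : IsUnit (L c) := by
    have h1 : L c * H.det = 2 * M.det * H.det + T * (s ⬝ᵥ (H.adjugate *ᵥ c)) := by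
      have h2 : H.det • H⁻¹ = H.adjugate := by
        rw [Matrix.inv_def, smul_smul, Ring.mul_inverse_cancel _ hH, one_smul]
      rw [← h2]
      simp only [L, huc, mulVec_smul, dotProduct_smul, smul_mulVec, smul_eq_mul]
      ring
    rw [← h1] at hw
    exact isUnit_of_mul_isUnit_left hw
  obtain ⟨v, hv⟩ := hL.exists_right_inv
  let l := v * (γ - s ⬝ᵥ (H⁻¹ *ᵥ α) - β * L (Pi.single j 1))
  let η := β • Pi.single j 1 + l • c
  refine ⟨H⁻¹ *ᵥ (α + T • η), η, ?_, ?_, ?_⟩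
  · rw [mulVec_mulVec, mul_nonsing_inv _ hH, one_mulVec, add_sub_cancel_right]
  · simp [η, hcj]
  · have h3 : L η = β * L (Pi.single j 1) + l * L c := by
      simp only [L, η, mulVec_add, mulVec_smul, dotProduct_add, dotProduct_smul,
        smul_eq_mul]
      ring
    have h4 : s ⬝ᵥ (H⁻¹ *ᵥ (α + T • η)) + 2 * ((M *ᵥ u) ⬝ᵥ η) = s ⬝ᵥ (H⁻¹ *ᵥ α) + L η := by
      simp only [L, mulVec_add, dotProduct_add]; ring
    rw [h4, h3]
    linear_combination (γ - s ⬝ᵥ (H⁻¹ *ᵥ α) - β * L (Pi.single j 1)) * hv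

end LinearAlgebra

instance : IsZariskiLocalAtSource (@Smooth.{0} : MorphismProperty Scheme.{0}) :=
  HasRingHomProperty.instIsZariskiLocalAtSource (P := @Smooth.{0}) (Q := RingHom.Smooth)

theorem smooth_of_forall_exists {X Y : Scheme.{0}} (f : X ⟶ Y)
    (h : ∀ x : X, ∃ (U : Scheme.{0}) (k : U ⟶ X), IsOpenImmersion k ∧ x ∈ Set.range k ∧
      Smooth (k ≫ f)) : Smooth f := by
  choose U k hk hx hs using h
  exact IsZariskiLocalAtSource.of_openCover (P := @Smooth)
    (Scheme.Cover.mkOfCovers X U k (fun x => ⟨x, hx x⟩) hk : X.OpenCover) hs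

/-- The universal property of the chart gives a map to `E`, which extends to the localization at
`w`. It is inverse to `κ`: one composite is handled by `hid`, the other by `chart_ringHom_ext`. -/
theorem chart_localization_bijective {R E ι : Type} [CommRing R] [CommRing E] (g : ι → R) {j : ι}
    (θ : R →+* E) (hs : θ (g j) ∈ nonZeroDivisors E) (hd : ∀ i, θ (g j) ∣ θ (g i))
    (w : ReesChart g j) (κ : E →+* Localization.Away w)
    (hκ : ∀ r, κ (θ r) = algebraMap _ _ (chartMap g j r))
    (hw : ∀ χ : ReesChart g j →+* E, (∀ r, χ (chartMap g j r) = θ r) → IsUnit (χ w))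
    (hid : ∀ (χ : ReesChart g j →+* E) (χ' : Localization.Away w →+* E),
      (∀ r, χ (chartMap g j r) = θ r) → (∀ c, χ' (algebraMap _ _ c) = χ c) →
        ∀ e, χ' (κ e) = e) : Function.Bijective κ := by
  obtain ⟨χ, hχ⟩ := exists_chart_lift g θ hs hd
  let χ' : Localization.Away w →+* E := IsLocalization.Away.lift w (hw χ hχ)
  have hχ' (c) : χ' (algebraMap _ _ c) = χ c := IsLocalization.Away.lift_eq w (hw χ hχ) c
  have h1 := hid χ χ' hχ hχ'
  refine ⟨Function.LeftInverse.injective h1, Function.RightInverse.surjective (g := χ') ?_⟩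
  have hcomp : κ.comp χ = algebraMap _ (Localization.Away w) := by
    refine chart_ringHom_ext g ?_ fun r => ?_
    · rw [RingHom.comp_apply, hχ, hκ]
      exact algebraMap_mem_nonZeroDivisors_away (chartMap_mem_nonZeroDivisors g j) _
    · rw [RingHom.comp_apply, hχ, hκ]
  have h2 : κ.comp χ' = RingHom.id _ := by
    apply IsLocalization.ringHom_ext (Submonoid.powers w)
    ext c
    rw [RingHom.comp_apply, RingHom.comp_apply, hχ', RingHom.id_comp, ← hcomp, RingHom.comp_apply]
  exact fun x => congr($h2 x)

section Chart

open MvPolynomial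

variable {B n : Type} [CommRing B]

/-- The coordinate ring of the hypersurface `f = 0`. -/
abbrev HypRing (f : MvPolynomial n B) : Type :=
  MvPolynomial n B ⧸ Ideal.span (Set.range fun _ : Unit => f)

/-- The quotient map to the coordinate ring of a hypersurface. -/
def toHypRing (f : MvPolynomial n B) : MvPolynomial n B →ₐ[B] HypRing f :=
  Ideal.Quotient.mkₐ B _

theorem toHypRing_self (f : MvPolynomial n B) : toHypRing f f = 0 :=
  Ideal.Quotient.eq_zero_iff_mem.mpr (Ideal.subset_span ⟨(), rfl⟩)

theorem exists_hypRing_lift {f : MvPolynomial n B} {T : Type*} [CommRing T]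
    (ψ : MvPolynomial n B →+* T) (h : ψ f = 0) :
    ∃ θ : HypRing f →+* T, ∀ P, θ (toHypRing f P) = ψ P := by
  refine ⟨Ideal.Quotient.lift _ ψ fun a ha => ?_, fun P => Ideal.Quotient.lift_mk _ _ _⟩
  have : Ideal.span (Set.range fun _ : Unit => f) ≤ RingHom.ker ψ := by
    rw [Ideal.span_le]; rintro _ ⟨_, rfl⟩; exact h
  exact this ha

theorem quotLoc_hypersurface_smooth [Fintype n] (f W : MvPolynomial n B) (j : n)
    (h : IsUnit (toQuotLoc (fun _ : Unit => f) W (pderiv j f))) :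
    Algebra.Smooth B (QuotLoc (fun _ : Unit => f) W) := by
  classical
  refine quotLoc_smooth _ _ fun v => ?_
  obtain ⟨y, hy⟩ := h.exists_right_inv
  refine ⟨Pi.single j (y * v ()), fun k => ?_⟩
  rw [Finset.sum_eq_single j]
  · rw [Pi.single_eq_same, ← mul_assoc, hy, one_mul]
  · intro s _ hs; rw [Pi.single_eq_of_ne hs, mul_zero]
  · simp

variable (f : MvPolynomial n B) (g : n → MvPolynomial n B)

/-- The structure map of the localization of a chart of the blow-up of the hypersurface. -/
def chartLocMap (j : n) (w : ReesChart (fun i => toHypRing f (g i)) j) :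
    B →+* Localization.Away w :=
  ((algebraMap _ (Localization.Away w)).comp (chartMap (fun i => toHypRing f (g i)) j)).comp
    (algebraMap B (HypRing f))

/-- Away from the exceptional divisor the blow-up changes nothing: the chart with `g_j` inverted is
the hypersurface with `g_j` inverted, where the partial derivative `∂_j f` is a unit. -/
theorem chartLocMap_smooth_of_isUnit [Fintype n] (j : n) (h : ∃ a : B, IsUnit a ∧ pderiv j f = C a * g j) :
    (chartLocMap f g j (chartMap (fun i => toHypRing f (g i)) j (toHypRing f (g j)))).Smooth := by
  obtain ⟨a, ha, hj⟩ := h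
  let E := QuotLoc (fun _ : Unit => f) (g j)
  have hu : IsUnit (toQuotLoc (fun _ : Unit => f) (g j) (g j)) := isUnit_toQuotLoc _ _
  have hE : Algebra.Smooth B E := quotLoc_hypersurface_smooth f (g j) j (by
    rw [hj, map_mul]
    exact ((ha.map C).map _).mul hu)
  let θ : HypRing f →+* E := algebraMap _ _
  let w := chartMap (fun i => toHypRing f (g i)) j (toHypRing f (g j))
  let ψ : HypRing f →+* Localization.Away w :=
    (algebraMap _ (Localization.Away w)).comp (chartMap (fun i => toHypRing f (g i)) j)
  obtain ⟨κ, hκ⟩ := exists_quotLoc_lift (fun _ : Unit => f) (g j)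
    (ψ.comp (toHypRing f).toRingHom)
    (fun _ => by
      change ψ (toHypRing f f) = 0
      rw [toHypRing_self, map_zero])
    (IsLocalization.Away.algebraMap_isUnit w)
  have hκ' (r) : κ (θ r) = ψ r := by
    obtain ⟨P, rfl⟩ := Ideal.Quotient.mk_surjective r
    exact hκ P
  have hbij : Function.Bijective κ := by
    refine chart_localization_bijective (fun i => toHypRing f (g i)) θ hu.mem_nonZeroDivisors
      (fun i => hu.dvd) w κ hκ' (fun χ hχ => ?_) (fun χ χ' hχ hχ' => ?_)
    · rw [hχ]; exact hu
    · have : χ'.comp κ = RingHom.id _ := quotLoc_ringHom_ext _ _ fun P => by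
        have e : κ (toQuotLoc (fun _ : Unit => f) (g j) P) = ψ (toHypRing f P) := hκ P
        rw [RingHom.comp_apply, e]
        exact (hχ' _).trans (hχ _)
      exact fun e => congr($this e)
  have hcomp : chartLocMap f g j w = κ.comp (algebraMap B E) := by
    ext b
    exact (hκ' (algebraMap B _ b)).symm
  change (chartLocMap f g j w).Smooth
  rw [hcomp]
  exact RingHom.Smooth.comp (RingHom.smooth_algebraMap.mpr hE) (RingHom.Smooth.of_bijective hbij)

end Chart

/-! ### Equations of the blow-up near the exceptional divisor. -/

section NodeChart

open MvPolynomial Matrix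

variable {B n : Type} [CommRing B]

/-- The embedding of `B[x]` in `B[T][x, u]`. -/
def nodeEmb : MvPolynomial n B →+* MvPolynomial (n ⊕ n) (Polynomial B) :=
  (rename Sum.inl : MvPolynomial n (Polynomial B) →ₐ[Polynomial B] _).toRingHom.comp
    (MvPolynomial.map Polynomial.C)

theorem pderiv_inl_nodeEmb (s : n) (P : MvPolynomial n B) :
    pderiv (Sum.inl s) (nodeEmb P) = nodeEmb (pderiv s P) := by
  change pderiv (Sum.inl s) (rename Sum.inl (MvPolynomial.map _ P)) = rename _ (MvPolynomial.map _ _)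
  rw [pderiv_rename Sum.inl_injective, pderiv_map]

theorem pderiv_inr_nodeEmb (s : n) (P : MvPolynomial n B) :
    pderiv (Sum.inr s) (nodeEmb P) = 0 := by
  classical
  change pderiv (Sum.inr s) (rename Sum.inl (MvPolynomial.map _ P)) = 0
  apply pderiv_eq_zero_of_notMem_vars
  intro h
  have := vars_rename _ _ h
  simp at this

variable [Fintype n] [DecidableEq n]
variable (g : n → MvPolynomial n B) (M : Matrix n n (MvPolynomial n B)) (c : MvPolynomial n B)

/-- The Jacobian matrix of the family `g`. -/
def jacobian : Matrix n n (MvPolynomial n B) := Matrix.of fun i k => pderiv k (g i)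

/-- The coordinate functions `u` on the chart. -/
def nodeU : n → MvPolynomial (n ⊕ n) (Polynomial B) := fun i => X (Sum.inr i)

/-- The partial derivatives of the quadratic form `M` in the direction of the base. -/
def nodeS : n → MvPolynomial (n ⊕ n) (Polynomial B) := fun k =>
  nodeU ⬝ᵥ ((M.map fun P => nodeEmb (pderiv k P)) *ᵥ nodeU)

/-- The equations of a chart of the blow-up of a family of nodes. -/
def nodeRel (j : n) : n ⊕ Bool → MvPolynomial (n ⊕ n) (Polynomial B)
  | Sum.inl i => nodeEmb (g i) - C Polynomial.X * X (Sum.inr i)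
  | Sum.inr false => X (Sum.inr j) - 1
  | Sum.inr true => nodeU ⬝ᵥ (nodeEmb.mapMatrix M *ᵥ nodeU)

/-- The function whose nonvanishing defines the part of the chart over a neighbourhood of the
exceptional divisor. -/
def nodeW (j : n) : MvPolynomial (n ⊕ n) (Polynomial B) :=
  nodeEmb c * (nodeEmb.mapMatrix (jacobian g)).det *
    (2 * (nodeEmb.mapMatrix M).det * (nodeEmb.mapMatrix (jacobian g)).det + C Polynomial.X *
      (nodeS M ⬝ᵥ ((nodeEmb.mapMatrix (jacobian g)).adjugate *ᵥ
        ((nodeEmb.mapMatrix M).adjugate *ᵥ Pi.single j 1 -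
          (nodeEmb.mapMatrix M).adjugate j j • nodeU))))

theorem pderiv_inr_quadratic (hM : Mᵀ = M) (s : n) :
    pderiv (Sum.inr s) (nodeU ⬝ᵥ (nodeEmb.mapMatrix M *ᵥ nodeU))
      = 2 * (nodeEmb.mapMatrix M *ᵥ nodeU) s := by
  have hsymm (a b : n) : M a b = M b a := congr($hM b a)
  simp only [dotProduct, mulVec, Finset.mul_sum, map_sum, pderiv_mul, RingHom.mapMatrix_apply,
    map_apply, pderiv_inr_nodeEmb, nodeU, pderiv_X, zero_mul, zero_add, Finset.sum_add_distrib]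
  have e1 : ∑ x, ∑ y, (Pi.single (Sum.inr s) 1 : n ⊕ n → MvPolynomial (n ⊕ n) (Polynomial B))
      (Sum.inr x) * (nodeEmb (M x y) * X (Sum.inr y)) = ∑ y, nodeEmb (M s y) * X (Sum.inr y) := by
    rw [Finset.sum_eq_single s]
    · simp
    · intro b _ hb; simp [hb]
    · simp
  have e2 : ∑ x, ∑ y, X (Sum.inr x) * (nodeEmb (M x y) *
      (Pi.single (Sum.inr s) 1 : n ⊕ n → MvPolynomial (n ⊕ n) (Polynomial B)) (Sum.inr y))
        = ∑ y, nodeEmb (M s y) * X (Sum.inr y) := by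
    refine Finset.sum_congr rfl fun x _ => ?_
    rw [Finset.sum_eq_single s]
    · simp [hsymm x s, mul_comm]
    · intro b _ hb; simp [hb]
    · simp
  rw [e1, e2, ← Finset.mul_sum, two_mul]

theorem pderiv_inl_quadratic (s : n) :
    pderiv (Sum.inl s) (nodeU ⬝ᵥ (nodeEmb.mapMatrix M *ᵥ nodeU)) = nodeS M s := by
  simp only [nodeS, dotProduct, mulVec, Finset.mul_sum, map_sum, pderiv_mul,
    RingHom.mapMatrix_apply, map_apply, pderiv_inl_nodeEmb, nodeU]
  refine Finset.sum_congr rfl fun a _ => Finset.sum_congr rfl fun b _ => ?_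
  rw [pderiv_X_of_ne (by simp), pderiv_X_of_ne (by simp)]
  ring

theorem map_nodeW {E : Type*} [CommRing E] (j : n)
    (ψ : MvPolynomial (n ⊕ n) (Polynomial B) →+* E) :
    ψ (nodeW g M c j) = ψ (nodeEmb c) * (ψ.mapMatrix (nodeEmb.mapMatrix (jacobian g))).det *
      (2 * (ψ.mapMatrix (nodeEmb.mapMatrix M)).det *
        (ψ.mapMatrix (nodeEmb.mapMatrix (jacobian g))).det + ψ (C Polynomial.X) *
      ((ψ ∘ nodeS M) ⬝ᵥ ((ψ.mapMatrix (nodeEmb.mapMatrix (jacobian g))).adjugate *ᵥ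
        ((ψ.mapMatrix (nodeEmb.mapMatrix M)).adjugate *ᵥ Pi.single j 1 -
          (ψ.mapMatrix (nodeEmb.mapMatrix M)).adjugate j j • (ψ ∘ nodeU))))) := by
  rw [nodeW, map_mul, map_mul, map_add, map_mul, map_mul, map_mul, map_ofNat, RingHom.map_det,
    RingHom.map_det, RingHom.map_dotProduct]
  refine congrArg (fun z : n → E => ψ (nodeEmb c) *
    (ψ.mapMatrix (nodeEmb.mapMatrix (jacobian g))).det *
      (2 * (ψ.mapMatrix (nodeEmb.mapMatrix M)).det *
        (ψ.mapMatrix (nodeEmb.mapMatrix (jacobian g))).det + ψ (C Polynomial.X) *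
      ((ψ ∘ nodeS M) ⬝ᵥ z))) ?_
  ext i
  rw [Function.comp_apply, RingHom.map_mulVec, ← RingHom.mapMatrix_apply, RingHom.map_adjugate]
  refine congrArg (fun z : n → E =>
    ((ψ.mapMatrix (nodeEmb.mapMatrix (jacobian g))).adjugate *ᵥ z) i) ?_
  ext k
  rw [Function.comp_apply, Pi.sub_apply, map_sub, RingHom.map_mulVec, ← RingHom.mapMatrix_apply,
    RingHom.map_adjugate, Pi.smul_apply, smul_eq_mul, map_mul, Pi.sub_apply, ← RingHom.map_adjugate]
  refine congrArg₂ (· - ·) (congrArg (fun z : n → E =>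
    (ψ.mapMatrix (nodeEmb.mapMatrix M).adjugate *ᵥ z) k) ?_) rfl
  ext l
  rw [Function.comp_apply, Pi.single_apply, Pi.single_apply, apply_ite ψ, map_one, map_zero]

/-- The Jacobian of `nodeRel` in the variables `x`, `u` is the system solved by `exists_mulVec_eq`,
and the factors of `nodeW` are the units needed there. The coordinate `T` belongs to the base, so
the result gives flatness over `B[T]` and not merely smoothness over `B`. -/
theorem nodeChart_smooth (hM : Mᵀ = M) (j : n) :
    Algebra.Smooth (Polynomial B) (QuotLoc (nodeRel g M j) (nodeW g M c j)) := by
  set φ := toQuotLoc (nodeRel g M j) (nodeW g M c j) with hφ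
  have hW : IsUnit (φ (nodeW g M c j)) := isUnit_toQuotLoc _ _
  have hrel := toQuotLoc_relation (nodeRel g M j) (nodeW g M c j)
  rw [← hφ] at hrel
  let φ' : MvPolynomial (n ⊕ n) (Polynomial B) →+* _ := φ.toRingHom
  let H := φ'.mapMatrix (nodeEmb.mapMatrix (jacobian g))
  let N := φ'.mapMatrix (nodeEmb.mapMatrix M)
  let u := φ' ∘ nodeU
  let s := φ' ∘ nodeS M
  let T := φ' (C Polynomial.X)
  have hu : u j = 1 := by
    have := hrel (Sum.inr false)
    rw [nodeRel, map_sub, map_one, sub_eq_zero] at this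
    exact this
  have hq : u ⬝ᵥ (N *ᵥ u) = 0 := by
    rw [← hrel (Sum.inr true)]
    change _ = φ' _
    rw [nodeRel, RingHom.map_dotProduct]
    congr 1
    ext i
    exact (RingHom.map_mulVec φ' _ _ i).symm
  have hN : Nᵀ = N := by
    change ((M.map nodeEmb).map φ')ᵀ = (M.map nodeEmb).map φ'
    rw [← transpose_map, ← transpose_map, hM]
  have hw := map_nodeW g M c j φ'
  change IsUnit (φ' (nodeW g M c j)) at hW
  rw [hw] at hW
  have hH : IsUnit H.det := isUnit_of_mul_isUnit_right (isUnit_of_mul_isUnit_left hW)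
  refine quotLoc_smooth _ _ fun v => ?_
  obtain ⟨ξ, η, h1, h2, h3⟩ := exists_mulVec_eq H N u s T j hu hq hN hH
    (isUnit_of_mul_isUnit_right hW) (fun i => v (Sum.inl i)) (v (Sum.inr false)) (v (Sum.inr true))
  refine ⟨Sum.elim ξ η, fun k => ?_⟩
  rw [Fintype.sum_sum_type]
  simp only [Sum.elim_inl, Sum.elim_inr, ← hφ]
  rcases k with i | (_ | _)
  · refine Eq.trans ?_ (congrFun h1 i)
    have e1 (a : n) : φ (pderiv (Sum.inl a) (nodeRel g M j (Sum.inl i))) = H i a := by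
      rw [nodeRel, map_sub, pderiv_inl_nodeEmb, pderiv_C_mul, pderiv_X_of_ne (by simp), mul_zero,
        sub_zero]
      rfl
    have e2 (a : n) : φ (pderiv (Sum.inr a) (nodeRel g M j (Sum.inl i)))
        = -T * (Pi.single i 1 : n → _) a := by
      rw [nodeRel, map_sub, pderiv_inr_nodeEmb, pderiv_C_mul, pderiv_X, zero_sub, map_neg,
        map_mul, neg_mul]
      congr 2
      rw [Pi.single_apply, Pi.single_apply]
      by_cases h : i = a
      · simp [h]
      · simp [h, Ne.symm h]
    simp only [e1, e2]
    have e3 : ∑ a, -T * (Pi.single i 1 : n → _) a * η a = -(T * η i) := by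
      rw [Finset.sum_eq_single i (fun b _ hb => by rw [Pi.single_eq_of_ne hb, mul_zero, zero_mul])
        (by simp), Pi.single_eq_same, mul_one, neg_mul]
    rw [e3, ← sub_eq_add_neg]
    rfl
  · refine Eq.trans ?_ h2
    have e1 (a : n) : φ (pderiv (Sum.inl a) (nodeRel g M j (Sum.inr false))) = 0 := by
      rw [nodeRel, map_sub, pderiv_X_of_ne (by simp), pderiv_one, sub_zero, map_zero]
    have e2 (a : n) : φ (pderiv (Sum.inr a) (nodeRel g M j (Sum.inr false)))
        = (Pi.single j 1 : n → _) a := by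
      rw [nodeRel, map_sub, pderiv_X, pderiv_one, sub_zero, Pi.single_apply, Pi.single_apply]
      by_cases h : j = a
      · simp [h]
      · simp [h, Ne.symm h]
    simp only [e1, e2, zero_mul, Finset.sum_const_zero, zero_add]
    rw [Finset.sum_eq_single j (fun b _ hb => by simp [hb]) (by simp), Pi.single_eq_same, one_mul]
  · refine Eq.trans ?_ h3
    have e2 (a : n) : φ (2 * (nodeEmb.mapMatrix M *ᵥ nodeU) a) = 2 * (N *ᵥ u) a := by
      rw [map_mul, map_ofNat]
      congr 1
      exact RingHom.map_mulVec φ' _ _ a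
    simp only [nodeRel, pderiv_inl_quadratic, pderiv_inr_quadratic M hM, e2]
    have e3 : ∑ a, 2 * (N *ᵥ u) a * η a = 2 * ((N *ᵥ u) ⬝ᵥ η) := by
      simp only [dotProduct, Finset.mul_sum, mul_assoc]
    rw [e3]
    rfl

end NodeChart

/-! ### Comparison of the explicit equations with the charts of the blow-up. -/

section NodeBlowup

open MvPolynomial Matrix

variable {B n : Type} [CommRing B]

theorem nodeEmb_X (i : n) : nodeEmb (B := B) (X i) = X (Sum.inl i) := by
  change rename Sum.inl (MvPolynomial.map _ (X i)) = _
  rw [map_X, rename_X]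

theorem nodeEmb_C (b : B) : nodeEmb (n := n) (C b) = C (Polynomial.C b) := by
  change rename Sum.inl (MvPolynomial.map _ (C b)) = _
  rw [map_C, rename_C]

theorem nodePoly_ringHom_ext {E : Type*} [CommRing E]
    {φ ψ : MvPolynomial (n ⊕ n) (Polynomial B) →+* E}
    (h1 : ∀ P, φ (nodeEmb P) = ψ (nodeEmb P)) (h2 : φ (C Polynomial.X) = ψ (C Polynomial.X))
    (h3 : ∀ i, φ (X (Sum.inr i)) = ψ (X (Sum.inr i))) : φ = ψ := by
  apply MvPolynomial.ringHom_ext'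
  · ext b
    · have := h1 (C b)
      rwa [nodeEmb_C] at this
    · exact h2
  · rintro (i | i)
    · have := h1 (X i)
      rwa [nodeEmb_X] at this
    · exact h3 i

variable (f : MvPolynomial n B) (g : n → MvPolynomial n B)

/-- The generators of the ideal of the nodes, as functions on the hypersurface. -/
abbrev nodeGen : n → HypRing f := fun i => toHypRing f (g i)

/-- Evaluation of polynomials in `T`, `x` and `u` on a chart. -/
def nodeEval (j : n) :
    MvPolynomial (n ⊕ n) (Polynomial B) →+* ReesChart (nodeGen f g) j :=
  eval₂Hom (Polynomial.eval₂RingHom ((chartMap (nodeGen f g) j).comp (algebraMap B (HypRing f)))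
      (chartMap (nodeGen f g) j (nodeGen f g j)))
    (Sum.elim (fun i => chartMap (nodeGen f g) j (toHypRing f (X i)))
      (chartVar (nodeGen f g) j))

theorem nodeEval_nodeEmb (j : n) (P : MvPolynomial n B) :
    nodeEval f g j (nodeEmb P) = chartMap (nodeGen f g) j (toHypRing f P) := by
  have : (nodeEval f g j).comp nodeEmb
      = (chartMap (nodeGen f g) j).comp (toHypRing f : MvPolynomial n B →+* HypRing f) := by
    apply MvPolynomial.ringHom_ext
    · intro b
      rw [RingHom.comp_apply, nodeEmb_C, nodeEval, coe_eval₂Hom, eval₂_C,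
        Polynomial.coe_eval₂RingHom, Polynomial.eval₂_C]
      rfl
    · intro i
      rw [RingHom.comp_apply, nodeEmb_X, nodeEval, coe_eval₂Hom, eval₂_X]
      rfl
  exact congr($this P)

theorem nodeEval_T (j : n) :
    nodeEval f g j (C Polynomial.X) = chartMap (nodeGen f g) j (nodeGen f g j) := by
  rw [nodeEval, coe_eval₂Hom, eval₂_C, Polynomial.coe_eval₂RingHom, Polynomial.eval₂_X]

theorem nodeEval_U (j i : n) :
    nodeEval f g j (X (Sum.inr i)) = chartVar (nodeGen f g) j i := by
  rw [nodeEval, coe_eval₂Hom, eval₂_X]; rfl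

theorem quadratic_smul [Fintype n] {E : Type*} [CommRing E] (N : Matrix n n E) (u v : n → E) (T : E)
    (h : ∀ i, v i = T * u i) : v ⬝ᵥ (N *ᵥ v) = T * T * (u ⬝ᵥ (N *ᵥ u)) := by
  have : v = T • u := funext h
  rw [this, mulVec_smul, dotProduct_smul, smul_dotProduct, smul_eq_mul, smul_eq_mul, mul_assoc]

variable [Fintype n] [DecidableEq n] (M : Matrix n n (MvPolynomial n B)) (c : MvPolynomial n B)

/-- Substituting `g = T u` turns `c f = gᵀ M g` into `c f = T² uᵀ M u`. In the model `E` the right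
side vanishes and `c` is a unit, so `f = 0`. In the chart `f = 0` and `T` is a nonzerodivisor, so
`uᵀ M u = 0`. Hence maps exist in both directions. -/
theorem exists_nodeChart_equiv (hc : c * f = g ⬝ᵥ (M *ᵥ g)) (j : n) {E : Type} [CommRing E]
    (φ : MvPolynomial (n ⊕ n) (Polynomial B) →+* E) (hW : IsUnit (φ (nodeW g M c j)))
    (hrel : ∀ k, φ (nodeRel g M j k) = 0) (hT : φ (C Polynomial.X) ∈ nonZeroDivisors E)
    (hlift : ∀ {A : Type} [CommRing A] (ψ : MvPolynomial (n ⊕ n) (Polynomial B) →+* A),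
      (∀ k, ψ (nodeRel g M j k) = 0) → IsUnit (ψ (nodeW g M c j)) →
        ∃ κ : E →+* A, ∀ P, κ (φ P) = ψ P)
    (hext : ∀ {κ₁ κ₂ : E →+* E}, (∀ P, κ₁ (φ P) = κ₂ (φ P)) → κ₁ = κ₂) :
    ∃ κ : E →+* Localization.Away (nodeEval f g j (nodeW g M c j)), Function.Bijective κ ∧
      ∀ b, κ (φ (nodeEmb (C b))) = chartLocMap f g j (nodeEval f g j (nodeW g M c j)) b := by
  have hcu : IsUnit (φ (nodeEmb c)) := by
    have h := map_nodeW g M c j φ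
    rw [h] at hW
    exact isUnit_of_mul_isUnit_left (isUnit_of_mul_isUnit_left hW)
  have hg (i) : φ (nodeEmb (g i)) = φ (C Polynomial.X) * φ (X (Sum.inr i)) := by
    have := hrel (Sum.inl i)
    rwa [nodeRel, map_sub, map_mul, sub_eq_zero] at this
  have huj : φ (X (Sum.inr j)) = 1 := by
    have := hrel (Sum.inr false)
    rwa [nodeRel, map_sub, map_one, sub_eq_zero] at this
  have hgj : φ (nodeEmb (g j)) = φ (C Polynomial.X) := by rw [hg, huj, mul_one]
  have hquad {A : Type} [CommRing A] (ψ : MvPolynomial (n ⊕ n) (Polynomial B) →+* A)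
      (h : ∀ i, ψ (nodeEmb (g i)) = ψ (C Polynomial.X) * ψ (X (Sum.inr i))) :
      ψ (nodeEmb c) * ψ (nodeEmb f) = ψ (C Polynomial.X) * ψ (C Polynomial.X) *
        ψ (nodeRel g M j (Sum.inr true)) := by
    rw [← map_mul, ← map_mul, hc, RingHom.map_dotProduct, RingHom.map_dotProduct, nodeRel,
      RingHom.map_dotProduct]
    have e1 : ψ ∘ nodeEmb ∘ (M *ᵥ g)
        = ψ.mapMatrix (nodeEmb.mapMatrix M) *ᵥ (ψ ∘ nodeEmb ∘ g) := by
      ext i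
      simp only [Function.comp_apply]
      rw [RingHom.map_mulVec, RingHom.map_mulVec]
      rfl
    have e2 : ψ ∘ (nodeEmb.mapMatrix M *ᵥ nodeU)
        = ψ.mapMatrix (nodeEmb.mapMatrix M) *ᵥ (ψ ∘ nodeU) := by
      ext i
      simp only [Function.comp_apply]
      rw [RingHom.map_mulVec]
      rfl
    rw [e1, e2]
    exact quadratic_smul _ _ _ _ h
  have hf : φ (nodeEmb f) = 0 := by
    have := hquad φ hg
    rw [hrel, mul_zero] at this
    exact (hcu.mul_right_eq_zero).mp this
  obtain ⟨θ, hθ⟩ := exists_hypRing_lift (f := f) (φ.comp nodeEmb) hf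
  let G := nodeGen f g
  have hGnz := chartMap_mem_nonZeroDivisors G j
  have hev (i) : nodeEval f g j (nodeEmb (g i))
      = nodeEval f g j (C Polynomial.X) * nodeEval f g j (X (Sum.inr i)) := by
    rw [nodeEval_nodeEmb, nodeEval_T, nodeEval_U]
    exact (chartMap_mul_chartVar G j i).symm
  let w := nodeEval f g j (nodeW g M c j)
  have hkrel (k) : nodeEval f g j (nodeRel g M j k) = 0 := by
    rcases k with i | (_ | _)
    · rw [nodeRel, map_sub, map_mul, hev, sub_self]
    · rw [nodeRel, map_sub, map_one, nodeEval_U]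
      refine (mul_left_mem_nonZeroDivisors_eq_zero_iff hGnz).mp ?_
      rw [mul_sub, mul_one]
      exact sub_eq_zero.mpr (chartMap_mul_chartVar G j j)
    · have := hquad (nodeEval f g j) hev
      rw [nodeEval_nodeEmb (P := f), toHypRing_self, map_zero, mul_zero, nodeEval_T] at this
      exact (mul_left_mem_nonZeroDivisors_eq_zero_iff (mul_mem hGnz hGnz)).mp this.symm
  obtain ⟨κ, hκ⟩ := hlift
    ((algebraMap _ (Localization.Away w)).comp (nodeEval f g j))
    (fun k => by rw [RingHom.comp_apply, hkrel, map_zero])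
    (IsLocalization.Away.algebraMap_isUnit w)
  have hκ' (r) : κ (θ r) = algebraMap _ (Localization.Away w) (chartMap G j r) := by
    obtain ⟨P, rfl⟩ := Ideal.Quotient.mk_surjective r
    have h1 : θ (Ideal.Quotient.mk _ P) = φ (nodeEmb P) := hθ P
    rw [h1]
    refine (hκ _).trans ?_
    rw [RingHom.comp_apply, nodeEval_nodeEmb]
    rfl
  have hχev (χ : ReesChart G j →+* E) (hχ : ∀ r, χ (chartMap G j r) = θ r) :
      χ.comp (nodeEval f g j) = φ := by
    apply nodePoly_ringHom_ext
    · intro P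
      rw [RingHom.comp_apply, nodeEval_nodeEmb, hχ, hθ]
      rfl
    · rw [RingHom.comp_apply, nodeEval_T, hχ, hθ]
      exact hgj
    · intro i
      rw [RingHom.comp_apply, nodeEval_U]
      refine (mul_cancel_left_mem_nonZeroDivisors hT).mp ?_
      rw [← hg, ← hgj]
      have h2 := congrArg χ (chartMap_mul_chartVar G j i)
      rw [map_mul, hχ, hχ, hθ, hθ] at h2
      exact h2
  have hθg (i) : θ (G i) = φ (C Polynomial.X) * φ (X (Sum.inr i)) := (hθ _).trans (hg i)
  have hbij : Function.Bijective κ := by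
    refine chart_localization_bijective G θ ?_ (fun i => ?_) w κ hκ' (fun χ hχ => ?_)
      (fun χ χ' hχ hχ' => ?_)
    · rw [hθg, huj, mul_one]; exact hT
    · rw [hθg, hθg, huj, mul_one]; exact dvd_mul_right _ _
    · have := congr($(hχev χ hχ) (nodeW g M c j))
      rw [RingHom.comp_apply] at this
      rw [this]; exact hW
    · have : χ'.comp κ = RingHom.id _ := hext fun P => by
        have e := hκ P
        rw [RingHom.comp_apply, e, RingHom.comp_apply, hχ']
        exact congr($(hχev χ hχ) P)
      exact fun e => congr($this e)
  refine ⟨κ, hbij, fun b => (hκ _).trans ?_⟩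
  rw [RingHom.comp_apply, nodeEval_nodeEmb]
  rfl

/-- The comparison with the chart requires `T` to be a nonzerodivisor on the model. This holds
because the model is smooth, hence flat, over `B[T]`. -/
theorem chartLocMap_nodeW_smooth (hM : Mᵀ = M) (hc : c * f = g ⬝ᵥ (M *ᵥ g)) (j : n) :
    (chartLocMap f g j (nodeEval f g j (nodeW g M c j))).Smooth := by
  have hE : Algebra.Smooth (Polynomial B) (QuotLoc (nodeRel g M j) (nodeW g M c j)) :=
    nodeChart_smooth g M c hM j
  have hT : toQuotLoc (nodeRel g M j) (nodeW g M c j) (C Polynomial.X) ∈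
      nonZeroDivisors (QuotLoc (nodeRel g M j) (nodeW g M c j)) := by
    have hflat : Module.Flat (Polynomial B) (QuotLoc (nodeRel g M j) (nodeW g M c j)) :=
      inferInstance
    have h1 : IsSMulRegular (QuotLoc (nodeRel g M j) (nodeW g M c j))
        (Polynomial.X : Polynomial B) :=
      Module.Flat.isSMulRegular_of_nonZeroDivisors Polynomial.monic_X.mem_nonZeroDivisors
    have h2 := (toQuotLoc (nodeRel g M j) (nodeW g M c j)).commutes Polynomial.X
    rw [MvPolynomial.algebraMap_eq] at h2
    rw [h2, mem_nonZeroDivisors_iff_right]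
    intro x hx
    refine h1.right_eq_zero_of_smul ?_
    rw [Algebra.smul_def, mul_comm, hx]
  obtain ⟨κ, hbij, hκ⟩ := exists_nodeChart_equiv f g M c hc j
    (toQuotLoc (nodeRel g M j) (nodeW g M c j)).toRingHom (isUnit_toQuotLoc _ _)
    (toQuotLoc_relation (nodeRel g M j) (nodeW g M c j)) hT
    (exists_quotLoc_lift _ _) (quotLoc_ringHom_ext _ _)
  have hcomp : chartLocMap f g j (nodeEval f g j (nodeW g M c j)) = κ.comp
      ((algebraMap (Polynomial B) (QuotLoc (nodeRel g M j) (nodeW g M c j))).comp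
        (algebraMap B (Polynomial B))) := by
    ext b
    rw [← hκ, nodeEmb_C, RingHom.comp_apply]
    exact congrArg κ ((toQuotLoc (nodeRel g M j) (nodeW g M c j)).commutes (Polynomial.C b))
  rw [hcomp]
  refine RingHom.Smooth.comp (RingHom.Smooth.comp (RingHom.smooth_algebraMap.mpr ?_)
    (RingHom.smooth_algebraMap.mpr hE)) (RingHom.Smooth.of_bijective hbij)
  exact {}

/-- The blow-up of a hypersurface along a family of nodes is smooth. -/
theorem reesBlowup_smooth (hM : Mᵀ = M) (hc : c * f = g ⬝ᵥ (M *ᵥ g))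
    (hd : ∀ j, ∃ a : B, IsUnit a ∧ pderiv j f = C a * g j)
    (hK : ∀ (K : Type) [Field K] (φ : MvPolynomial n B →+* K), φ f = 0 → (∀ i, φ (g i) = 0) →
      φ c ≠ 0 ∧ φ M.det ≠ 0 ∧ φ (jacobian g).det ≠ 0 ∧ (2 : K) ≠ 0) :
    Smooth (reesBlowupHom (nodeGen f g) ≫
      Spec.map (CommRingCat.ofHom (algebraMap B (HypRing f)))) := by
  refine smooth_of_forall_exists _ fun x => ?_
  obtain ⟨j, y, rfl⟩ := exists_mem_range_chartι (nodeGen f g) x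
  have key (w : ReesChart (nodeGen f g) j) (hw : (chartLocMap f g j w).Smooth)
      (hy : w ∉ (y : PrimeSpectrum (ReesChart (nodeGen f g) j)).asIdeal) :
      ∃ (U : Scheme.{0}) (k : U ⟶ reesBlowup (nodeGen f g)), IsOpenImmersion k ∧
        chartι (nodeGen f g) j y ∈ Set.range k ∧ Smooth (k ≫ reesBlowupHom (nodeGen f g) ≫
          Spec.map (CommRingCat.ofHom (algebraMap B (HypRing f)))) := by
    refine ⟨_, Spec.map (CommRingCat.ofHom (algebraMap (ReesChart (nodeGen f g) j)
      (Localization.Away w))) ≫ chartι (nodeGen f g) j, inferInstance, ?_, ?_⟩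
    · have hy' : y ∈ Set.range (Spec.map (CommRingCat.ofHom
          (algebraMap (ReesChart (nodeGen f g) j) (Localization.Away w)))) :=
        (PrimeSpectrum.localization_away_comap_range (Localization.Away w) w).ge hy
      obtain ⟨z, hz⟩ := hy'
      exact ⟨z, by rw [Scheme.Hom.comp_apply, hz]⟩
    · have e := chartι_comp (nodeGen f g) j
      rw [Category.assoc, reassoc_of% e, ← Spec.map_comp, ← Spec.map_comp,
        HasRingHomProperty.Spec_iff (P := @Smooth.{0}) (Q := RingHom.Smooth)]
      exact hw
  -- The point lies on the exceptional divisor exactly when `g_j` vanishes at it; the two cases use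
  -- different smooth neighbourhoods.
  by_cases hy : chartMap (nodeGen f g) j (nodeGen f g j) ∈
      (y : PrimeSpectrum (ReesChart (nodeGen f g) j)).asIdeal
  · refine key _ (chartLocMap_nodeW_smooth f g M c hM hc j) fun hmem => ?_
    let 𝔭 := (y : PrimeSpectrum (ReesChart (nodeGen f g) j)).asIdeal
    have h𝔭 : 𝔭.IsPrime := (y : PrimeSpectrum (ReesChart (nodeGen f g) j)).2
    let ρ : ReesChart (nodeGen f g) j →+* 𝔭.ResidueField := algebraMap _ _
    have hρ (a) : ρ a = 0 ↔ a ∈ 𝔭 := Ideal.algebraMap_residueField_eq_zero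
    let ψ := ρ.comp (nodeEval f g j)
    have hT : ψ (C Polynomial.X) = 0 := by
      rw [RingHom.comp_apply, nodeEval_T, hρ]; exact hy
    obtain ⟨h1, h2, h3, h4⟩ := hK 𝔭.ResidueField (ψ.comp nodeEmb)
      (by rw [RingHom.comp_apply, RingHom.comp_apply, nodeEval_nodeEmb, toHypRing_self, map_zero,
        map_zero])
      (fun i => by
        rw [RingHom.comp_apply, RingHom.comp_apply, nodeEval_nodeEmb,
          ← chartMap_mul_chartVar (nodeGen f g) j i, map_mul, (hρ _).mpr hy, zero_mul])
    have h0 : ψ (nodeW g M c j) = 0 := (hρ _).mpr hmem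
    have h5 := map_nodeW g M c j ψ
    -- At `T = 0` the function `nodeW` reduces to `c * det J * (2 * det M * det J)` with `J` the
    -- Jacobian matrix of `g`, and all these factors are nonzero at a node.
    rw [h5, hT, zero_mul, add_zero, ← RingHom.map_det, ← RingHom.map_det,
      ← RingHom.map_det, ← RingHom.map_det] at h0
    exact mul_ne_zero (mul_ne_zero h1 h3) (mul_ne_zero (mul_ne_zero h4 h2) h3) h0
  · exact key _ (chartLocMap_smooth_of_isUnit f g j (hd j)) hy

end NodeBlowup

/-! ### The Chebyshev quintic and the certificate for its critical points -/

section Certificate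

variable {A : Type*} [CommRing A]

/-- The value of `P₅` at `(x, y)`. -/
def quintic (x y : A) : A :=
  x ^ 5 + y ^ 5 - 5 * x * y * (x ^ 2 + y ^ 2) + 5 * x * y * (x + y)
    + 5 * (x ^ 2 + y ^ 2) - 5 * (x + y)

/-- One fifth of the partial derivative of `P₅` in the first variable. By symmetry,
`quinticDeriv y x` is one fifth of the derivative in the second variable. -/
def quinticDeriv (x y : A) : A :=
  x ^ 4 - 3 * x ^ 2 * y - y ^ 3 + 2 * x * y + y ^ 2 + 2 * x - 1

/-- The derivative of `quinticDeriv` in its first variable. -/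
def quinticDxx (x y : A) : A := 4 * x ^ 3 - 6 * x * y + 2 * y + 2

/-- The derivative of `quinticDeriv` in its second variable. -/
def quinticDxy (x y : A) : A := -3 * x ^ 2 - 3 * y ^ 2 + 2 * x + 2 * y

/-- One of the coefficients of `quintic_certificate`. -/
def certA (x y : A) : A :=
  x ^ 7 - 9 * x ^ 5 * y + 11 * x ^ 4 * y + 17 * x ^ 4 - 13 * x ^ 3 * y ^ 3
    + 22 * x ^ 3 * y ^ 2 - 25 * x ^ 3 + 3 * x ^ 2 * y ^ 5 + 18 * x ^ 2 * y ^ 2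
    - 39 * x ^ 2 * y + 5 * x ^ 2 + 18 * x * y ^ 4 - 16 * x * y ^ 3 - 9 * x * y ^ 2
    + 26 * x * y + x - 6 * y ^ 6 + 3 * y ^ 4 - 36 * y ^ 3 + 13 * y ^ 2 - 12

/-- One of the coefficients of `quintic_certificate`. -/
def certB (x y : A) : A :=
  -3 * x ^ 3 * y ^ 2 + 18 * x ^ 3 * y + 3 * x ^ 3 - 3 * x ^ 2 * y ^ 3
    - 14 * x ^ 2 * y - 53 * x ^ 2 + 18 * x * y ^ 3 - 14 * x * y ^ 2 - 10 * x * y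
    + 47 * x + 3 * y ^ 3 - 53 * y ^ 2 + 47 * y - 12

/-- `(P₅ + 2)(P₅ + 3)(P₅ - 6)` is a quadratic form in the partial derivatives of `P₅`. -/
theorem quintic_certificate (x y : A) :
    (quintic x y + 2) * (quintic x y + 3) * (quintic x y - 6) =
      certA x y * quinticDeriv x y ^ 2 + certB x y * quinticDeriv x y * quinticDeriv y x
        + certA y x * quinticDeriv y x ^ 2 := by
  simp only [quintic, certA, certB, quinticDeriv]
  ring

theorem quinticDxy_comm (x y : A) : quinticDxy x y = quinticDxy y x := by
  simp only [quinticDxy]; ring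

theorem certB_comm (x y : A) : certB x y = certB y x := by
  simp only [certB]; ring

theorem quintic_comm (x y : A) : quintic x y = quintic y x := by
  simp only [quintic]; ring

/-- Let `N` be the matrix of the certificate with doubled diagonal and `J` the Jacobian matrix of
the two derivatives. Differentiating the certificate twice at a critical point gives `J N J =
5χ'(P₅) J`, which suggests `N J = 5χ'(P₅)`. This is a diagonal entry of the latter identity,
verified by explicit cofactors so that `J` need not be invertible; the off-diagonal entry follows
next. -/
theorem cert_mul_hessian_diag {x y : A} (h : quinticDeriv x y = 0) (h' : quinticDeriv y x = 0) :
    2 * certA x y * quinticDxx x y + certB x y * quinticDxy x y =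
      5 * (3 * quintic x y ^ 2 - 2 * quintic x y - 24) := by
  have key : 2 * certA x y * quinticDxx x y + certB x y * quinticDxy x y =
      5 * (3 * quintic x y ^ 2 - 2 * quintic x y - 24) + quinticDeriv x y * (
    -7 * x ^ 6 + 45 * x ^ 4 * y - 44 * x ^ 3 * y - 68 * x ^ 3 + 39 * x ^ 2 * y ^ 3
    - 66 * x ^ 2 * y ^ 2 + 75 * x ^ 2 - 6 * x * y ^ 5 - 36 * x * y ^ 2 + 78 * x * y
    - 10 * x - 18 * y ^ 4 + 16 * y ^ 3 + 9 * y ^ 2 - 26 * y - 1) + quinticDeriv y x * (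
    -72 * x ^ 4 + 33 * x ^ 3 * y ^ 2 + 60 * x ^ 3 - 150 * x ^ 2 * y ^ 2
    - 66 * x ^ 2 * y + 9 * x ^ 2 + 99 * x * y ^ 4 - 42 * x * y ^ 3 + 192 * x * y
    + 78 * x - 15 * y ^ 6 - 162 * y ^ 3 + 145 * y ^ 2 + 6 * y - 71) := by
    simp only [quintic, certA, certB, quinticDeriv, quinticDxx, quinticDxy]
    ring
  rw [key, h, h', zero_mul, zero_mul, add_zero, add_zero]

theorem cert_mul_hessian_off {x y : A} (h : quinticDeriv x y = 0) (h' : quinticDeriv y x = 0) :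
    certB x y * quinticDxx x y + 2 * certA y x * quinticDxy x y = 0 := by
  have key : certB x y * quinticDxx x y + 2 * certA y x * quinticDxy x y =
      quinticDeriv x y * (
    72 * x ^ 4 - 33 * x ^ 3 * y ^ 2 - 60 * x ^ 3 + 159 * x ^ 2 * y ^ 2 + 12 * x ^ 2 * y
    - 18 * x ^ 2 - 99 * x * y ^ 4 + 48 * x * y ^ 3 - 164 * x * y + 28 * x + 15 * y ^ 6
    + 144 * y ^ 3 - 131 * y ^ 2 + 4 * y + 24) + quinticDeriv y x * (
    36 * x ^ 5 - 15 * x ^ 4 * y ^ 2 - 72 * x ^ 3 * y - 12 * x ^ 3 + 39 * x ^ 2 * y ^ 3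
    + 48 * x ^ 2 * y + 108 * x ^ 2 - 44 * x * y ^ 3 - 36 * x * y ^ 2 + 18 * x * y
    - 26 * x + 9 * y ^ 5 - 11 * y ^ 4 + 39 * y ^ 2 - 26 * y) := by
    simp only [certA, certB, quinticDeriv, quinticDxx, quinticDxy]
    ring
  rw [key, h, h', zero_mul, zero_mul, add_zero]

/-- Take determinants in `N J = 5χ'(P₅)`; the four entries come from the two preceding lemmas and
the symmetry exchanging `x` and `y`. -/
theorem cert_det_mul_hessian_det {x y : A} (h : quinticDeriv x y = 0)
    (h' : quinticDeriv y x = 0) :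
    (4 * certA x y * certA y x - certB x y ^ 2) *
        (quinticDxx x y * quinticDxx y x - quinticDxy x y ^ 2) =
      (5 * (3 * quintic x y ^ 2 - 2 * quintic x y - 24)) ^ 2 := by
  have h1 := cert_mul_hessian_diag h h'
  have h2 := cert_mul_hessian_off h h'
  have h3 := cert_mul_hessian_diag h' h
  have h4 := cert_mul_hessian_off h' h
  rw [certB_comm y x, quinticDxy_comm y x] at h3 h4
  rw [quintic_comm y x] at h3
  have : (4 * certA x y * certA y x - certB x y ^ 2) *
        (quinticDxx x y * quinticDxx y x - quinticDxy x y ^ 2) =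
      (2 * certA x y * quinticDxx x y + certB x y * quinticDxy x y) *
        (2 * certA y x * quinticDxx y x + certB x y * quinticDxy x y) -
      (certB x y * quinticDxx x y + 2 * certA y x * quinticDxy x y) *
        (certB x y * quinticDxx y x + 2 * certA x y * quinticDxy x y) := by ring
  rw [this, h1, h2, h3, zero_mul, sub_zero]
  ring

end Certificate

/-! ### Critical values and nondegeneracy over a field. -/

section CriticalValues

variable {K : Type*} [Field K]

theorem quintic_eq_of_critical {x y : K} (h : quinticDeriv x y = 0) (h' : quinticDeriv y x = 0) :
    quintic x y = -2 ∨ quintic x y = -3 ∨ quintic x y = 6 := by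
  have := quintic_certificate x y
  rw [h, h'] at this
  simp only [ne_eq, OfNat.ofNat_ne_zero, not_false_eq_true, zero_pow, mul_zero, add_zero,
    mul_eq_zero, or_assoc] at this
  refine this.imp (fun h => by linear_combination h)
    (Or.imp (fun h => by linear_combination h) fun h => by linear_combination h)

theorem ne_zero_of_thirty {A : Type*} [CommRing A] (h30 : (30 : A) ≠ 0) :
    (2 : A) ≠ 0 ∧ (3 : A) ≠ 0 ∧ (5 : A) ≠ 0 := by
  refine ⟨fun h => h30 ?_, fun h => h30 ?_, fun h => h30 ?_⟩
  · linear_combination 15 * h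
  · linear_combination 10 * h
  · linear_combination 6 * h

/-- The three values are `-8`, `9` and `72`. So the roots of `χ` stay simple outside the primes `2`
and `3`. -/
theorem chi_deriv_ne_zero (h30 : (30 : K) ≠ 0) {t : K} (ht : t = -2 ∨ t = -3 ∨ t = 6) :
    3 * t ^ 2 - 2 * t - 24 ≠ 0 := by
  obtain ⟨h2, h3, h5⟩ := ne_zero_of_thirty h30
  rcases ht with rfl | rfl | rfl <;> intro h
  · exact pow_ne_zero 3 h2 (by linear_combination -h)
  · exact pow_ne_zero 2 h3 (by linear_combination h)
  · exact mul_ne_zero (pow_ne_zero 3 h2) (pow_ne_zero 2 h3) (by linear_combination h)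

theorem cert_hessian_ne_zero (h30 : (30 : K) ≠ 0) {x y : K} (h : quinticDeriv x y = 0)
    (h' : quinticDeriv y x = 0) :
    4 * certA x y * certA y x - certB x y ^ 2 ≠ 0 ∧
      quinticDxx x y * quinticDxx y x - quinticDxy x y ^ 2 ≠ 0 := by
  have := cert_det_mul_hessian_det h h'
  have hne := pow_ne_zero 2 (mul_ne_zero (ne_zero_of_thirty h30).2.2
    (chi_deriv_ne_zero h30 (quintic_eq_of_critical h h')))
  rw [← this] at hne
  exact mul_ne_zero_iff.mp hne

end CriticalValues

section Maps

variable {A A' : Type*} [CommRing A] [CommRing A'] (φ : A →+* A') (x y : A)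

theorem map_quintic : φ (quintic x y) = quintic (φ x) (φ y) := by
  simp [quintic, map_ofNat]

theorem map_quinticDeriv : φ (quinticDeriv x y) = quinticDeriv (φ x) (φ y) := by
  simp [quinticDeriv, map_ofNat]

theorem map_quinticDxx : φ (quinticDxx x y) = quinticDxx (φ x) (φ y) := by
  simp [quinticDxx, map_ofNat]

theorem map_quinticDxy : φ (quinticDxy x y) = quinticDxy (φ x) (φ y) := by
  simp [quinticDxy, map_ofNat]

theorem map_certA : φ (certA x y) = certA (φ x) (φ y) := by
  simp [certA, map_ofNat]

theorem map_certB : φ (certB x y) = certB (φ x) (φ y) := by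
  simp [certB, map_ofNat]

variable {R : Type*} [CommRing R] [Algebra R A] (D : Derivation R A A)

theorem derivation_quintic :
    D (quintic x y) = 5 * quinticDeriv x y * D x + 5 * quinticDeriv y x * D y := by
  have h5 : D 5 = 0 := by simpa using D.map_natCast 5
  simp only [quintic, quinticDeriv, map_add, map_sub, Derivation.leibniz, Derivation.leibniz_pow,
    smul_eq_mul, nsmul_eq_mul, h5]
  push_cast
  ring

theorem derivation_quinticDeriv :
    D (quinticDeriv x y) = quinticDxx x y * D x + quinticDxy x y * D y := by
  have h2 : D 2 = 0 := by simpa using D.map_natCast 2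
  have h3 : D 3 = 0 := by simpa using D.map_natCast 3
  simp only [quinticDeriv, quinticDxx, quinticDxy, map_add, map_sub, Derivation.leibniz,
    Derivation.leibniz_pow, smul_eq_mul, nsmul_eq_mul, h2, h3, Derivation.map_one_eq_zero]
  push_cast
  ring

end Maps

/-! ### The quadratic form and the nodes of the affine threefold. -/

section AffineThreefold

open MvPolynomial Matrix

variable (B : Type) [CommRing B]

theorem P5_eq (A : Type*) [CommRing A] : P5 A = quintic (X 0) (X 1) := rfl

theorem f5_eq : f5 B = quintic (X 0) (X 1) - quintic (X 2) (X 3) := by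
  rw [f5, P5_eq]
  have h (v : Fin 2 → Fin 4) : rename (R := B) v (quintic (X 0) (X 1)) =
      quintic (X (v 0)) (X (v 1)) := by
    have := map_quintic (rename (R := B) v).toRingHom (X 0) (X 1)
    simpa using this
  rw [h, h]
  rfl

/-- The partial derivatives of `f₅`, divided by `5`. -/
def nodeEqs : Fin 4 → MvPolynomial (Fin 4) B :=
  ![quinticDeriv (X 0) (X 1), quinticDeriv (X 1) (X 0),
    -quinticDeriv (X 2) (X 3), -quinticDeriv (X 3) (X 2)]

/-- The symmetric matrix of the quadratic form in `nodeEqs` which represents a multiple of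
`f₅`. -/
def nodeForm : Matrix (Fin 4) (Fin 4) (MvPolynomial (Fin 4) B) :=
  !![2 * certA (X 0) (X 1), certB (X 0) (X 1), 0, 0;
    certB (X 0) (X 1), 2 * certA (X 1) (X 0), 0, 0;
    0, 0, -(2 * certA (X 2) (X 3)), -certB (X 2) (X 3);
    0, 0, -certB (X 2) (X 3), -(2 * certA (X 3) (X 2))]

/-- The multiple of `f₅` in question has this cofactor. -/
def nodeCofactor : MvPolynomial (Fin 4) B :=
  2 * (quintic (X 0) (X 1) ^ 2 + quintic (X 0) (X 1) * quintic (X 2) (X 3)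
    + quintic (X 2) (X 3) ^ 2 - (quintic (X 0) (X 1) + quintic (X 2) (X 3)) - 24)

theorem nodeForm_transpose : (nodeForm B)ᵀ = nodeForm B := by
  ext1 i j
  fin_cases i <;> fin_cases j <;> rfl

/-- Subtract the certificates for the two pairs of variables. The difference `χ(s) - χ(t)` is
divisible by `s - t`, and the quotient is half the cofactor. The factor `2` allows a symmetric
matrix without halves. -/
theorem nodeCofactor_mul :
    nodeCofactor B * f5 B = nodeEqs B ⬝ᵥ (nodeForm B *ᵥ nodeEqs B) := by
  have h1 := quintic_certificate (X 0 : MvPolynomial (Fin 4) B) (X 1)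
  have h2 := quintic_certificate (X 2 : MvPolynomial (Fin 4) B) (X 3)
  rw [f5_eq]
  simp only [nodeCofactor, nodeEqs, nodeForm, dotProduct, mulVec, Fin.sum_univ_four,
    of_apply, cons_val]
  linear_combination 2 * h1 - 2 * h2

theorem pderiv_f5 (j : Fin 4) : pderiv j (f5 B) = C 5 * nodeEqs B j := by
  have h5 : (C 5 : MvPolynomial (Fin 4) B) = 5 := map_ofNat C 5
  rw [f5_eq, map_sub, derivation_quintic, derivation_quintic, h5]
  fin_cases j <;> simp [pderiv_X, nodeEqs]

theorem det_blocks {A : Type*} [CommRing A] (a b c d a' b' c' d' : A) :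
    (!![a, b, 0, 0; c, d, 0, 0; 0, 0, a', b'; 0, 0, c', d'] : Matrix (Fin 4) (Fin 4) A).det =
      (a * d - b * c) * (a' * d' - b' * c') := by
  simp [det_succ_row_zero, Fin.sum_univ_succ, Fin.succAbove]
  ring

theorem jacobian_nodeEqs : jacobian (nodeEqs B) =
    !![quinticDxx (X 0) (X 1), quinticDxy (X 0) (X 1), 0, 0;
      quinticDxy (X 1) (X 0), quinticDxx (X 1) (X 0), 0, 0;
      0, 0, -quinticDxx (X 2) (X 3), -quinticDxy (X 2) (X 3);
      0, 0, -quinticDxy (X 3) (X 2), -quinticDxx (X 3) (X 2)] := by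
  ext1 i j
  fin_cases i <;> fin_cases j <;>
    simp [jacobian, nodeEqs, derivation_quinticDeriv, pderiv_X]

/-- At a common zero of `f₅` and its derivatives, both pairs are critical points with one common
value `t`. The cofactor becomes `2χ'(t)`, and both determinants are products of two blocks, nonzero
by `cert_hessian_ne_zero`. -/
theorem node_conditions (h30 : IsUnit (30 : B)) (K : Type) [Field K]
    (φ : MvPolynomial (Fin 4) B →+* K) (hf : φ (f5 B) = 0) (hg : ∀ i, φ (nodeEqs B i) = 0) :
    φ (nodeCofactor B) ≠ 0 ∧ φ (nodeForm B).det ≠ 0 ∧ φ (jacobian (nodeEqs B)).det ≠ 0 ∧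
      (2 : K) ≠ 0 := by
  have hK : (30 : K) ≠ 0 := by
    simpa only [map_ofNat] using (h30.map (φ.comp C)).ne_zero
  have h2 := (ne_zero_of_thirty hK).1
  rw [f5_eq, map_sub, map_quintic, map_quintic, sub_eq_zero] at hf
  have g0 := hg 0
  have g1 := hg 1
  have g2 := hg 2
  have g3 := hg 3
  simp only [nodeEqs, cons_val, map_neg, neg_eq_zero, map_quinticDeriv] at g0 g1 g2 g3
  obtain ⟨a1, a2⟩ := cert_hessian_ne_zero hK g0 g1
  obtain ⟨b1, b2⟩ := cert_hessian_ne_zero hK g2 g3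
  have hc := chi_deriv_ne_zero hK (quintic_eq_of_critical g0 g1)
  refine ⟨?_, ?_, ?_, h2⟩
  · have : φ (nodeCofactor B) = 2 * (3 * quintic (φ (X 0)) (φ (X 1)) ^ 2 -
        2 * quintic (φ (X 0)) (φ (X 1)) - 24) := by
      simp only [nodeCofactor, map_mul, map_add, map_sub, map_pow, map_quintic, map_ofNat, ← hf]
      ring
    rw [this]
    exact mul_ne_zero h2 hc
  · rw [nodeForm, det_blocks]
    simp only [map_mul, map_sub, map_neg, map_certA, map_certB, map_ofNat]
    refine mul_ne_zero (fun h => a1 ?_) fun h => b1 ?_ <;> linear_combination h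
  · rw [jacobian_nodeEqs, det_blocks]
    simp only [map_mul, map_sub, map_neg, map_quinticDxx, map_quinticDxy]
    rw [quinticDxy_comm (φ (X 1)), quinticDxy_comm (φ (X 3))]
    refine mul_ne_zero (fun h => a2 ?_) fun h => b2 ?_ <;> linear_combination h

theorem smooth_nodeBlowup (h30 : IsUnit (30 : B)) :
    Smooth (reesBlowupHom (nodeGen (f5 B) (nodeEqs B)) ≫
      Spec.map (CommRingCat.ofHom (algebraMap B (HypRing (f5 B))))) :=
  reesBlowup_smooth (f5 B) (nodeEqs B) (nodeForm B) (nodeCofactor B) (nodeForm_transpose B)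
    (nodeCofactor_mul B)
    (fun j => ⟨5, isUnit_of_dvd_unit ⟨6, by norm_num⟩ h30, pderiv_f5 B j⟩)
    (fun K _ φ hf hg => node_conditions B h30 K φ hf hg)

end AffineThreefold

/-! ### Affine charts of the projective quintic -/

section AwayCharts

open MvPolynomial HomogeneousLocalization

/-- Each monomial of `P` has `n` factors and so picks up exactly `tⁿ`. This compares a homogeneous
polynomial with its dehomogenization. -/
theorem homogeneous_scale {A E σ : Type*} [CommRing A] [CommRing E] (τ τ' : MvPolynomial σ A →+* E)
    (t : E) (hC : ∀ a, τ' (C a) = τ (C a)) (hX : ∀ k, τ' (X k) * t = τ (X k)) {n : ℕ}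
    {P : MvPolynomial σ A} (hP : P.IsHomogeneous n) : τ' P * t ^ n = τ P := by
  rw [P.as_sum, map_sum, map_sum, Finset.sum_mul]
  refine Finset.sum_congr rfl fun d hd => ?_
  have hn : d.sum (fun _ e => e) = n := by
    rw [← hP (mem_support_iff.mp hd), Finsupp.weight_apply]
    exact Finset.sum_congr rfl fun _ _ => by simp
  rw [monomial_eq, map_mul, map_mul, hC, mul_assoc, ← hn, Finsupp.prod, Finsupp.sum, map_prod,
    map_prod, ← Finset.prod_pow_eq_pow_sum, ← Finset.prod_mul_distrib]
  refine congrArg _ (Finset.prod_congr rfl fun k _ => ?_)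
  rw [map_pow, map_pow, ← mul_pow, hX]

variable {A : Type} [CommRing A]

/-- The projection onto the homogeneous coordinate ring of the quintic. -/
def toCoord (A : Type) [CommRing A] : MvPolynomial (Fin 5) A →+* CoordRing A :=
  Ideal.Quotient.mk (quinticIdeal A)

theorem toCoord_surjective : Function.Surjective (toCoord A) := Ideal.Quotient.mk_surjective

theorem toCoord_F5 : toCoord A (F5 A) = 0 :=
  Ideal.Quotient.eq_zero_iff_mem.mpr (Ideal.mem_span_singleton_self _)

theorem toCoord_mem {P : MvPolynomial (Fin 5) A} {n : ℕ} (hP : P.IsHomogeneous n) :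
    toCoord A P ∈ grading A n := ⟨P, hP, rfl⟩

theorem exists_toCoord {a : CoordRing A} {n : ℕ} (ha : a ∈ grading A n) :
    ∃ P, P.IsHomogeneous n ∧ toCoord A P = a := ha

/-- The structure map of a homogeneous localization of the coordinate ring. -/
def awayStruct (w : CoordRing A) : A →+* Away (grading A) w :=
  (fromZeroRingHom (grading A) _).comp (algebraMap A (grading A 0))

theorem val_awayStruct (w : CoordRing A) (b : A) : (awayStruct w b).val =
    algebraMap (CoordRing A) (Localization.Away w) (toCoord A (C b)) :=
  (Localization.mk_one_eq_algebraMap _)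

theorem away_val_mk_mul {w : CoordRing A} {d : ℕ} (hw : w ∈ grading A d) (n : ℕ) (a : CoordRing A)
    (ha : a ∈ grading A (n • d)) :
    (Away.mk (grading A) hw n a ha).val * algebraMap (CoordRing A) (Localization.Away w) w ^ n =
      algebraMap _ _ a := by
  rw [Away.val_mk, Localization.mk_eq_mk', ← map_pow]
  exact IsLocalization.mk'_spec _ a (⟨w ^ n, n, rfl⟩ : Submonoid.powers w)

theorem isUnit_algebraMap_of_dvd {w x : CoordRing A} (h : x ∣ w) :
    IsUnit (algebraMap (CoordRing A) (Localization.Away w) x) :=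
  isUnit_of_dvd_unit (map_dvd _ h) (IsLocalization.Away.algebraMap_isUnit w)

variable (W h : MvPolynomial (Fin 5) A) (i : Fin 5) {m : ℕ}

theorem chart_isHomogeneous (hW : W = X i * h) (hh : h.IsHomogeneous m) :
    W.IsHomogeneous (1 + m) := by
  rw [hW]; exact (isHomogeneous_X A i).mul hh

/-- Dehomogenization with respect to the `i`-th variable, on the chart where `W = X i * h` is
invertible. -/
def dehom (hW : W = X i * h) (hh : h.IsHomogeneous m) :
    MvPolynomial (Fin 5) A →+* Away (grading A) (toCoord A W) :=
  eval₂Hom (awayStruct (toCoord A W)) fun k =>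
    Away.mk (grading A) (toCoord_mem (chart_isHomogeneous W h i hW hh)) 1 (toCoord A (X k * h))
      (by rw [one_smul]; exact toCoord_mem ((isHomogeneous_X A k).mul hh))

variable (hW : W = X i * h) (hh : h.IsHomogeneous m)

theorem dehom_C (b : A) : dehom W h i hW hh (C b) = awayStruct (toCoord A W) b := by
  simp [dehom]

theorem val_dehom {P : MvPolynomial (Fin 5) A} {n : ℕ} (hP : P.IsHomogeneous n) :
    (dehom W h i hW hh P).val * algebraMap (CoordRing A) (Localization.Away (toCoord A W))
      (toCoord A (X i)) ^ n = algebraMap _ _ (toCoord A P) := by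
  refine homogeneous_scale
    ((algebraMap (CoordRing A) (Localization.Away (toCoord A W))).comp (toCoord A))
    ((algebraMap (Away (grading A) (toCoord A W)) (Localization.Away (toCoord A W))).comp
      (dehom W h i hW hh)) _ (fun a => ?_) (fun k => ?_) hP
  · rw [RingHom.comp_apply, dehom_C]
    exact val_awayStruct _ _
  · rw [RingHom.comp_apply, dehom, coe_eval₂Hom, eval₂_X]
    have h1 := away_val_mk_mul (toCoord_mem (chart_isHomogeneous W h i hW hh)) 1
      (toCoord A (X k * h)) (by rw [one_smul]; exact toCoord_mem ((isHomogeneous_X A k).mul hh))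
    have hu : IsUnit (algebraMap (CoordRing A) (Localization.Away (toCoord A W))
        (toCoord A h)) :=
      isUnit_algebraMap_of_dvd ⟨toCoord A (X i), by rw [← map_mul, mul_comm, hW]⟩
    refine hu.mul_right_cancel ?_
    rw [RingHom.comp_apply, ← map_mul, ← map_mul, ← h1, mul_assoc, ← map_mul, ← map_mul, ← hW,
      pow_one]
    rfl

theorem isUnit_coord_var (W h : MvPolynomial (Fin 5) A) (i : Fin 5) (hW : W = X i * h) :
    IsUnit (algebraMap (CoordRing A) (Localization.Away (toCoord A W)) (toCoord A (X i))) :=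
  isUnit_algebraMap_of_dvd ⟨toCoord A h, by rw [← map_mul, hW]⟩

theorem dehom_F5 : dehom W h i hW hh (F5 A) = 0 := by
  have := val_dehom W h i hW hh (F5_isHomogeneous A)
  rw [toCoord_F5, map_zero] at this
  refine val_injective _ ?_
  rw [val_zero]
  exact (IsUnit.mul_left_eq_zero ((isUnit_coord_var W h i hW).pow 5)).mp this

theorem dehom_var : dehom W h i hW hh (X i) = 1 := by
  have := val_dehom W h i hW hh (isHomogeneous_X A i)
  refine val_injective _ ?_
  rw [val_one]
  refine (isUnit_coord_var W h i hW).mul_right_cancel ?_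
  rw [one_mul]
  simpa only [pow_one] using this

theorem isUnit_dehom : IsUnit (dehom W h i hW hh W) := by
  have hWd := chart_isHomogeneous W h i hW hh
  have hX : (X i ^ (1 + m) : MvPolynomial (Fin 5) A).IsHomogeneous (1 • (1 + m)) := by
    simpa using (isHomogeneous_X A i).pow (1 + m)
  refine IsUnit.of_mul_eq_one (Away.mk (grading A) (toCoord_mem hWd) 1 _ (toCoord_mem hX)) ?_
  refine val_injective _ ?_
  rw [val_mul, val_one]
  have h1 := val_dehom W h i hW hh hWd
  have h2 := away_val_mk_mul (toCoord_mem hWd) 1 _ (toCoord_mem hX)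
  have hu : IsUnit (algebraMap (CoordRing A) (Localization.Away (toCoord A W)) (toCoord A W)) :=
    IsLocalization.Away.algebraMap_isUnit _
  refine hu.mul_right_cancel ?_
  rw [pow_one] at h2
  rw [mul_assoc, h2, one_mul, map_pow, map_pow, h1]

/-- The map out of the degree zero part is the restriction of a map out of the full localization. In
general `E` is larger than the degree zero part, since `X i` need not map to `1`; the last clause
says that dehomogenization retracts `E` onto it. -/
theorem exists_away_section {E : Type} [CommRing E] (e : MvPolynomial (Fin 5) A →+* E)
    (he : e (F5 A) = 0) (hu : IsUnit (e W)) :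
    ∃ s : Away (grading A) (toCoord A W) →+* E,
      (∀ b, s (awayStruct _ b) = e (C b)) ∧ (∀ P n, P.IsHomogeneous n → ∀ x,
        x.val * algebraMap _ _ (toCoord A (X i)) ^ n = algebraMap _ _ (toCoord A P) →
          s x * e (X i) ^ n = e P) ∧
      ∀ r : E →+* Away (grading A) (toCoord A W), r.comp e = dehom W h i hW hh →
        r.comp s = RingHom.id _ := by
  have hI : ∀ a ∈ quinticIdeal A, e a = 0 := fun a ha => by
    obtain ⟨c, rfl⟩ := Ideal.mem_span_singleton.mp ha
    rw [map_mul, he, zero_mul]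
  let g : CoordRing A →+* E := Ideal.Quotient.lift (quinticIdeal A) e hI
  have hg (P) : g (toCoord A P) = e P := Ideal.Quotient.lift_mk _ _ _
  have hgu : IsUnit (g (toCoord A W)) := by rwa [hg]
  let l : Localization.Away (toCoord A W) →+* E := IsLocalization.Away.lift (toCoord A W) hgu
  have hl (P) : l (algebraMap _ _ (toCoord A P)) = e P := by
    rw [← hg]; exact IsLocalization.Away.lift_eq _ hgu _
  let s : Away (grading A) (toCoord A W) →+* E :=
    l.comp (algebraMap _ (Localization.Away (toCoord A W)))
  have hs (x) : s x = l x.val := rfl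
  refine ⟨s, fun b => ?_, fun P n _ x hx => ?_, fun r hr => RingHom.ext fun x => ?_⟩
  · rw [hs, val_awayStruct, hl]
  · rw [hs, ← hl P, ← hx, map_mul, map_pow, hl]
  · have hWd := chart_isHomogeneous W h i hW hh
    obtain ⟨n, a, ha, rfl⟩ := Away.mk_surjective (grading A) (toCoord_mem hWd) x
    obtain ⟨P, hP, rfl⟩ := exists_toCoord ha
    have hr' (Q) : r (e Q) = dehom W h i hW hh Q := congr($hr Q)
    have hx := away_val_mk_mul (toCoord_mem hWd) n _ ha
    have h1 : s (Away.mk (grading A) (toCoord_mem hWd) n _ ha) * e W ^ n = e P := by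
      rw [hs, ← hl P, ← hx, map_mul, map_pow, hl]
    have h2 := congrArg r h1
    rw [map_mul, map_pow, hr', hr'] at h2
    refine ((isUnit_dehom W h i hW hh).pow n).mul_right_cancel ?_
    rw [RingHom.comp_apply, h2, RingHom.id_apply]
    refine val_injective _ ?_
    have hXu := isUnit_coord_var W h i hW
    refine (hXu.pow (n • (1 + m))).mul_right_cancel ?_
    rw [val_dehom W h i hW hh hP, ← hx, val_mul, val_pow, mul_assoc, smul_eq_mul, mul_comm n,
      pow_mul, ← mul_pow, val_dehom W h i hW hh hWd]

end AwayCharts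

/-! ### The charts at infinity are smooth, and the affine chart -/

/-- A lifting problem for `D` is pulled back to `E` along `r`, solved there, and restricted along
`s`. Finite type passes to the quotient `D` of `E`, and the noetherian base turns it into finite
presentation. -/
theorem ringHom_smooth_of_retract {A D E : Type} [CommRing A] [CommRing D] [CommRing E]
    [IsNoetherianRing A] (φ : A →+* D) (ψ : A →+* E) (s : D →+* E) (r : E →+* D)
    (hrs : r.comp s = RingHom.id D) (hs : ∀ a, s (φ a) = ψ a) (hψ : ψ.Smooth) : φ.Smooth := by
  let := φ.toAlgebra
  let := ψ.toAlgebra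
  have hE : Algebra.Smooth A E := hψ
  have hrs' (x) : r (s x) = x := congr($hrs x)
  let s' : D →ₐ[A] E := ⟨s, hs⟩
  let r' : E →ₐ[A] D := ⟨r, fun a => by
    change r (ψ a) = φ a
    rw [← hs, hrs']⟩
  have : Algebra.FiniteType A D := Algebra.FiniteType.of_surjective r' fun x => ⟨s x, hrs' x⟩
  have hD : Algebra.Smooth A D := by
    refine ⟨?_, Algebra.FinitePresentation.of_finiteType.mp inferInstance⟩
    rw [Algebra.FormallySmooth.iff_comp_surjective]
    intro C _ _ I hI g
    obtain ⟨l, hl⟩ := Algebra.FormallySmooth.comp_surjective A E I hI (g.comp r')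
    refine ⟨l.comp s', AlgHom.ext fun x => ?_⟩
    have := congr($hl (s x))
    change Ideal.Quotient.mkₐ A I (l (s x)) = g x
    change Ideal.Quotient.mkₐ A I (l (s x)) = g (r (s x)) at this
    rw [this, hrs']
  exact hD

section Charts

open MvPolynomial HomogeneousLocalization

variable {A : Type} [CommRing A]

/-- Where `∂_i F₅` is invertible the affine cone is a smooth hypersurface. Inverting `X i` too makes
the degree zero part a retract of its coordinate ring, by dehomogenization. -/
theorem awayStruct_smooth [IsNoetherianRing A] (i : Fin 5) (h : MvPolynomial (Fin 5) A) {m : ℕ}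
    (hh : h.IsHomogeneous m) (hF : pderiv i (F5 A) = h) :
    (awayStruct (toCoord A (X i * h))).Smooth := by
  let F : Unit → MvPolynomial (Fin 5) A := fun _ => F5 A
  let W : MvPolynomial (Fin 5) A := X i * h
  have hu := isUnit_toQuotLoc F W
  have hE : Algebra.Smooth A (QuotLoc F W) := by
    refine quotLoc_hypersurface_smooth (F5 A) W i ?_
    rw [hF]
    exact isUnit_of_dvd_unit (map_dvd _ (Dvd.intro_left _ rfl)) hu
  obtain ⟨s, hs, -, hr⟩ := exists_away_section W h i rfl hh (toQuotLoc F W).toRingHom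
    (toQuotLoc_relation F W ()) hu
  obtain ⟨r, hr'⟩ := exists_quotLoc_lift F W (dehom W h i rfl hh)
    (fun _ => dehom_F5 W h i rfl hh) (isUnit_dehom W h i rfl hh)
  exact ringHom_smooth_of_retract _ (algebraMap A (QuotLoc F W)) s r (hr r (RingHom.ext hr'))
    (fun b => (hs b).trans ((toQuotLoc F W).commutes b)) (RingHom.smooth_algebraMap.mpr hE)

/-- The variable `z` of the homogeneous coordinate ring. -/
abbrev coordZ (A : Type) [CommRing A] : CoordRing A := toCoord A (X 0)

/-- Setting `z = 1` sends the inverted variable to `1`, so the retraction of `exists_away_section`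
is a two-sided inverse here. -/
theorem exists_affineChart_equiv : ∃ e : Away (grading A) (coordZ A) ≃+* HypRing (f5 A),
    (∀ b, e (awayStruct _ b) = algebraMap A _ b) ∧
      ∀ P n, P.IsHomogeneous n → ∀ x,
        x.val * algebraMap _ _ (coordZ A) ^ n = algebraMap _ _ (toCoord A P) →
          e x = toHypRing (f5 A) (aeval (Fin.cons 1 X : Fin 5 → MvPolynomial (Fin 4) A) P) := by
  have hW : (X 0 : MvPolynomial (Fin 5) A) = X 0 * 1 := (mul_one _).symm
  have h1 : (1 : MvPolynomial (Fin 5) A).IsHomogeneous 0 := isHomogeneous_one _ _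
  let c : MvPolynomial (Fin 5) A →ₐ[A] HypRing (f5 A) :=
    (toHypRing (f5 A)).comp (aeval (Fin.cons 1 X : Fin 5 → MvPolynomial (Fin 4) A))
  have hc0 : c (X 0) = 1 := by simp [c]
  have hcs (k : Fin 4) : c (X k.succ) = toHypRing (f5 A) (X k) := by simp [c]
  obtain ⟨s, hs, hsX, hr⟩ := exists_away_section (X 0) 1 0 hW h1 c.toRingHom
    (by change toHypRing _ (aeval _ (F5 A)) = 0; rw [F5_dehomogenize, toHypRing_self])
    (by change IsUnit (c (X 0)); rw [hc0]; exact isUnit_one)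
  let d := dehom (X 0) (1 : MvPolynomial (Fin 5) A) 0 hW h1
  let d' : MvPolynomial (Fin 4) A →+* Away (grading A) (coordZ A) :=
    d.comp (rename Fin.succ).toRingHom
  have hd : ∀ P, d' (aeval (Fin.cons 1 X : Fin 5 → MvPolynomial (Fin 4) A) P) = d P := by
    intro P
    have : (d'.comp (aeval (Fin.cons 1 X : Fin 5 → MvPolynomial (Fin 4) A)).toRingHom) = d := by
      refine ringHom_ext (fun b => ?_) fun k => ?_
      · simp [d']
      · refine Fin.cases ?_ (fun k => ?_) k
        · simp [d', d, dehom_var]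
        · simp [d']
    exact congr($this P)
  obtain ⟨r, hr'⟩ := exists_hypRing_lift (f := f5 A) d' (by
    rw [← F5_dehomogenize, hd]; exact dehom_F5 _ _ _ _ _)
  have hrc : r.comp c.toRingHom = d := RingHom.ext fun P => (hr' _).trans (hd P)
  have hrs := hr r hrc
  have key (P n) (hP : P.IsHomogeneous n) (x)
      (hx : x.val * algebraMap _ _ (coordZ A) ^ n = algebraMap _ _ (toCoord A P)) :
      s x = c P := by
    have := hsX P n hP x hx
    change s x * c (X 0) ^ n = c _ at this
    rwa [hc0, one_pow, mul_one] at this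
  have hsb (b : A) : s (awayStruct _ b) = algebraMap A _ b := (hs b).trans (c.commutes b)
  have hsr : s.comp r = RingHom.id _ := by
    refine Ideal.Quotient.ringHom_ext (MvPolynomial.ringHom_ext (fun b => ?_) fun k => ?_)
    · change s (r (toHypRing _ (C b))) = toHypRing _ (C b)
      rw [hr', RingHom.comp_apply]
      simp only [AlgHom.toRingHom_eq_coe, RingHom.coe_coe, rename_C]
      rw [dehom_C, hsb]
      exact ((toHypRing (f5 A)).commutes b).symm
    · change s (r (toHypRing _ (X k))) = toHypRing _ (X k)
      rw [← hcs]
      refine key _ 1 (isHomogeneous_X A k.succ) _ ?_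
      have e : r (c (X k.succ)) = d (X k.succ) := congr($hrc (X k.succ))
      rw [e]
      exact val_dehom (X 0) (1 : MvPolynomial (Fin 5) A) 0 hW h1 (isHomogeneous_X A k.succ)
  exact ⟨RingEquiv.ofRingHom s r hsr hrs, hsb, key⟩

end Charts

/-! ### The geometry of the projective quintic -/

section Equations

open MvPolynomial

variable (A : Type*) [CommRing A]

/-- Modulo `z` the equation is the Fermat form `x₁⁵ + x₂⁵ - x₄⁵ - x₅⁵`. -/
theorem pderiv_F5 (i : Fin 4) : ∃ (a : A) (c : MvPolynomial (Fin 5) A), (a = 5 ∨ a = -5) ∧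
    pderiv i.succ (F5 A) = C a * X i.succ ^ 4 + X 0 * c := by
  have h5 : (C 5 : MvPolynomial (Fin 5) A) = 5 := map_ofNat C 5
  have key (x y : MvPolynomial (Fin 5) A) : ∃ c, P5hom (X 0) x y = x ^ 5 + y ^ 5 + X 0 * c :=
    ⟨-5 * x * y * (x ^ 2 + y ^ 2) + 5 * x * y * (x + y) * X 0
      + 5 * (x ^ 2 + y ^ 2) * X 0 ^ 2 - 5 * (x + y) * X 0 ^ 3, by rw [P5hom]; ring⟩
  obtain ⟨c, hc⟩ := key (X 1) (X 2)
  obtain ⟨c', hc'⟩ := key (X 3) (X 4)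
  rw [F5, hc, hc']
  have h0 : (0 : Fin 5) ≠ i.succ := i.succ_ne_zero.symm
  have : pderiv i.succ (X 1 ^ 5 + X 2 ^ 5 + X 0 * c - (X 3 ^ 5 + X 4 ^ 5 + X 0 * c') :
      MvPolynomial (Fin 5) A) = 5 * (X 1 ^ 4 * pderiv i.succ (X 1) + X 2 ^ 4 * pderiv i.succ (X 2)
        - X 3 ^ 4 * pderiv i.succ (X 3) - X 4 ^ 4 * pderiv i.succ (X 4)) +
        X 0 * (pderiv i.succ c - pderiv i.succ c') := by
    simp only [map_sub, map_add, Derivation.leibniz, Derivation.leibniz_pow, smul_eq_mul,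
      nsmul_eq_mul, pderiv_X_of_ne h0]
    push_cast
    ring
  rw [this]
  fin_cases i
  · exact ⟨5, _, Or.inl rfl, by rw [h5]; simp [pderiv_X]; rfl⟩
  · exact ⟨5, _, Or.inl rfl, by rw [h5]; simp [pderiv_X]; rfl⟩
  · exact ⟨-5, _, Or.inr rfl, by rw [map_neg, h5]; simp [pderiv_X]; rfl⟩
  · exact ⟨-5, _, Or.inr rfl, by rw [map_neg, h5]; simp [pderiv_X]; rfl⟩

theorem aeval_cons_pderiv (i : Fin 4) (P : MvPolynomial (Fin 5) A) :
    aeval (Fin.cons 1 X : Fin 5 → MvPolynomial (Fin 4) A) (pderiv i.succ P) =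
      pderiv i (aeval (Fin.cons 1 X : Fin 5 → MvPolynomial (Fin 4) A) P) := by
  induction P using MvPolynomial.induction_on with
  | C a => simp
  | add p q hp hq => simp only [map_add, hp, hq]
  | mul_X p k hp =>
    simp only [Derivation.leibniz, map_mul, map_add, smul_eq_mul, hp]
    congr 2
    refine Fin.cases ?_ (fun k => ?_) k
    · simp [pderiv_X]
    · simp [pderiv_X, Pi.single_apply, Fin.succ_inj]

end Equations

/-! ### Properness, the affine chart and the neighbourhood of infinity. -/

section Geometry

open MvPolynomial HomogeneousLocalization

variable (A : Type) [CommRing A]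

/-- The inclusion of the base ring in the coordinate ring as the component of degree zero. -/
def coordZeroMap : CommRingCat.of A ⟶ CommRingCat.of (grading A 0) :=
  CommRingCat.ofHom (algebraMap A (grading A 0))

theorem coordZeroMap_surjective : Function.Surjective (coordZeroMap A) := fun a => by
  obtain ⟨P, hP, ha⟩ := exists_toCoord a.2
  obtain ⟨b, rfl⟩ : ∃ b, P = C b :=
    ⟨_, totalDegree_eq_zero_iff_eq_C.mp (Nat.le_zero.mp hP.totalDegree_le)⟩
  exact ⟨b, Subtype.ext ha⟩

theorem adjoin_coord :
    Algebra.adjoin (grading A 0) (Set.range fun k => toCoord A (X k)) = ⊤ := by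
  rw [eq_top_iff]
  rintro a -
  obtain ⟨P, rfl⟩ := toCoord_surjective a
  induction P using MvPolynomial.induction_on with
  | C b => exact Subalgebra.algebraMap_mem _ (coordZeroMap A b)
  | add p q hp hq => rw [map_add]; exact add_mem hp hq
  | mul_X p k hp =>
    rw [map_mul]; exact mul_mem hp (Algebra.subset_adjoin ⟨k, rfl⟩)

instance : Algebra.FiniteType (grading A 0) (CoordRing A) :=
  ⟨⟨(Set.finite_range fun k => toCoord A (X k)).toFinset, by
    rw [Set.Finite.coe_toFinset]; exact adjoin_coord A⟩⟩

instance : IsProper (XbarHom A) := by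
  have : IsClosedImmersion (Spec.map (coordZeroMap A)) :=
    IsClosedImmersion.spec_of_surjective _ (coordZeroMap_surjective A)
  have h : IsProper (Proj.toSpecZero (grading A)) := inferInstance
  exact MorphismProperty.comp_mem @IsProper _ (Spec.map (coordZeroMap A)) h inferInstance

/-- The inclusion of the chart of the quintic on which `w` is invertible. -/
def coordι {w : CoordRing A} {d : ℕ} (hw : w ∈ grading A d) (hd : 0 < d) :
    Spec (.of (Away (grading A) w)) ⟶ Xbar A :=
  Proj.awayι (grading A) w hw hd

instance {w : CoordRing A} {d : ℕ} (hw : w ∈ grading A d) (hd : 0 < d) :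
    IsOpenImmersion (coordι A hw hd) :=
  inferInstanceAs (IsOpenImmersion (Proj.awayι (grading A) w hw hd))

/-- The open subset of the quintic on which `w` does not vanish. -/
def coordOpen (w : CoordRing A) : (Xbar A).Opens := Proj.basicOpen (grading A) w

theorem opensRange_coordι {w : CoordRing A} {d : ℕ} (hw : w ∈ grading A d) (hd : 0 < d) :
    (coordι A hw hd).opensRange = coordOpen A w :=
  Proj.opensRange_awayι _ _ hw hd

theorem coordι_XbarHom {w : CoordRing A} {d : ℕ} (hw : w ∈ grading A d) (hd : 0 < d) :
    coordι A hw hd ≫ XbarHom A = Spec.map (CommRingCat.ofHom (awayStruct w)) := by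
  have h := Proj.awayι_toSpecZero_assoc (grading A) w hw hd (Spec.map (coordZeroMap A))
  refine h.trans ?_
  rw [← Spec.map_comp]
  rfl

theorem coordZ_mem : coordZ A ∈ grading A 1 := toCoord_mem (isHomogeneous_X A 0)

/-- The isomorphism of the ring of the affine chart `z ≠ 0` with the coordinate ring of the affine
threefold. -/
def affineEquiv : Away (grading A) (coordZ A) ≃+* HypRing (f5 A) :=
  (exists_affineChart_equiv (A := A)).choose

theorem affineEquiv_awayStruct (b : A) : affineEquiv A (awayStruct _ b) = algebraMap A _ b :=
  (exists_affineChart_equiv (A := A)).choose_spec.1 b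

theorem affineEquiv_eq {P : MvPolynomial (Fin 5) A} {n : ℕ} (hP : P.IsHomogeneous n)
    (x : Away (grading A) (coordZ A))
    (hx : x.val * algebraMap _ _ (coordZ A) ^ n = algebraMap _ _ (toCoord A P)) :
    affineEquiv A x =
      toHypRing (f5 A) (aeval (Fin.cons 1 X : Fin 5 → MvPolynomial (Fin 4) A) P) :=
  (exists_affineChart_equiv (A := A)).choose_spec.2 P n hP x hx

/-- The inclusion of the affine threefold in the projective quintic. -/
def affineι : Spec (.of (HypRing (f5 A))) ⟶ Xbar A :=
  Spec.map (affineEquiv A).toCommRingCatIso.hom ≫ coordι A (coordZ_mem A) one_pos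

instance : IsOpenImmersion (affineι A) :=
  MorphismProperty.comp_mem @IsOpenImmersion _ (coordι A (coordZ_mem A) one_pos) inferInstance
    inferInstance

theorem affineι_XbarHom : affineι A ≫ XbarHom A =
    Spec.map (CommRingCat.ofHom (algebraMap A (HypRing (f5 A)))) := by
  rw [affineι, Category.assoc, coordι_XbarHom, ← Spec.map_comp]
  congr 1
  ext b
  exact affineEquiv_awayStruct A b

theorem mem_range_affineι (x : Xbar A) :
    x ∈ Set.range (affineι A) ↔ x ∈ coordOpen A (coordZ A) := by
  rw [← opensRange_coordι A (coordZ_mem A) one_pos, affineι]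
  change x ∈ (Spec.map _ ≫ coordι A (coordZ_mem A) one_pos).opensRange ↔ _
  rw [Scheme.Hom.opensRange_comp_of_isIso]

/-- The equation `xᵢ ∂ᵢ F₅ ≠ 0` of a chart near infinity. -/
def infinityEq (i : Fin 4) : MvPolynomial (Fin 5) A := X i.succ * pderiv i.succ (F5 A)

theorem infinityEq_isHomogeneous (i : Fin 4) : (infinityEq A i).IsHomogeneous (1 + 4) :=
  (isHomogeneous_X A _).mul ((F5_isHomogeneous A).pderiv (i := i.succ))

/-- A neighbourhood of the hyperplane section at infinity of the quintic. -/
def infinityOpen : (Xbar A).Opens :=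
  ⨆ i, coordOpen A (toCoord A (infinityEq A i))

/-- If `z` and all `x_i ∂_i F₅` vanish at a point, then so do all `±5 x_i⁵`, hence all homogeneous
coordinates, which is impossible on `Proj`. -/
theorem affine_or_infinity (h5 : IsUnit (5 : A)) (x : Xbar A) :
    x ∈ Set.range (affineι A) ∨ x ∈ infinityOpen A := by
  rw [mem_range_affineι, or_iff_not_imp_left]
  intro hz
  by_contra hU
  let 𝔭 := ProjectiveSpectrum.asHomogeneousIdeal (𝒜 := grading A) x
  have hprime : 𝔭.toIdeal.IsPrime := ProjectiveSpectrum.isPrime x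
  have hz' : coordZ A ∈ 𝔭.toIdeal := by
    by_contra h; exact hz ((Proj.mem_basicOpen _ _ _).mpr h)
  have hi (i : Fin 4) : toCoord A (infinityEq A i) ∈ 𝔭.toIdeal := by
    by_contra h
    exact hU (TopologicalSpace.Opens.mem_iSup.mpr ⟨i, (Proj.mem_basicOpen _ _ _).mpr h⟩)
  have hX (i : Fin 4) : toCoord A (X i.succ) ∈ 𝔭.toIdeal := by
    obtain ⟨a, c, ha, hc⟩ := pderiv_F5 A i
    have hu : IsUnit a := by rcases ha with rfl | rfl; exacts [h5, h5.neg]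
    have := hi i
    rw [infinityEq, hc, mul_add, map_add] at this
    have h1 : toCoord A (X i.succ * (X 0 * c)) ∈ 𝔭.toIdeal := by
      rw [map_mul, map_mul]; exact Ideal.mul_mem_left _ _ (Ideal.mul_mem_right _ _ hz')
    have h2 := (Ideal.add_mem_iff_left _ h1).mp this
    have h3 : (X i.succ * (C a * X i.succ ^ 4) : MvPolynomial (Fin 5) A) = C a * X i.succ ^ 5 := by
      ring
    rw [h3, map_mul, Ideal.unit_mul_mem_iff_mem _ ((hu.map C).map _), map_pow] at h2
    exact hprime.mem_of_pow_mem _ h2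
  have h := Proj.iSup_basicOpen_eq_top' (grading A) (fun k => toCoord A (X k))
    (fun k => ⟨1, toCoord_mem (isHomogeneous_X A k)⟩) (adjoin_coord A)
  have hx : x ∈ ⨆ k, Proj.basicOpen (grading A) (toCoord A (X k)) := by
    rw [h]; trivial
  obtain ⟨k, hk⟩ := TopologicalSpace.Opens.mem_iSup.mp hx
  refine (Proj.mem_basicOpen _ _ _).mp hk ?_
  exact Fin.cases hz' hX k

theorem infinityOpen_smooth [IsNoetherianRing A] : Smooth ((infinityOpen A).ι ≫ XbarHom A) := by
  refine smooth_of_forall_exists _ fun x => ?_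
  obtain ⟨i, hi⟩ := TopologicalSpace.Opens.mem_iSup.mp x.2
  have hd := toCoord_mem (infinityEq_isHomogeneous A i)
  let k := coordι A hd (by norm_num)
  have hr : k.opensRange = coordOpen A (toCoord A (infinityEq A i)) :=
    opensRange_coordι A hd (by norm_num)
  have hle : k.opensRange ≤ infinityOpen A := by
    rw [hr]
    exact le_iSup (fun i => coordOpen A (toCoord A (infinityEq A i))) i
  have hle' : Set.range k ⊆ Set.range (infinityOpen A).ι := by
    rw [Scheme.Opens.range_ι]; exact hle
  let l := IsOpenImmersion.lift (infinityOpen A).ι k hle'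
  have hl : l ≫ (infinityOpen A).ι = k := IsOpenImmersion.lift_fac _ _ _
  refine ⟨_, l, ?_, ?_, ?_⟩
  · have : IsOpenImmersion (l ≫ (infinityOpen A).ι) := by rw [hl]; infer_instance
    exact IsOpenImmersion.of_comp l (infinityOpen A).ι
  · have : (infinityOpen A).ι x ∈ k.opensRange := by rw [hr]; exact hi
    obtain ⟨y, hy⟩ := this
    refine ⟨y, (infinityOpen A).ι.injective ?_⟩
    rw [← hy]
    exact congr($hl y)
  · rw [reassoc_of% hl, coordι_XbarHom,
      HasRingHomProperty.Spec_iff (P := @Smooth.{0}) (Q := RingHom.Smooth)]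
    exact awayStruct_smooth i.succ _ ((F5_isHomogeneous A).pderiv (i := i.succ)) rfl

end Geometry

/-! ### The ideal sheaf of the nodes and its blow-up -/

section Kernels

theorem ker_comap_of_isPullback {X Y U V : Scheme.{0}} {f : X ⟶ Y} {f' : U ⟶ V} {iU : U ⟶ X}
    {iV : V ⟶ Y} [IsOpenImmersion iV] [QuasiCompact f] (h : IsPullback f' iU iV f) :
    f.ker.comap iV = f'.ker := by
  refine Scheme.IdealSheafData.ext (funext fun W => ?_)
  rw [Scheme.ker_ideal_of_isPullback_of_isOpenImmersion f f' iU iV h,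
    Scheme.IdealSheafData.ideal_comap_of_isOpenImmersion]

theorem ker_comp_comap_of_isOpenImmersion {X V Y : Scheme.{0}} (f : X ⟶ V) (j : V ⟶ Y)
    [IsOpenImmersion j] [QuasiCompact (f ≫ j)] : (f ≫ j).ker.comap j = f.ker := by
  refine ker_comap_of_isPullback (iU := 𝟙 X) ⟨⟨by rw [Category.id_comp]⟩, ⟨?_⟩⟩
  refine PullbackCone.IsLimit.mk _ (fun s => s.snd) (fun s => ?_) (fun s => Category.comp_id _)
    fun s m _ h => (Category.comp_id m).symm.trans h
  rw [← cancel_mono j, Category.assoc, s.condition]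

theorem ker_comap_eq_top {X Y : Scheme.{0}} (f : X ⟶ Y) [QuasiCompact f] (U : Y.Opens)
    (h : ∀ x, f x ∉ U) : f.ker.comap U.ι = ⊤ := by
  rw [ker_comap_of_isPullback (isPullback_morphismRestrict f U)]
  have : IsEmpty (f ⁻¹ᵁ U).toScheme := ⟨fun x => h x.1 x.2⟩
  exact Scheme.ker_eq_top_of_isEmpty _

/-- The inclusion of the closed subscheme of `Spec R` defined by an ideal. -/
def specQuot {R : CommRingCat.{0}} (J : Ideal R) : Spec (.of (R ⧸ J)) ⟶ Spec R :=
  Spec.map (CommRingCat.ofHom (Ideal.Quotient.mk J))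

theorem ker_specQuot {R : CommRingCat.{0}} (J : Ideal R) : (specQuot J).ker = specIdeal J := rfl

theorem mem_specQuot {R : CommRingCat.{0}} {J : Ideal R} {r : R} (hr : r ∈ J)
    (y : Spec (.of (R ⧸ J))) : r ∈ (specQuot J y : PrimeSpectrum R).asIdeal := by
  change Ideal.Quotient.mk J r ∈ (y : PrimeSpectrum (R ⧸ J)).asIdeal
  rw [Ideal.Quotient.eq_zero_iff_mem.mpr hr]
  exact zero_mem _

end Kernels

/-- This gives properness of the glued blow-up over the quintic: it is an affine blow-up over one
open and an isomorphism over the other. -/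
theorem property_of_cover (P : MorphismProperty Scheme.{0}) [IsZariskiLocalAtTarget P]
    {X V Y M : Scheme.{0}} (j : V ⟶ X) [IsOpenImmersion j] (U : X.Opens)
    (hcov : ∀ x, x ∈ Set.range j ∨ x ∈ U) {π : M ⟶ X} {ρ : Y ⟶ V} {i : Y ⟶ M}
    {b : U.toScheme ⟶ M} (hV : IsPullback ρ i j π) (hU : IsPullback (𝟙 U.toScheme) b U.ι π)
    (hρ : P ρ) (hid : P (𝟙 U.toScheme)) : P π := by
  have key {V Y : Scheme.{0}} (j : V ⟶ X) [IsOpenImmersion j] {ρ : Y ⟶ V} {i : Y ⟶ M}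
      (hV : IsPullback ρ i j π) (hρ : P ρ) : P (π ∣_ j.opensRange) := by
    rw [P.arrow_mk_iso_iff (morphismRestrictOpensRange π j)]
    rwa [← hV.flip.isoPullback_hom_snd, P.cancel_left_of_respectsIso] at hρ
  refine IsZariskiLocalAtTarget.of_iSup_eq_top (P := P)
    (fun t : Bool => if t then j.opensRange else U.ι.opensRange) ?_ ?_
  · rw [eq_top_iff]
    intro x _
    rcases hcov x with h | h
    · exact TopologicalSpace.Opens.mem_iSup.mpr ⟨true, h⟩
    · refine TopologicalSpace.Opens.mem_iSup.mpr ⟨false, ?_⟩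
      simpa using h
  · rintro (_ | _)
    · exact key U.ι hU hid
    · exact key j hV hρ

/-! ### The nodes as a closed subscheme, and the glued blow-up. -/

section Nodes

open MvPolynomial HomogeneousLocalization

variable (A : Type) [CommRing A]

/-- The ideal of the nodes in the coordinate ring of the affine threefold. -/
def nodeIdeal : Ideal (HypRing (f5 A)) :=
  Ideal.span (Set.range (nodeGen (f5 A) (nodeEqs A)))

/-- The subscheme of the nodes in the projective quintic. -/
def nodeSubscheme : Spec (.of (HypRing (f5 A) ⧸ nodeIdeal A)) ⟶ Xbar A :=
  specQuot (R := .of (HypRing (f5 A))) (nodeIdeal A) ≫ affineι A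

instance : (Xbar A).IsSeparated := inferInstanceAs ((Proj (grading A)).IsSeparated)

instance : QuasiCompact (nodeSubscheme A) := quasiCompact_of_compactSpace _

/-- The ideal sheaf of the nodes of the projective quintic. -/
def nodeSheaf : (Xbar A).IdealSheafData := (nodeSubscheme A).ker

theorem nodeSheaf_comap_affineι : (nodeSheaf A).comap (affineι A) =
    specIdeal (R := .of (HypRing (f5 A))) (nodeIdeal A) := by
  have : QuasiCompact (specQuot (R := .of (HypRing (f5 A))) (nodeIdeal A) ≫ affineι A) :=
    inferInstanceAs (QuasiCompact (nodeSubscheme A))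
  exact ker_comp_comap_of_isOpenImmersion _ _

theorem affineι_mem_coordOpen {w : MvPolynomial (Fin 5) A} {d : ℕ} (hw : w.IsHomogeneous d)
    (hd : 0 < d) (y : Spec (.of (HypRing (f5 A)))) :
    affineι A y ∈ coordOpen A (toCoord A w) ↔
      toHypRing (f5 A) (aeval (Fin.cons 1 X : Fin 5 → MvPolynomial (Fin 4) A) w) ∉
        (y : PrimeSpectrum (HypRing (f5 A))).asIdeal := by
  let y' := Spec.map (affineEquiv A).toCommRingCatIso.hom y
  have h1 : affineι A y = coordι A (coordZ_mem A) one_pos y' := rfl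
  have h2 := Proj.awayι_preimage_basicOpen (grading A) (coordZ_mem A) one_pos (toCoord_mem hw) hd
  have h3 : affineι A y ∈ coordOpen A (toCoord A w) ↔
      y' ∈ PrimeSpectrum.basicOpen (Away.isLocalizationElem (coordZ_mem A) (toCoord_mem hw)) := by
    rw [h1, ← h2]
    exact Iff.rfl
  have h4 : affineEquiv A (Away.isLocalizationElem (coordZ_mem A) (toCoord_mem hw)) =
      toHypRing (f5 A) (aeval (Fin.cons 1 X : Fin 5 → MvPolynomial (Fin 4) A) w) := by
    refine affineEquiv_eq A hw _ ?_
    exact (away_val_mk_mul (coordZ_mem A) d _ _).trans (by rw [pow_one])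
  rw [h3, ← h4]
  exact Iff.rfl

theorem toHypRing_infinityEq (i : Fin 4) :
    toHypRing (f5 A) (aeval (Fin.cons 1 X : Fin 5 → MvPolynomial (Fin 4) A) (infinityEq A i)) =
      toHypRing (f5 A) (X i * C 5) * nodeGen (f5 A) (nodeEqs A) i := by
  rw [infinityEq, map_mul, aeval_cons_pderiv, F5_dehomogenize, pderiv_f5, aeval_X, Fin.cons_succ,
    ← mul_assoc, map_mul]

/-- After dehomogenization the function `x_i ∂_i F₅` is a multiple of the generator `g_i` of the
ideal of the nodes, hence vanishes at every node. -/
theorem nodeSubscheme_notMem (y : Spec (.of (HypRing (f5 A) ⧸ nodeIdeal A))) :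
    nodeSubscheme A y ∉ infinityOpen A := by
  intro h
  obtain ⟨i, hi⟩ := TopologicalSpace.Opens.mem_iSup.mp h
  have := (affineι_mem_coordOpen A (infinityEq_isHomogeneous A i) (by norm_num)
    (specQuot (R := .of (HypRing (f5 A))) (nodeIdeal A) y)).mp hi
  refine this (mem_specQuot (R := .of (HypRing (f5 A))) ?_ y)
  rw [toHypRing_infinityEq]
  exact Ideal.mul_mem_left _ _ (Ideal.subset_span ⟨i, rfl⟩)

theorem nodeSheaf_comap_infinity : (nodeSheaf A).comap (infinityOpen A).ι = ⊤ :=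
  ker_comap_eq_top _ _ (nodeSubscheme_notMem A)

/-- The blow-up of the quintic in its nodes is smooth and proper when `30` is invertible. -/
theorem exists_nodeBlowup [IsNoetherianRing A] (h30 : IsUnit (30 : A)) :
    ∃ (M : Scheme.{0}) (π : M ⟶ Xbar A), IsBlowup (nodeSheaf A) π ∧
      IsProper (π ≫ XbarHom A) ∧ Smooth (π ≫ XbarHom A) := by
  have h5 : IsUnit (5 : A) := isUnit_of_dvd_unit ⟨6, by norm_num⟩ h30
  let ρ := reesBlowupHom (nodeGen (f5 A) (nodeEqs A))
  have hρ : IsBlowup ((nodeSheaf A).comap (affineι A)) ρ := by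
    rw [nodeSheaf_comap_affineι]
    exact reesBlowup_isBlowup _
  have hcov := affine_or_infinity A h5
  obtain ⟨M, π, i, b, hπ, hV, hU⟩ := exists_isBlowup_of_cover (nodeSheaf A) (affineι A)
    (infinityOpen A) hcov (nodeSheaf_comap_infinity A) ρ hρ
  have hi : IsOpenImmersion i := MorphismProperty.of_isPullback hV inferInstance
  have hb : IsOpenImmersion b := MorphismProperty.of_isPullback hU inferInstance
  -- Properness is checked on the base and smoothness on the source; both use the affine threefold
  -- and the neighbourhood of infinity.
  have hp : IsProper π := property_of_cover @IsProper _ _ hcov hV hU inferInstance inferInstance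
  refine ⟨M, π, hπ, inferInstance, smooth_of_forall_exists _ fun x => ?_⟩
  rcases hcov (π x) with ⟨v, hv⟩ | hx
  · obtain ⟨y, -, hy⟩ := Scheme.exists_preimage_of_isPullback hV v x hv
    refine ⟨_, i, hi, ⟨y, hy⟩, ?_⟩
    rw [← hV.w_assoc, affineι_XbarHom]
    exact smooth_nodeBlowup A h30
  · obtain ⟨y, -, hy⟩ := Scheme.exists_preimage_of_isPullback hU ⟨π x, hx⟩ x rfl
    refine ⟨_, b, hb, ⟨y, hy⟩, ?_⟩
    rw [← hU.w_assoc, Category.id_comp]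
    exact infinityOpen_smooth A

end Nodes

/-! ### Base change of the projective quintic -/

theorem isPullback_of_cover {X Y Z W : Scheme.{0}} {c : W ⟶ X} {p : W ⟶ Y} {q : X ⟶ Z} {r : Y ⟶ Z}
    {ι : Type} {V V' : ι → Scheme.{0}} (j : ∀ i, V i ⟶ X) [hj : ∀ i, IsOpenImmersion (j i)]
    (hcov : ∀ x, ∃ i, x ∈ Set.range (j i)) (j' : ∀ i, V' i ⟶ W) (m : ∀ i, V' i ⟶ V i)
    (h1 : ∀ i, IsPullback (j' i) (m i) c (j i))
    (h2 : ∀ i, IsPullback (m i) (j' i ≫ p) (j i ≫ q) r) : IsPullback c p q r := by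
  let 𝒰 : X.OpenCover := Scheme.Cover.mkOfCovers ι V j hcov hj
  refine Scheme.isPullback_of_openCover _ _ _ _ 𝒰 fun i => ?_
  refine IsPullback.of_iso (h2 i) (h1 i).isoPullback (Iso.refl _) (Iso.refl _) (Iso.refl _)
    ?_ ?_ ?_ ?_
  · exact (Category.comp_id _).trans (h1 i).isoPullback_hom_snd.symm
  · have := (h1 i).isoPullback_hom_fst
    exact (Category.comp_id _).trans ((this =≫ p).symm.trans (Category.assoc _ _ _))
  · exact (Category.comp_id _).trans (Category.id_comp _).symm
  · exact (Category.comp_id _).trans (Category.id_comp _).symm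

section BaseChange

open MvPolynomial HomogeneousLocalization

theorem map_F5 {A A' : Type*} [CommRing A] [CommRing A'] (φ : A →+* A') :
    map φ (F5 A) = F5 A' := by
  simp [F5, P5hom]

theorem map_f5 {A A' : Type} [CommRing A] [CommRing A'] (φ : A →+* A') :
    map φ (f5 A) = f5 A' := by
  rw [f5_eq, f5_eq, map_sub, map_quintic, map_quintic]
  simp

variable {A A' : Type} [CommRing A] [CommRing A'] (φ : A →+* A')

/-- The map of homogeneous coordinate rings induced by a map of base rings. -/
def coordMap : CoordRing A →+* CoordRing A' :=
  Ideal.quotientMap _ (map φ) (by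
    rw [Ideal.span_le]
    rintro _ rfl
    exact Ideal.mem_comap.mpr (by rw [map_F5]; exact Ideal.mem_span_singleton_self _))

theorem coordMap_toCoord (P : MvPolynomial (Fin 5) A) :
    coordMap φ (toCoord A P) = toCoord A' (map φ P) := Ideal.quotientMap_mk

/-- The graded version of `coordMap`. -/
def coordGradedMap : GradedRingHom (grading A) (grading A') where
  __ := coordMap φ
  map_mem {i x} hx := by
    obtain ⟨P, hP, rfl⟩ := exists_toCoord hx
    exact ⟨map φ P, hP.map φ, rfl⟩

theorem homogeneous_mem_span_X {σ : Type*} {P : MvPolynomial σ A} {n : ℕ}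
    (hP : P.IsHomogeneous n) (hn : 0 < n) : P ∈ Ideal.span (Set.range (X (R := A) (σ := σ))) := by
  rw [← Set.image_univ, mem_ideal_span_X_image]
  intro m hm
  by_contra! h
  have : m = 0 := Finsupp.ext fun i => h i trivial
  have h2 := hP (mem_support_iff.mp hm)
  rw [this] at h2
  simp at h2
  omega

/-- The irrelevant ideal upstairs is generated by the variables, which are images of variables. This
makes the map of `Proj` defined everywhere. -/
theorem irrelevant_le_coordGradedMap : HomogeneousIdeal.irrelevant (grading A') ≤
    (HomogeneousIdeal.irrelevant (grading A)).map (coordGradedMap φ) := by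
  rw [HomogeneousIdeal.irrelevant_le]
  intro i hi x hx
  obtain ⟨P, hP, rfl⟩ := exists_toCoord hx
  have h1 := homogeneous_mem_span_X hP hi
  have h2 : Ideal.span (Set.range X) ≤ ((HomogeneousIdeal.irrelevant (grading A)).map
      (coordGradedMap φ)).toIdeal.comap (toCoord A') := by
    rw [Ideal.span_le]
    rintro _ ⟨k, rfl⟩
    have h3 : toCoord A (X k) ∈ (HomogeneousIdeal.irrelevant (grading A)).toIdeal :=
      HomogeneousIdeal.mem_irrelevant_of_mem (grading A) one_pos (toCoord_mem (isHomogeneous_X A k))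
    have h4 : coordGradedMap φ (toCoord A (X k)) = toCoord A' (X k) :=
      (coordMap_toCoord φ _).trans (by rw [map_X])
    rw [SetLike.mem_coe, Ideal.mem_comap, ← h4]
    exact Ideal.mem_map_of_mem _ h3
  exact h2 h1

/-- The map of projective quintics induced by a map of base rings. -/
def baseMap : Xbar A' ⟶ Xbar A :=
  Proj.map (coordGradedMap φ) (irrelevant_le_coordGradedMap φ)

theorem baseMap_preimage {P : MvPolynomial (Fin 5) A} {P' : MvPolynomial (Fin 5) A'}
    (hP : map φ P = P') :
    baseMap φ ⁻¹ᵁ coordOpen A (toCoord A P) = coordOpen A' (toCoord A' P') := by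
  subst hP; rfl

theorem exists_awayMap {P : MvPolynomial (Fin 5) A} {P' : MvPolynomial (Fin 5) A'}
    (hP : map φ P = P') {d : ℕ} (hd : 0 < d) (hw : toCoord A P ∈ grading A d)
    (hw' : toCoord A' P' ∈ grading A' d) :
    ∃ m : Away (grading A) (toCoord A P) →+* Away (grading A') (toCoord A' P'),
      coordι A' hw' hd ≫ baseMap φ = Spec.map (CommRingCat.ofHom m) ≫ coordι A hw hd ∧
      ∀ n Q (hQ : toCoord A Q ∈ grading A (n • d)) (hQ' : toCoord A' (map φ Q) ∈ grading A' (n • d)),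
        m (Away.mk (grading A) hw n _ hQ) = Away.mk (grading A') hw' n _ hQ' := by
  subst hP
  refine ⟨Away.map (coordGradedMap φ) (toCoord A P),
    Proj.awayι_comp_map (coordGradedMap φ) (irrelevant_le_coordGradedMap φ) hd _ hw,
    fun n Q hQ hQ' => ?_⟩
  exact Away.map_mk (coordGradedMap φ) _ hw n _ hQ

/-- Dehomogenization with respect to the `k`-th variable. -/
abbrev dehomVar (A : Type) [CommRing A] (k : Fin 5) :
    MvPolynomial (Fin 5) A →+* Away (grading A) (toCoord A (X k)) :=
  dehom (X k) 1 k (mul_one _).symm (isHomogeneous_one _ _)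

theorem eq_dehomVar (k : Fin 5) {P : MvPolynomial (Fin 5) A} {n : ℕ} (hP : P.IsHomogeneous n)
    {x : Away (grading A) (toCoord A (X k))} (hx : x.val * algebraMap _ _ (toCoord A (X k)) ^ n =
      algebraMap _ _ (toCoord A P)) : x = dehomVar A k P := by
  refine val_injective _ ?_
  refine ((isUnit_coord_var (X k) 1 k (mul_one _).symm).pow n).mul_right_cancel ?_
  rw [hx, val_dehom (X k) 1 k (mul_one _).symm (isHomogeneous_one _ _) hP]

theorem mk_eq_dehomVar (k : Fin 5) {P : MvPolynomial (Fin 5) A} {n : ℕ} (hP : P.IsHomogeneous n)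
    (hk : toCoord A (X k) ∈ grading A 1) (hP' : toCoord A P ∈ grading A (n • 1)) :
    Away.mk (grading A) hk n (toCoord A P) hP' = dehomVar A k P :=
  eq_dehomVar k hP (away_val_mk_mul hk n _ hP')

theorem dehomVar_surjective (k : Fin 5) : Function.Surjective (dehomVar A k) := fun x => by
  have hk := toCoord_mem (isHomogeneous_X A k)
  obtain ⟨n, a, ha, rfl⟩ := Away.mk_surjective (grading A) hk x
  obtain ⟨P, hP, rfl⟩ := exists_toCoord ha
  exact ⟨P, (mk_eq_dehomVar k (by simpa using hP) hk ha).symm⟩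

theorem exists_awayMap_var (k : Fin 5) :
    ∃ m : Away (grading A) (toCoord A (X k)) →+* Away (grading A') (toCoord A' (X k)),
      coordι A' (toCoord_mem (isHomogeneous_X A' k)) one_pos ≫ baseMap φ =
        Spec.map (CommRingCat.ofHom m) ≫ coordι A (toCoord_mem (isHomogeneous_X A k)) one_pos ∧
      m.comp (dehomVar A k) = (dehomVar A' k).comp (map φ) := by
  obtain ⟨m, hm, hm'⟩ := exists_awayMap φ (map_X φ k) one_pos
    (toCoord_mem (isHomogeneous_X A k)) (toCoord_mem (isHomogeneous_X A' k))
  have key {P : MvPolynomial (Fin 5) A} {n : ℕ} (hP : P.IsHomogeneous n) :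
      m (dehomVar A k P) = dehomVar A' k (map φ P) := by
    rw [← mk_eq_dehomVar k hP (toCoord_mem (isHomogeneous_X A k))
      (by rw [smul_eq_mul, mul_one]; exact toCoord_mem hP), hm', mk_eq_dehomVar k (hP.map φ)]
    rw [smul_eq_mul, mul_one]; exact toCoord_mem (hP.map φ)
  exact ⟨m, hm, ringHom_ext (fun b => key (isHomogeneous_C _ b)) fun i => key (isHomogeneous_X A i)⟩

theorem dehomVar_hom_ext {k : Fin 5} {E : Type} [CommRing E]
    {w w' : Away (grading A) (toCoord A (X k)) →+* E}
    (hC : ∀ b, w (awayStruct _ b) = w' (awayStruct _ b))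
    (hX : ∀ i, w (dehomVar A k (X i)) = w' (dehomVar A k (X i))) : w = w' := by
  have : w.comp (dehomVar A k) = w'.comp (dehomVar A k) :=
    ringHom_ext (fun b => by rw [RingHom.comp_apply, RingHom.comp_apply, dehom_C, hC]) hX
  ext x
  obtain ⟨P, rfl⟩ := dehomVar_surjective k x
  exact congr($this P)

variable {φ}

theorem awayMap_struct {k : Fin 5}
    {m : Away (grading A) (toCoord A (X k)) →+* Away (grading A') (toCoord A' (X k))}
    (hm : m.comp (dehomVar A k) = (dehomVar A' k).comp (map φ)) (b : A) :
    m (awayStruct _ b) = awayStruct _ (φ b) := by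
  have : m (dehomVar A k (C b)) = dehomVar A' k (map φ (C b)) := congr($hm (C b))
  rwa [map_C, dehom_C, dehom_C] at this

/-- Evaluate polynomials over `A'` with `v` on constants and the images of `x_i / x_k` on variables.
The equation `F₅` is sent to zero because it comes from `A`. -/
theorem exists_awayMap_desc {k : Fin 5}
    {m : Away (grading A) (toCoord A (X k)) →+* Away (grading A') (toCoord A' (X k))}
    (hm : m.comp (dehomVar A k) = (dehomVar A' k).comp (map φ)) {E : Type} [CommRing E]
    (u : Away (grading A) (toCoord A (X k)) →+* E) (v : A' →+* E)
    (huv : ∀ b, u (awayStruct _ b) = v (φ b)) :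
    ∃ w : Away (grading A') (toCoord A' (X k)) →+* E, w.comp m = u ∧ w.comp (awayStruct _) = v := by
  have hk : (X k : MvPolynomial (Fin 5) A') = X k * 1 := (mul_one _).symm
  have h1 := isHomogeneous_one (Fin 5) A'
  have hm' (P) : m (dehomVar A k P) = dehomVar A' k (map φ P) := congr($hm P)
  let e : MvPolynomial (Fin 5) A' →+* E := eval₂Hom v fun i => u (dehomVar A k (X i))
  have he (P) : e (map φ P) = u (dehomVar A k P) := by
    have : e.comp (map φ) = u.comp (dehomVar A k) := by
      refine ringHom_ext (fun b => ?_) fun i => ?_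
      · simp only [RingHom.comp_apply, map_C, dehom_C, huv]
        simp [e]
      · simp [e]
    exact congr($this P)
  have heF : e (F5 A') = 0 := by rw [← map_F5 φ, he, dehom_F5, map_zero]
  have heX : e (X k) = 1 := by rw [← map_X φ, he, dehom_var, map_one]
  obtain ⟨w, hw1, hw2, -⟩ := exists_away_section (X k) 1 k hk h1 e heF (by
    rw [heX]; exact isUnit_one)
  refine ⟨w, dehomVar_hom_ext (fun b => ?_) fun i => ?_, RingHom.ext fun b => ?_⟩
  · rw [RingHom.comp_apply, awayMap_struct hm, hw1, huv]
    simp [e]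
  · have := hw2 (X i) 1 (isHomogeneous_X A' i) _ (val_dehom (X k) 1 k hk h1 (isHomogeneous_X A' i))
    rw [heX, one_pow, mul_one] at this
    rw [RingHom.comp_apply, hm', map_X, this, ← map_X φ, he]
  · exact (hw1 b).trans (by simp [e])

theorem isPushout_awayMap {k : Fin 5}
    {m : Away (grading A) (toCoord A (X k)) →+* Away (grading A') (toCoord A' (X k))}
    (hm : m.comp (dehomVar A k) = (dehomVar A' k).comp (map φ)) :
    IsPushout (CommRingCat.ofHom (awayStruct (toCoord A (X k)))) (CommRingCat.ofHom φ)
      (CommRingCat.ofHom m) (CommRingCat.ofHom (awayStruct (toCoord A' (X k)))) := by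
  refine ⟨⟨CommRingCat.hom_ext (RingHom.ext (awayMap_struct hm))⟩,
    ⟨PushoutCocone.isColimitAux' _ fun s => Classical.choice ?_⟩⟩
  obtain ⟨w, hw, hw'⟩ := exists_awayMap_desc hm s.inl.hom s.inr.hom
    fun b => congr($(s.condition).hom b)
  refine ⟨⟨CommRingCat.ofHom w, CommRingCat.hom_ext hw, CommRingCat.hom_ext hw',
    fun {w'} hl hr => ?_⟩⟩
  have hl' : w'.hom.comp m = w.comp m := (congrArg CommRingCat.Hom.hom hl).trans hw.symm
  have hr' : w'.hom.comp (awayStruct _) = w.comp (awayStruct _) :=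
    (congrArg CommRingCat.Hom.hom hr).trans hw'.symm
  refine CommRingCat.hom_ext (dehomVar_hom_ext (fun b => congr($hr' b)) fun i => ?_)
  have h2 : m (dehomVar A k (X i)) = dehomVar A' k (X i) :=
    congr($hm (X i)).trans (by rw [RingHom.comp_apply, map_X])
  rw [← h2]
  exact congr($hl' (dehomVar A k (X i)))

variable (φ)

/-- The formation of the projective quintic commutes with base change. -/
theorem isPullback_baseMap : IsPullback (baseMap φ) (XbarHom A') (XbarHom A)
    (Spec.map (CommRingCat.ofHom φ)) := by
  choose m hm hm' using exists_awayMap_var (A := A) (A' := A') φ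
  refine isPullback_of_cover (fun k : Fin 5 => coordι A (toCoord_mem (isHomogeneous_X A k)) one_pos)
    (fun x => ?_) (fun k => coordι A' (toCoord_mem (isHomogeneous_X A' k)) one_pos)
    (fun k => Spec.map (CommRingCat.ofHom (m k))) (fun k => ?_) fun k => ?_
  · have h := Proj.iSup_basicOpen_eq_top' (grading A) (fun k => toCoord A (X k))
      (fun k => ⟨1, toCoord_mem (isHomogeneous_X A k)⟩) (adjoin_coord A)
    have hx : x ∈ ⨆ k, coordOpen A (toCoord A (X k)) := h.ge trivial
    obtain ⟨k, hk⟩ := TopologicalSpace.Opens.mem_iSup.mp hx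
    rw [← opensRange_coordι A (toCoord_mem (isHomogeneous_X A k)) one_pos] at hk
    exact ⟨k, hk⟩
  · refine (IsOpenImmersion.isPullback _ _ _ _ (hm k) ?_).flip
    rw [opensRange_coordι, opensRange_coordι]
    exact baseMap_preimage φ (map_X φ k)
  · rw [coordι_XbarHom, coordι_XbarHom]
    exact isPullback_SpecMap_of_isPushout _ _ _ _ (isPushout_awayMap (hm' k))

end BaseChange

/-! ### Base change of the ideal of the nodes. -/

section BaseChangeNodes

open MvPolynomial HomogeneousLocalization

variable {A A' : Type} [CommRing A] [CommRing A'] (φ : A →+* A')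

theorem map_nodeEqs (i : Fin 4) : map φ (nodeEqs A i) = nodeEqs A' i := by
  fin_cases i <;> simp [nodeEqs, map_quinticDeriv]

theorem exists_affineι_baseMap : ∃ ψ : HypRing (f5 A) →+* HypRing (f5 A'),
    affineι A' ≫ baseMap φ = Spec.map (CommRingCat.ofHom ψ) ≫ affineι A ∧
      ∀ P, ψ (toHypRing (f5 A) P) = toHypRing (f5 A') (map φ P) := by
  obtain ⟨ψ, hψ⟩ := exists_hypRing_lift (f := f5 A) ((toHypRing (f5 A')).toRingHom.comp (map φ))
    (by rw [RingHom.comp_apply, map_f5]; exact toHypRing_self _)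
  have hψ' (P) : ψ (toHypRing (f5 A) P) = toHypRing (f5 A') (map φ P) := hψ P
  refine ⟨ψ, ?_, hψ'⟩
  obtain ⟨m, hm, hm'⟩ := exists_awayMap_var (A := A) (A' := A') φ 0
  have hX (A : Type) [CommRing A] (i : Fin 5) : affineEquiv A (dehomVar A 0 (X i)) =
      toHypRing (f5 A) (aeval (Fin.cons 1 X : Fin 5 → MvPolynomial (Fin 4) A) (X i)) :=
    affineEquiv_eq A (isHomogeneous_X A i) _
      (val_dehom (X 0) 1 0 (mul_one _).symm (isHomogeneous_one _ _) (isHomogeneous_X A i))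
  have key : (affineEquiv A').toRingHom.comp m = ψ.comp (affineEquiv A).toRingHom := by
    refine dehomVar_hom_ext (k := 0) (fun b => ?_) fun i => ?_
    · change affineEquiv A' (m _) = ψ (affineEquiv A _)
      rw [awayMap_struct hm']
      refine (affineEquiv_awayStruct A' _).trans ?_
      have h1 := affineEquiv_awayStruct A b
      have h2 : algebraMap A (HypRing (f5 A)) b = toHypRing (f5 A) (C b) := rfl
      rw [h2] at h1
      refine Eq.trans ?_ (congrArg ψ h1).symm
      rw [hψ', map_C]
      rfl
    · change affineEquiv A' (m _) = ψ (affineEquiv A _)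
      have h1 : m (dehomVar A 0 (X i)) = dehomVar A' 0 (X i) :=
        congr($hm' (X i)).trans (by rw [RingHom.comp_apply, map_X])
      refine (congrArg _ h1).trans ((hX A' i).trans (Eq.trans ?_ (congrArg ψ (hX A i)).symm))
      rw [hψ']
      congr 1
      refine Fin.cases ?_ (fun i => ?_) i <;> simp
  have h1 : coordι A' (coordZ_mem A') one_pos ≫ baseMap φ =
      Spec.map (CommRingCat.ofHom m) ≫ coordι A (coordZ_mem A) one_pos := hm
  rw [affineι, affineι, Category.assoc, h1, ← Category.assoc, ← Category.assoc, ← Spec.map_comp,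
    ← Spec.map_comp]
  congr 2
  exact CommRingCat.hom_ext key

theorem map_infinityEq (i : Fin 4) : map φ (infinityEq A i) = infinityEq A' i := by
  rw [infinityEq, infinityEq, map_mul, map_X, ← map_F5 φ, pderiv_map]

theorem infinityOpen_le_preimage : infinityOpen A' ≤ baseMap φ ⁻¹ᵁ infinityOpen A := by
  refine iSup_le fun i => ?_
  rw [← baseMap_preimage φ (map_infinityEq φ i)]
  exact fun x hx => le_iSup (fun i => coordOpen A (toCoord A (infinityEq A i))) i hx

/-- The formation of the ideal sheaf of the nodes commutes with base change. -/
theorem nodeSheaf_comap_baseMap (h5 : IsUnit (5 : A')) :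
    (nodeSheaf A).comap (baseMap φ) = nodeSheaf A' := by
  let V : Bool → Scheme.{0} := fun t => if t then Spec (.of (HypRing (f5 A'))) else (infinityOpen A').toScheme
  let j : ∀ t, V t ⟶ Xbar A' := fun t => match t with
    | true => affineι A'
    | false => (infinityOpen A').ι
  have hj : ∀ t, IsOpenImmersion (j t) := by
    rintro (_ | _)
    · exact inferInstanceAs (IsOpenImmersion (infinityOpen A').ι)
    · exact inferInstanceAs (IsOpenImmersion (affineι A'))
  refine ideal_ext_of_cover V j (fun x => ?_) ?_
  · rcases affine_or_infinity A' h5 x with h | h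
    · exact ⟨true, h⟩
    · exact ⟨false, ⟨⟨x, h⟩, rfl⟩⟩
  rintro (_ | _)
  -- Near infinity both ideal sheaves are trivial, since the nodes avoid this open and `baseMap`
  -- respects it. On the affine chart the generators correspond.
  · change ((nodeSheaf A).comap (baseMap φ)).comap (infinityOpen A').ι =
      (nodeSheaf A').comap (infinityOpen A').ι
    have hle : Set.range ((infinityOpen A').ι ≫ baseMap φ) ⊆ Set.range (infinityOpen A).ι := by
      rw [Scheme.Opens.range_ι]
      rintro _ ⟨x, rfl⟩
      exact infinityOpen_le_preimage φ x.2
    rw [nodeSheaf_comap_infinity, ← Scheme.IdealSheafData.comap_comp,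
      ← IsOpenImmersion.lift_fac (infinityOpen A).ι _ hle, Scheme.IdealSheafData.comap_comp,
      nodeSheaf_comap_infinity, Scheme.IdealSheafData.comap_top]
  · change ((nodeSheaf A).comap (baseMap φ)).comap (affineι A') =
      (nodeSheaf A').comap (affineι A')
    obtain ⟨ψ, h1, h2⟩ := exists_affineι_baseMap φ
    rw [nodeSheaf_comap_affineι, ← Scheme.IdealSheafData.comap_comp, h1,
      Scheme.IdealSheafData.comap_comp, nodeSheaf_comap_affineι, nodeIdeal]
    refine (comap_specMap_span (nodeGen (f5 A) (nodeEqs A)) ψ).trans ?_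
    rw [nodeIdeal]
    congr 3
    refine funext fun i => (h2 _).trans ?_
    rw [map_nodeEqs]

end BaseChangeNodes

/-! ### Good reduction -/

/-! ### Properties of `ℤ_(p)`. -/

section ValuationRing

variable (p : ℕ) [Fact p.Prime]

/-- The valuation ring `ℤ_(p)`. -/
abbrev LocalInt : ValuationSubring ℚ := (Rat.padicValuation p).valuationSubring

theorem padicValuation_natCast_eq_one {n : ℤ} (hn : ¬ (p : ℤ) ∣ n) :
    Rat.padicValuation p (n : ℚ) = 1 := by
  rw [Rat.padicValuation_cast]
  exact Int.padicValuation_eq_one_iff.mpr hn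

theorem isUnit_localInt {n : ℤ} (hn : ¬ (p : ℤ) ∣ n) : IsUnit (n : LocalInt p) := by
  have h0 : (n : ℚ) ≠ 0 := by
    intro h
    rw [Int.cast_eq_zero] at h
    exact hn (h ▸ dvd_zero _)
  have hm : (n : ℚ)⁻¹ ∈ LocalInt p := by
    rw [Valuation.mem_valuationSubring_iff, map_inv₀, padicValuation_natCast_eq_one p hn, inv_one]
  refine IsUnit.of_mul_eq_one ⟨(n : ℚ)⁻¹, hm⟩ (Subtype.ext ?_)
  change ((n : LocalInt p) : ℚ) * (n : ℚ)⁻¹ = 1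
  push_cast
  exact mul_inv_cancel₀ h0

/-- The valuation ring is the localization of `ℤ` at `(p)`: its elements are the fractions with
reduced denominator prime to `p`. -/
theorem localInt_isNoetherianRing : IsNoetherianRing (LocalInt p) := by
  have hp : Prime (p : ℤ) := Nat.prime_iff_prime_int.mp Fact.out
  have hI : (Ideal.span {(p : ℤ)}).IsPrime := (Ideal.span_singleton_prime hp.ne_zero).mpr hp
  have hmem (n : ℤ) (h : n ∈ (Ideal.span {(p : ℤ)}).primeCompl) : ¬ (p : ℤ) ∣ n := fun hd =>
    h (Ideal.mem_span_singleton.mpr hd)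
  have hloc : IsLocalization (Ideal.span {(p : ℤ)}).primeCompl (LocalInt p) := by
    refine ⟨⟨fun y => ?_, fun x => ?_, fun {x y} h => ?_⟩⟩
    · exact isUnit_localInt p (hmem _ y.2)
    · have hx := (Valuation.mem_valuationSubring_iff _ _).mp x.2
      rw [Rat.padicValuation_le_one_iff] at hx
      refine ⟨((x : ℚ).num, ⟨((x : ℚ).den : ℤ), fun h => hx ?_⟩), Subtype.ext ?_⟩
      · exact Int.natCast_dvd_natCast.mp (Ideal.mem_span_singleton.mp h)
      · simp
    · refine ⟨1, ?_⟩
      have : x = y := by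
        have := congrArg (Subtype.val) h
        simpa using this
      rw [this]
  exact IsLocalization.isNoetherianRing (Ideal.span {(p : ℤ)}).primeCompl _ inferInstance

/-- This makes `Spec ℚ ⟶ Spec ℤ_(p)` an open immersion, so compatibility of blow-ups with
restriction to opens suffices for the generic fibre. -/
theorem isLocalization_away_localInt : IsLocalization.Away (p : LocalInt p) ℚ := by
  have hp0 : (p : ℚ) ≠ 0 := by exact_mod_cast (Fact.out : p.Prime).ne_zero
  refine ⟨⟨fun y => ?_, fun x => ?_, fun {x y} h => ⟨1, ?_⟩⟩⟩
  · obtain ⟨_, n, rfl⟩ := y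
    rw [map_pow, map_natCast]
    exact (isUnit_iff_ne_zero.mpr hp0).pow n
  -- Split the denominator as `pⁿ m` with `m` prime to `p`; then `pⁿ x = num / m` is `p`-integral.
  · obtain ⟨n, m, hm, hd⟩ := Nat.exists_eq_pow_mul_and_not_dvd x.den_nz p
      (Fact.out : p.Prime).ne_one
    have hm0 : (m : ℚ) ≠ 0 := by
      rintro h
      rw [Nat.cast_eq_zero] at h
      exact hm (h ▸ dvd_zero _)
    have hmv : Rat.padicValuation p (m : ℚ) = 1 := by
      have := padicValuation_natCast_eq_one p (n := m) (by exact_mod_cast hm)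
      exact_mod_cast this
    have hmem : (x.num : ℚ) / m ∈ LocalInt p := by
      rw [Valuation.mem_valuationSubring_iff, map_div₀, hmv, div_one, Rat.padicValuation_cast]
      exact Int.padicValuation_le_one p _
    refine ⟨(⟨_, hmem⟩, ⟨(p : LocalInt p) ^ n, n, rfl⟩), ?_⟩
    change x * algebraMap _ ℚ ((p : LocalInt p) ^ n) = x.num / m
    rw [map_pow, map_natCast, eq_div_iff hm0, mul_assoc]
    have := Rat.mul_den_eq_num x
    rw [hd] at this
    exact_mod_cast this
  · have : x = y := Subtype.ext h
    rw [this]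

theorem isUnit_thirty_localInt (h2 : p ≠ 2) (h3 : p ≠ 3) (h5 : p ≠ 5) :
    IsUnit (30 : LocalInt p) := by
  have hp : p.Prime := Fact.out
  have : ¬ (p : ℤ) ∣ 30 := by
    intro h
    have h' : p ∣ 2 * 3 * 5 := by exact_mod_cast h
    rcases (hp.dvd_mul.mp h') with h' | h'
    · rcases (hp.dvd_mul.mp h') with h' | h'
      · exact h2 ((Nat.prime_dvd_prime_iff_eq hp Nat.prime_two).mp h')
      · exact h3 ((Nat.prime_dvd_prime_iff_eq hp Nat.prime_three).mp h')
    · exact h5 ((Nat.prime_dvd_prime_iff_eq hp Nat.prime_five).mp h')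
  have h := isUnit_localInt p this
  exact_mod_cast h

end ValuationRing

/-- The blow-up of the quintic in its nodes has good reduction outside `2`, `3` and `5`. -/
theorem hasGoodReductionAt_of_isBlowup {Xt : Scheme.{0}} {π : Xt ⟶ Xbar ℚ}
    (hπ : IsBlowup (nodeSheaf ℚ) π) (p : ℕ) [Fact p.Prime] (h2 : p ≠ 2) (h3 : p ≠ 3)
    (h5 : p ≠ 5) : HasGoodReductionAt (π ≫ XbarHom ℚ) p := by
  have := localInt_isNoetherianRing p
  have := isLocalization_away_localInt p
  let φ := algebraMap (LocalInt p) ℚ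
  obtain ⟨M, ρ, hρ, hproper, hsmooth⟩ := exists_nodeBlowup (LocalInt p)
    (isUnit_thirty_localInt p h2 h3 h5)
  have hb := isPullback_baseMap φ
  have hφ : IsOpenImmersion (Spec.map (CommRingCat.ofHom φ)) :=
    IsOpenImmersion.of_isLocalization (p : LocalInt p)
  have hbo : IsOpenImmersion (baseMap φ) := MorphismProperty.of_isPullback hb.flip hφ
  have hpb : IsPullback (pullback.fst (baseMap φ) ρ) (pullback.snd (baseMap φ) ρ) (baseMap φ) ρ :=
    IsPullback.of_hasPullback _ _
  have hM := hρ.of_isPullback hpb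
  -- The generic fibre of the model is now a blow-up of the same ideal sheaf as `Xt`, hence
  -- isomorphic to `Xt` over the quintic.
  rw [nodeSheaf_comap_baseMap φ (isUnit_iff_ne_zero.mpr (by norm_num))] at hM
  obtain ⟨e, he⟩ := hπ.exists_iso hM
  have hsq : IsPullback (e.hom ≫ pullback.snd (baseMap φ) ρ) π ρ (baseMap φ) := by
    refine IsPullback.of_iso hpb.flip e.symm (Iso.refl _) (Iso.refl _) (Iso.refl _) ?_ ?_ ?_ ?_
    all_goals simp [← he]
  exact ⟨M, ρ ≫ XbarHom _, _, hproper, hsmooth, hsq.paste_vert hb⟩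

/-! ### The singular locus -/

section NotSmooth

open MvPolynomial

variable {B n : Type} [CommRing B] [IsDomain B] [Fintype n]

/-- A hypersurface is not smooth at a zero of all its partial derivatives. -/
theorem quotLoc_hypersurface_not_formallySmooth {f W : MvPolynomial n B} (hf0 : f ≠ 0)
    {K : Type} [Field K] (φ : MvPolynomial n B →+* K) (hf : φ f = 0)
    (hd : ∀ i, φ (pderiv i f) = 0) (hW : φ W ≠ 0) :
    ¬ Algebra.FormallySmooth B (QuotLoc (fun _ : Unit => f) W) := by
  intro hsm
  -- Test formal smoothness on the square-zero thickening `f² = 0` of the hypersurface: a lift would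
  -- be a section of the projection to `f = 0`.
  let q : Unit → MvPolynomial n B := fun _ => f ^ 2
  let C := QuotLoc q W
  let t : MvPolynomial n B →ₐ[B] C := toQuotLoc q W
  have ht2 : t f * t f = 0 := by
    rw [← map_mul, ← pow_two]; exact toQuotLoc_relation q W ()
  let I : Ideal C := Ideal.span {t f}
  have hI : IsNilpotent I := ⟨2, by
    rw [Ideal.span_singleton_pow, pow_two, ht2, Ideal.zero_eq_bot, Ideal.span_singleton_eq_bot]⟩
  obtain ⟨ψ, hψ⟩ := exists_quotLoc_lift q W φ (fun _ => by simp [q, hf]) (isUnit_iff_ne_zero.mpr hW)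
  obtain ⟨g, hg⟩ := exists_quotLoc_lift (fun _ : Unit => f) W
    ((Ideal.Quotient.mk I).comp t.toRingHom)
    (fun _ => Ideal.Quotient.eq_zero_iff_mem.mpr (Ideal.mem_span_singleton_self _))
    (IsUnit.map (Ideal.Quotient.mk I) (isUnit_toQuotLoc q W))
  let g' : QuotLoc (fun _ : Unit => f) W →ₐ[B] C ⧸ I := { g with
    commutes' := fun b => by
      have h1 := hg (MvPolynomial.C b)
      rw [← algebraMap_eq, AlgHom.commutes] at h1
      refine h1.trans ?_
      change Ideal.Quotient.mk I (t (algebraMap B _ b)) = _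
      rw [AlgHom.commutes]; rfl }
  obtain ⟨σ, hσ⟩ := Algebra.FormallySmooth.exists_lift I hI g'
  have hx (i : n) : ∃ a, σ (toQuotLoc (fun _ : Unit => f) W (X i)) = t (X i) + t f * a := by
    have h1 : Ideal.Quotient.mk I (σ (toQuotLoc (fun _ : Unit => f) W (X i))) =
        Ideal.Quotient.mk I (t (X i)) := congr($hσ _).trans (hg (X i))
    obtain ⟨a, ha⟩ := Ideal.mem_span_singleton'.mp (Ideal.Quotient.eq.mp h1)
    exact ⟨a, by linear_combination -ha⟩
  choose a ha using hx
  have hT := aeval_add_of_mul_eq_zero (fun i => t (X i)) (fun i => t f * a i)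
    (fun i j => by linear_combination a i * a j * ht2) f
  have e1 : (σ.comp (toQuotLoc (fun _ : Unit => f) W)) =
      aeval (fun i => t (X i) + t f * a i) := algHom_ext fun i => by
    rw [AlgHom.comp_apply, ha, aeval_X]
  have e2 : t = aeval (fun i => t (X i)) := algHom_ext fun i => by rw [aeval_X]
  rw [← e1, ← e2, AlgHom.comp_apply, toQuotLoc_relation (fun _ : Unit => f) W (), map_zero] at hT
  -- The section moves each coordinate by a multiple of `f`, so Taylor's formula gives `f u = 0` in
  -- the thickening. Since the partial derivatives vanish at the point, `u` has value `1` there.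
  let u : C := 1 + ∑ i, t (pderiv i f) * a i
  have hu : t f * u = 0 := by
    rw [hT, mul_add, mul_one, Finset.mul_sum]
    exact congrArg _ (Finset.sum_congr rfl fun i _ => by ring)
  have hu1 : ψ u = 1 := by
    rw [map_add, map_one, map_sum, Finset.sum_eq_zero fun i _ => ?_, add_zero]
    rw [map_mul, hψ, hd, zero_mul]
  obtain ⟨⟨c, s⟩, hc⟩ := IsLocalization.surj
    (Submonoid.powers (Ideal.Quotient.mk (Ideal.span (Set.range q)) W)) u
  obtain ⟨Q, rfl⟩ := Ideal.Quotient.mk_surjective c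
  obtain ⟨_, m, rfl⟩ := s
  have hc' : u * t W ^ m = t Q := by
    rw [← map_pow]; exact hc
  have h0 : t (f * Q) = 0 := by
    rw [map_mul, ← hc', ← mul_assoc, hu, zero_mul]
  obtain ⟨⟨_, l, rfl⟩, hl⟩ := (IsLocalization.map_eq_zero_iff
    (Submonoid.powers (Ideal.Quotient.mk (Ideal.span (Set.range q)) W)) C _).mp h0
  have hl' : Ideal.Quotient.mk (Ideal.span (Set.range q)) (W ^ l * (f * Q)) = 0 := by
    rw [map_mul, map_pow]; exact hl
  rw [Ideal.Quotient.eq_zero_iff_mem, Set.range_const, Ideal.mem_span_singleton'] at hl'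
  obtain ⟨d, hd'⟩ := hl'
  have h3 : d * f = W ^ l * Q := mul_right_cancel₀ hf0 (by linear_combination hd')
  -- Clearing denominators and cancelling one `f` puts the numerator `Q` of `u`, up to a power of
  -- `W`, into the ideal `(f)`. It therefore vanishes at the point, contradicting the value `1` of
  -- `u`.
  have h4 : φ Q = 0 := by
    have := congrArg φ h3
    rw [map_mul, hf, mul_zero, map_mul, map_pow] at this
    exact (mul_eq_zero.mp this.symm).resolve_left (pow_ne_zero _ hW)
  have h5 := congrArg ψ hc'
  rw [map_mul, hu1, map_pow, hψ, hψ, h4, one_mul] at h5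
  exact pow_ne_zero _ hW h5

end NotSmooth

/-! ### The scheme of nodes is unramified over the base. -/

section Nodes

open MvPolynomial

variable (A : Type) [CommRing A]

theorem isUnit_of_forall_notMem_maximal {S : Type} [CommRing S] {x : S}
    (h : ∀ m : Ideal S, m.IsMaximal → x ∉ m) : IsUnit x := by
  by_contra hn
  obtain ⟨m, hm, hmem⟩ := exists_max_ideal_of_mem_nonunits hn
  exact h m hm hmem

/-- The Jacobian determinant of `g` lies in no maximal ideal of the quotient, so it is a unit. Two
maps that agree modulo a square-zero ideal differ by a vector killed by the Jacobian matrix, which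
is therefore zero. -/
theorem hypRing_quotient_formallyUnramified {n : Type} [Fintype n] [DecidableEq n]
    (f : MvPolynomial n A) (g : n → MvPolynomial n A)
    (h : ∀ (K : Type) [Field K] (φ : MvPolynomial n A →+* K), φ f = 0 → (∀ i, φ (g i) = 0) →
      φ (jacobian g).det ≠ 0) :
    Algebra.FormallyUnramified A (HypRing f ⧸ Ideal.span (Set.range (nodeGen f g))) := by
  let J := Ideal.span (Set.range (nodeGen f g))
  let q : MvPolynomial n A →ₐ[A] HypRing f ⧸ J := (Ideal.Quotient.mkₐ A J).comp (toHypRing f)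
  have hq : Function.Surjective q := (Ideal.Quotient.mk_surjective).comp Ideal.Quotient.mk_surjective
  have hqf : q f = 0 := by
    rw [AlgHom.comp_apply, toHypRing_self, map_zero]
  have hqg (i) : q (g i) = 0 := Ideal.Quotient.eq_zero_iff_mem.mpr (Ideal.subset_span ⟨i, rfl⟩)
  have hu : IsUnit (q (jacobian g).det) := by
    refine isUnit_of_forall_notMem_maximal (S := HypRing f ⧸ J) fun m hm hmem => ?_
    let _ := Ideal.Quotient.field m
    refine h (_ ⧸ m) ((Ideal.Quotient.mk m).comp q.toRingHom) ?_ (fun i => ?_)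
      (Ideal.Quotient.eq_zero_iff_mem.mpr hmem)
    · change Ideal.Quotient.mk m (q f) = 0
      rw [hqf, map_zero]
    · change Ideal.Quotient.mk m (q (g i)) = 0
      rw [hqg, map_zero]
  rw [Algebra.FormallyUnramified.iff_comp_injective]
  intro C _ _ I hI σ τ hστ
  have hmem (x) : τ x - σ x ∈ I := Ideal.Quotient.eq.mp congr($hστ x).symm
  have hmul {x y : C} (hx : x ∈ I) (hy : y ∈ I) : x * y = 0 := by
    have := Ideal.mul_mem_mul hx hy
    rwa [← pow_two, hI] at this
  let v : n → C := fun i => τ (q (X i)) - σ (q (X i))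
  have hT (P) : τ (q P) = σ (q P) + ∑ s, σ (q (pderiv s P)) * v s := by
    have := aeval_add_of_mul_eq_zero (fun i => σ (q (X i))) v
      (fun i j => hmul (hmem _) (hmem _)) P
    have e1 : σ.comp q = aeval (fun i => σ (q (X i))) := algHom_ext fun i => by
      rw [aeval_X]; rfl
    have e2 : τ.comp q = aeval (fun i => σ (q (X i)) + v i) := algHom_ext fun i => by
      rw [aeval_X, AlgHom.comp_apply]; simp [v]
    rw [← e1, ← e2] at this
    exact this
  let M : Matrix n n C := (jacobian g).map (σ.toRingHom.comp q.toRingHom)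
  have hM : M.mulVec v = 0 := funext fun i => by
    have := hT (g i)
    rw [hqg, map_zero, map_zero, zero_add] at this
    exact this.symm
  have hMu : IsUnit M.det := by
    have := hu.map σ
    have e : M.det = σ (q (jacobian g).det) := (RingHom.map_det _ _).symm
    rwa [e]
  have hv : v = 0 := by
    have := congrArg (M⁻¹.mulVec) hM
    rwa [Matrix.mulVec_mulVec, Matrix.nonsing_inv_mul _ hMu, Matrix.one_mulVec,
      Matrix.mulVec_zero] at this
  refine AlgHom.ext fun x => ?_
  obtain ⟨P, rfl⟩ := hq x
  rw [hT P, hv]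
  simp

end Nodes

/-! ### The singular locus and its reduced structure. -/

section SingularLocus

open MvPolynomial

theorem mem_support_specIdeal {R : CommRingCat.{0}} (J : Ideal R) (y : Spec R) :
    y ∈ (specIdeal J).support ↔ J ≤ (y : PrimeSpectrum R).asIdeal := by
  have hcl : IsClosedImmersion (specQuot J) := IsClosedImmersion.spec_of_quotient_mk J
  have h1 : ((specIdeal J).support : Set (Spec R)) = Set.range (specQuot J) := by
    rw [← ker_specQuot, Scheme.Hom.support_ker, hcl.isClosedEmbedding.isClosed_range.closure_eq]
  have h2 : Set.range (specQuot J) = PrimeSpectrum.zeroLocus (J : Set R) := by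
    have := range_comap_of_surjective (R ⧸ J) (Ideal.Quotient.mk J)
      Ideal.Quotient.mk_surjective
    rw [Ideal.mk_ker] at this
    exact this
  change y ∈ ((specIdeal J).support : Set (Spec R)) ↔ _
  rw [h1, h2]
  rfl

theorem affineι_mem_support_nodeSheaf (A : Type) [CommRing A] (y : Spec (.of (HypRing (f5 A)))) :
    affineι A y ∈ (nodeSheaf A).support ↔
      ∀ i, toHypRing (f5 A) (nodeEqs A i) ∈ (y : PrimeSpectrum (HypRing (f5 A))).asIdeal := by
  have h1 : affineι A y ∈ (nodeSheaf A).support ↔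
      y ∈ ((nodeSheaf A).comap (affineι A)).support := by
    rw [Scheme.IdealSheafData.support_comap]
    exact Iff.rfl
  rw [h1, nodeSheaf_comap_affineι, mem_support_specIdeal, nodeIdeal, Ideal.span_le]
  exact Set.range_subset_iff

theorem notMem_support_nodeSheaf (A : Type) [CommRing A] {x : Xbar A} (hx : x ∈ infinityOpen A) :
    x ∉ (nodeSheaf A).support := by
  intro h
  have h1 : (⟨x, hx⟩ : (infinityOpen A).toScheme) ∈
      ((nodeSheaf A).comap (infinityOpen A).ι).support := by
    rw [Scheme.IdealSheafData.support_comap]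
    exact h
  rw [nodeSheaf_comap_infinity, Scheme.IdealSheafData.support_top] at h1
  exact h1

/-- The inclusion of the principal open subset of the affine threefold defined by `W`. -/
def principalι (A : Type) [CommRing A] (W : MvPolynomial (Fin 4) A) :
    Spec (.of (QuotLoc (fun _ : Unit => f5 A) W)) ⟶ Xbar A :=
  Spec.map (CommRingCat.ofHom (algebraMap (HypRing (f5 A)) (Localization.Away (toHypRing (f5 A) W))))
    ≫ affineι A

instance (A : Type) [CommRing A] (W : MvPolynomial (Fin 4) A) : IsOpenImmersion (principalι A W) := by
  have : IsOpenImmersion (Spec.map (CommRingCat.ofHom (algebraMap (HypRing (f5 A))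
      (Localization.Away (toHypRing (f5 A) W))))) :=
    IsOpenImmersion.of_isLocalization (toHypRing (f5 A) W)
  exact MorphismProperty.comp_mem @IsOpenImmersion _ (affineι A) this inferInstance

theorem principalι_XbarHom (A : Type) [CommRing A] (W : MvPolynomial (Fin 4) A) :
    principalι A W ≫ XbarHom A =
      Spec.map (CommRingCat.ofHom (algebraMap A (QuotLoc (fun _ : Unit => f5 A) W))) := by
  rw [principalι, Category.assoc, affineι_XbarHom, ← Spec.map_comp]
  rfl

theorem affineι_mem_range_principalι (A : Type) [CommRing A] (W : MvPolynomial (Fin 4) A)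
    (y : Spec (.of (HypRing (f5 A)))) : affineι A y ∈ Set.range (principalι A W) ↔
      toHypRing (f5 A) W ∉ (y : PrimeSpectrum (HypRing (f5 A))).asIdeal := by
  have h := PrimeSpectrum.localization_away_comap_range
    (Localization.Away (toHypRing (f5 A) W)) (toHypRing (f5 A) W)
  have h' : y ∈ Set.range (Spec.map (CommRingCat.ofHom (algebraMap (HypRing (f5 A))
      (Localization.Away (toHypRing (f5 A) W))))) ↔
        toHypRing (f5 A) W ∉ (y : PrimeSpectrum (HypRing (f5 A))).asIdeal := by
    change (y : PrimeSpectrum (HypRing (f5 A))) ∈ Set.range (PrimeSpectrum.comap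
      (algebraMap (HypRing (f5 A)) (Localization.Away (toHypRing (f5 A) W)))) ↔ _
    rw [h]
    exact Iff.rfl
  rw [← h']
  constructor
  · rintro ⟨z, hz⟩
    refine ⟨z, (affineι A).isOpenEmbedding.injective ?_⟩
    exact hz
  · rintro ⟨z, rfl⟩
    exact ⟨z, rfl⟩

theorem f5_ne_zero (A : Type) [CommRing A] [Nontrivial A] : f5 A ≠ 0 := by
  intro h
  have := congrArg (eval ![1, 0, 0, 0]) h
  simp [f5, P5] at this

/-- The singular locus of the quintic is the support of the ideal sheaf of the nodes. -/
theorem singularLocus_eq_support (k : Type) [Field k] (h5 : (5 : k) ≠ 0) :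
    singularLocus (XbarHom k) = (nodeSheaf k).support := by
  ext x
  constructor
  -- Off the support some `g_i` is nonzero at the point, and it is a unit multiple of a partial
  -- derivative of `f₅`, so the Jacobian criterion gives a smooth neighbourhood.
  · intro hx
    by_contra hn
    have key {V : Scheme.{0}} (j : V ⟶ Xbar k) [IsOpenImmersion j] (hxj : x ∈ Set.range j)
        (hs : Smooth (j ≫ XbarHom k)) : False := by
      refine hx j.opensRange hxj ?_
      have e : j.opensRange.ι ≫ XbarHom k =
          j.isoOpensRange.inv ≫ j ≫ XbarHom k := by
        rw [← Category.assoc, Scheme.Hom.isoOpensRange_inv_comp]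
      rw [e]
      infer_instance
    rcases affine_or_infinity k h5.isUnit x with ⟨y, rfl⟩ | h
    · have hn' : affineι k y ∉ (nodeSheaf k).support := hn
      rw [affineι_mem_support_nodeSheaf, not_forall] at hn'
      obtain ⟨i, hi⟩ := hn'
      refine key (principalι k (nodeEqs k i)) ((affineι_mem_range_principalι k _ y).mpr hi) ?_
      rw [principalι_XbarHom, HasRingHomProperty.Spec_iff (P := @Smooth.{0}) (Q := RingHom.Smooth),
        CommRingCat.hom_ofHom, RingHom.smooth_algebraMap]
      refine quotLoc_hypersurface_smooth (f5 k) (nodeEqs k i) i ?_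
      rw [pderiv_f5, map_mul]
      exact ((h5.isUnit.map C).map _).mul (isUnit_toQuotLoc _ _)
    · exact hx (infinityOpen k) h (infinityOpen_smooth k)
  -- Conversely, a smooth neighbourhood of a node shrinks to a principal open of the affine
  -- threefold, where all partial derivatives vanish at the node.
  · intro hx U hxU hU
    rcases affine_or_infinity k h5.isUnit x with ⟨y, rfl⟩ | h
    swap
    · exact notMem_support_nodeSheaf k h hx
    have hg := (affineι_mem_support_nodeSheaf k y).mp hx
    obtain ⟨_, ⟨r, rfl⟩, hyr, hrU⟩ :=
      (PrimeSpectrum.isTopologicalBasis_basic_opens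
        (R := HypRing (f5 k))).exists_subset_of_mem_open
      (show y ∈ ((affineι k ⁻¹ᵁ U : (Spec (.of (HypRing (f5 k)))).Opens) : Set _) from hxU)
      (affineι k ⁻¹ᵁ U).isOpen
    obtain ⟨W, rfl⟩ := Ideal.Quotient.mk_surjective r
    have hj : Set.range (principalι k W) ⊆ Set.range U.ι := by
      rw [Scheme.Opens.range_ι]
      rintro _ ⟨z, rfl⟩
      let z' := Spec.map (CommRingCat.ofHom (algebraMap (HypRing (f5 k))
        (Localization.Away (toHypRing (f5 k) W)))) z
      exact hrU (show z' ∈ _ from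
        (affineι_mem_range_principalι k W z').mp ⟨z, rfl⟩)
    have hs : Smooth (principalι k W ≫ XbarHom k) := by
      have e : principalι k W ≫ XbarHom k =
          IsOpenImmersion.lift U.ι (principalι k W) hj ≫ U.ι ≫ XbarHom k := by
        rw [IsOpenImmersion.lift_fac_assoc]
      have : IsOpenImmersion (IsOpenImmersion.lift U.ι (principalι k W) hj) := by
        have : IsOpenImmersion (IsOpenImmersion.lift U.ι (principalι k W) hj ≫ U.ι) := by
          rw [IsOpenImmersion.lift_fac]; infer_instance
        exact IsOpenImmersion.of_comp _ U.ι
      rw [e]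
      infer_instance
    rw [principalι_XbarHom, HasRingHomProperty.Spec_iff (P := @Smooth.{0}) (Q := RingHom.Smooth),
      CommRingCat.hom_ofHom, RingHom.smooth_algebraMap] at hs
    let 𝔭 : PrimeSpectrum (HypRing (f5 k)) := y
    let φ : MvPolynomial (Fin 4) k →+* 𝔭.asIdeal.ResidueField :=
      (algebraMap (HypRing (f5 k)) _).comp (toHypRing (f5 k)).toRingHom
    have hφ (P) : φ P = 0 ↔ toHypRing (f5 k) P ∈ 𝔭.asIdeal :=
      Ideal.algebraMap_residueField_eq_zero
    refine quotLoc_hypersurface_not_formallySmooth (f5_ne_zero k) φ ?_ (fun i => ?_)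
      (mt (hφ W).mp hyr) hs.formallySmooth
    · rw [hφ, toHypRing_self]; exact zero_mem _
    · rw [pderiv_f5, hφ, map_mul]; exact Ideal.mul_mem_left _ _ (hg i)

/-- The ideal sheaf of the nodes is radical. -/
theorem vanishingIdeal_support_nodeSheaf (k : Type) [Field k] (h30 : (30 : k) ≠ 0) :
    Scheme.IdealSheafData.vanishingIdeal (nodeSheaf k).support = nodeSheaf k := by
  have : Algebra.FormallyUnramified k (HypRing (f5 k) ⧸ nodeIdeal k) :=
    hypRing_quotient_formallyUnramified k _ _
      fun K _ φ hf hg => (node_conditions k h30.isUnit K φ hf hg).2.2.1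
  have : _root_.IsReduced (HypRing (f5 k) ⧸ nodeIdeal k) :=
    Algebra.FormallyUnramified.isReduced_of_field k (HypRing (f5 k) ⧸ nodeIdeal k)
  rw [Scheme.IdealSheafData.vanishingIdeal_support]
  refine le_antisymm ?_ (Scheme.IdealSheafData.le_radical _)
  have hbot : Scheme.IdealSheafData.map ⊥ (nodeSubscheme k) = nodeSheaf k :=
    Scheme.IdealSheafData.map_bot _
  -- By adjunction the radical lies in the ideal of the nodes once its pullback to the scheme of
  -- nodes is zero. That scheme is reduced, so it is enough that the pullback has full support.
  rw [← hbot, Scheme.IdealSheafData.le_map_iff_comap_le, hbot, le_bot_iff,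
    ← Scheme.IdealSheafData.support_eq_top_iff, Scheme.IdealSheafData.support_comap,
    Scheme.IdealSheafData.support_radical]
  ext z
  exact ⟨fun _ => trivial, fun _ => (nodeSubscheme k).range_subset_ker_support ⟨z, rfl⟩⟩

/-- The reduced ideal sheaf of the singular locus of the quintic is the ideal sheaf of the
nodes. -/
theorem vanishingIdeal_singularLocus (k : Type) [Field k] (h30 : (30 : k) ≠ 0) :
    Scheme.IdealSheafData.vanishingIdeal (singularLocus (XbarHom k)) = nodeSheaf k := by
  rw [singularLocus_eq_support k (ne_zero_of_thirty h30).2.2, vanishingIdeal_support_nodeSheaf k h30]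

end SingularLocus

/-! ### The critical points in terms of roots of unity -/

section CriticalPoints

open MvPolynomial

/-- The partial derivatives of `P₅` are `5` times these expressions, and `5` can be cancelled. -/
theorem mem_critPts {A : Type*} [CommRing A] [IsDomain A] (h5 : (5 : A) ≠ 0) {v : Fin 2 → A} :
    v ∈ critPts A ↔ quinticDeriv (v 0) (v 1) = 0 ∧ quinticDeriv (v 1) (v 0) = 0 := by
  have h (i : Fin 2) : eval v (pderiv i (P5 A)) =
      5 * quinticDeriv (v 0) (v 1) * (Pi.single (M := fun _ => A) i 1 0) +
      5 * quinticDeriv (v 1) (v 0) * (Pi.single (M := fun _ => A) i 1 1) := by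
    rw [P5_eq, derivation_quintic]
    simp only [map_add, map_mul, map_ofNat, map_quinticDeriv, eval_X, pderiv_X]
    congr 2
    · by_cases h : 0 = i <;> simp [h]
    · by_cases h : 1 = i <;> simp [h]
  simp only [critPts, Set.mem_ofPred_eq, Fin.forall_fin_two, h]
  simp [h5]

theorem eval_P5 {A : Type*} [CommRing A] (v : Fin 2 → A) : eval v (P5 A) = quintic (v 0) (v 1) := by
  rw [P5_eq, map_quintic, eval_X, eval_X]

variable {D : Type*} [CommRing D]

/-- A root of unity `u` of order five gives a critical point with value `6`. -/
def critSix (u : D) : Fin 2 → D := ![1 + u + u ^ 4, 1 + u + u ^ 4]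

/-- Roots of unity `u`, `w` of order five and three give a critical point with value `-3`. -/
def critThree (u w : D) : Fin 2 → D := ![w * (1 + u + u ^ 4), w ^ 2 * (1 + u + u ^ 4)]

/-- A critical point with value `-2` on the diagonal. -/
def critTwoDiag (u : D) : Fin 2 → D := ![1 - u - u ^ 4, 1 - u - u ^ 4]

/-- A critical point with value `-2` on the line `x + y = -2`. -/
def critTwoLine (u : D) : Fin 2 → D := ![u ^ 4 - 1 - u, u - 1 - u ^ 4]

/-- A critical point with value `-2` on the hyperbola `xy = 1`. -/
def critTwoConic (u : D) : Fin 2 → D := ![-u, -u ^ 4]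

section Mem

variable {u w : D}

theorem quintic_critSix (hu : 1 + u + u ^ 2 + u ^ 3 + u ^ 4 = 0) :
    quinticDeriv (1 + u + u ^ 4) (1 + u + u ^ 4) = 0 ∧
    quintic (1 + u + u ^ 4) (1 + u + u ^ 4) = 6 := by
  simp only [quintic, quinticDeriv]; constructor <;> grind

theorem quintic_critTwoDiag (hu : 1 + u + u ^ 2 + u ^ 3 + u ^ 4 = 0) :
    quinticDeriv (1 - u - u ^ 4) (1 - u - u ^ 4) = 0 ∧
    quintic (1 - u - u ^ 4) (1 - u - u ^ 4) = -2 := by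
  simp only [quintic, quinticDeriv]; constructor <;> grind

theorem quintic_critTwoLine (hu : 1 + u + u ^ 2 + u ^ 3 + u ^ 4 = 0) :
    quinticDeriv (u ^ 4 - 1 - u) (u - 1 - u ^ 4) = 0 ∧
    quinticDeriv (u - 1 - u ^ 4) (u ^ 4 - 1 - u) = 0 ∧
    quintic (u ^ 4 - 1 - u) (u - 1 - u ^ 4) = -2 := by
  simp only [quintic, quinticDeriv]; refine ⟨?_, ?_, ?_⟩ <;> grind

theorem quintic_critTwoConic (hu : 1 + u + u ^ 2 + u ^ 3 + u ^ 4 = 0) :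
    quinticDeriv (-u) (-u ^ 4) = 0 ∧ quinticDeriv (-u ^ 4) (-u) = 0 ∧
    quintic (-u) (-u ^ 4) = -2 := by
  simp only [quintic, quinticDeriv]; refine ⟨?_, ?_, ?_⟩ <;> grind

theorem quintic_critThree (hu : 1 + u + u ^ 2 + u ^ 3 + u ^ 4 = 0) (hw : 1 + w + w ^ 2 = 0) :
    quinticDeriv (w * (1 + u + u ^ 4)) (w ^ 2 * (1 + u + u ^ 4)) = 0 ∧
    quinticDeriv (w ^ 2 * (1 + u + u ^ 4)) (w * (1 + u + u ^ 4)) = 0 ∧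
    quintic (w * (1 + u + u ^ 4)) (w ^ 2 * (1 + u + u ^ 4)) = -3 := by
  -- The root of unity `u` enters only through the golden ratio equation `b² = b + 1`.
  have hb : (1 + u + u ^ 4) ^ 2 = (1 + u + u ^ 4) + 1 := by grind
  generalize 1 + u + u ^ 4 = b at hb
  simp only [quintic, quinticDeriv]; refine ⟨?_, ?_, ?_⟩ <;> grind

end Mem

end CriticalPoints

/-! ### Solving the critical equations. -/

section CriticalPoints

open MvPolynomial

variable {D : Type*} [CommRing D]

section Exhaustion

variable [IsDomain D]

/-- The difference of the two equations factors through `y - x`, `y + 2 + x` and a conic.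
Substituting each line into one equation leaves a quartic in `x`; on the conic the sum of the
equations becomes a quartic in `x + y`. -/
theorem eq_or_eq_neg_of_critical {x y : D} (h : quinticDeriv x y = 0)
    (h' : quinticDeriv y x = 0) :
    (y = x ∧ (x ^ 2 - x - 1) * (x ^ 2 - 3 * x + 1) = 0) ∨
    (y = -2 - x ∧ (x ^ 2 + 2 * x) ^ 2 + 7 * (x ^ 2 + 2 * x) + 11 = 0) ∨
    (2 * (x * y) = (x + y) ^ 2 - (x + y) + 1 ∧
      ((x + y) ^ 2 + (x + y) - 1) * ((x + y) ^ 2 - (x + y) - 1) = 0) := by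
  have e : (y - x) * ((y - (-2 - x)) * (2 * (x * y) - ((x + y) ^ 2 - (x + y) + 1))) = 0 := by
    simp only [quinticDeriv] at h h'
    linear_combination h - h'
  rcases mul_eq_zero.mp e with e | e
  · obtain rfl := sub_eq_zero.mp e
    refine .inl ⟨rfl, ?_⟩
    rw [← h, quinticDeriv]; ring
  rcases mul_eq_zero.mp e with e | e
  · obtain rfl := sub_eq_zero.mp e
    refine .inr (.inl ⟨rfl, ?_⟩)
    rw [← h, quinticDeriv]; ring
  · refine .inr (.inr ⟨sub_eq_zero.mp e, ?_⟩)
    simp only [quinticDeriv] at h h'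
    linear_combination -2 * h - 2 * h' + (-4 * (x + y) ^ 2 + 2 * (x * y)
      + ((x + y) ^ 2 - (x + y) + 1) + 2) * e

/-- Over a domain containing roots of unity of order five and three the critical points of the
quintic are the expected ones. -/
theorem critical_cases (h2 : (2 : D) ≠ 0) {e w : D} (he : 1 + e + e ^ 2 + e ^ 3 + e ^ 4 = 0)
    (hw : 1 + w + w ^ 2 = 0) {v : Fin 2 → D} (h : quinticDeriv (v 0) (v 1) = 0)
    (h' : quinticDeriv (v 1) (v 0) = 0) :
    (∃ i : Fin 2, critSix (e ^ (i.val + 1)) = v) ∨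
    (∃ i : Fin 2 × Fin 2, critThree (e ^ (i.1.val + 1)) (w ^ (i.2.val + 1)) = v) ∨
    (∃ i : Fin 2, critTwoDiag (e ^ (i.val + 1)) = v) ∨
    (∃ i : Fin 4, critTwoLine (e ^ (i.val + 1)) = v) ∨
    (∃ i : Fin 4, critTwoConic (e ^ (i.val + 1)) = v) := by
  obtain ⟨x, y, rfl⟩ : ∃ x y, v = ![x, y] := ⟨v 0, v 1, by ext i; fin_cases i <;> rfl⟩
  have hv {a b : D} (ha : x = a) (hb : y = b) : ![a, b] = ![x, y] := by rw [ha, hb]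
  have hb1 : (1 + e + e ^ 4) ^ 2 = 1 + e + e ^ 4 + 1 := by grind
  have hb2 : (1 + e ^ 2 + (e ^ 2) ^ 4) ^ 2 = 1 + e ^ 2 + (e ^ 2) ^ 4 + 1 := by grind
  replace h : quinticDeriv x y = 0 := h
  replace h' : quinticDeriv y x = 0 := h'
  rcases eq_or_eq_neg_of_critical h h' with ⟨rfl, h⟩ | ⟨rfl, h⟩ | ⟨hm, h⟩
  · rcases mul_eq_zero.mp h with h | h
    -- The sums `e + e⁴` and `e² + e³` are the roots of `t² + t - 1`, which splits all the
    -- quadratics that occur.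
    · have : (y - (1 + e + e ^ 4)) * (y - (1 + e ^ 2 + (e ^ 2) ^ 4)) = 0 := by grind
      rcases mul_eq_zero.mp this with h | h <;> have h := sub_eq_zero.mp h
      · refine .inl ⟨0, hv ?_ ?_⟩ <;> simpa using h
      · refine .inl ⟨1, hv ?_ ?_⟩ <;> simpa using h
    · have : (y - (1 - e - e ^ 4)) * (y - (1 - e ^ 2 - (e ^ 2) ^ 4)) = 0 := by grind
      rcases mul_eq_zero.mp this with h | h <;> have h := sub_eq_zero.mp h
      · refine .inr (.inr (.inl ⟨0, hv ?_ ?_⟩)) <;> simpa using h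
      · refine .inr (.inr (.inl ⟨1, hv ?_ ?_⟩)) <;> simpa using h
  · have : ((x - (e ^ 4 - 1 - e)) * (x - ((e ^ 2) ^ 4 - 1 - e ^ 2))) *
        ((x - ((e ^ 3) ^ 4 - 1 - e ^ 3)) * (x - ((e ^ 4) ^ 4 - 1 - e ^ 4))) = 0 := by
      grind
    have key (i : Fin 4) (hi : x - ((e ^ (i.val + 1)) ^ 4 - 1 - e ^ (i.val + 1)) = 0) :
        ∃ i : Fin 4, critTwoLine (e ^ (i.val + 1)) = ![x, -2 - x] :=
      ⟨i, hv (sub_eq_zero.mp hi) (by linear_combination -hi)⟩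
    refine .inr (.inr (.inr (.inl ?_)))
    rcases mul_eq_zero.mp this with h | h <;> rcases mul_eq_zero.mp h with h | h
    · exact key 0 (by simpa using h)
    · exact key 1 h
    · exact key 2 h
    · exact key 3 h
  · rcases mul_eq_zero.mp h with h | h
    · have : (x + y + (1 + e + e ^ 4)) * (x + y + (1 + e ^ 2 + (e ^ 2) ^ 4)) = 0 := by grind
      have key (i : Fin 2) (b : D) (hb : 1 + e ^ (i.val + 1) + (e ^ (i.val + 1)) ^ 4 = b)
          (hb2 : b ^ 2 = b + 1) (hs : x + y + b = 0) :
          ∃ i : Fin 2 × Fin 2, critThree (e ^ (i.1.val + 1)) (w ^ (i.2.val + 1)) = ![x, y] := by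
        have hm' : 2 * (x * y - b ^ 2) = 0 := by grind
        have hm'' := (mul_eq_zero.mp hm').resolve_left h2
        -- With `x + y = -b` and `x y = b²`, the coordinates are the roots of `X² + b X + b²`.
        have : (x - w * b) * (x - w ^ 2 * b) = 0 := by grind
        rcases mul_eq_zero.mp this with hx | hx
        · refine ⟨⟨i, 0⟩, hv ?_ ?_⟩ <;> rw [hb] <;> simp <;> grind
        · refine ⟨⟨i, 1⟩, hv ?_ ?_⟩ <;> rw [hb] <;> simp <;> grind
      refine .inr (.inl ?_)
      rcases mul_eq_zero.mp this with h | h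
      · exact key 0 _ rfl (by simpa using hb1) (by simpa using h)
      · exact key 1 _ rfl hb2 (by simpa using h)
    -- Here `x y = 1` and `-(x + y)` is `e + e⁻¹` or `e² + e⁻²`, so `-x` is a primitive fifth root
    -- of unity and `-y` its inverse.
    · have hm' : 2 * (x * y - 1) = 0 := by linear_combination hm + h
      have hm'' := (mul_eq_zero.mp hm').resolve_left h2
      have : (x + y + (e + e ^ 4)) * (x + y + (e ^ 2 + e ^ 3)) = 0 := by grind
      have key (i : Fin 4) (hx : x = -(e ^ (i.val + 1))) (hy : y = -(e ^ (i.val + 1)) ^ 4) :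
        ∃ i : Fin 4, critTwoConic (e ^ (i.val + 1)) = ![x, y] := ⟨i, hv hx hy⟩
      refine .inr (.inr (.inr (.inr ?_)))
      rcases mul_eq_zero.mp this with h1 | h1
      · have : (x + e) * (x + e ^ 4) = 0 := by grind
        rcases mul_eq_zero.mp this with hx | hx
        · refine key 0 ?_ ?_ <;> simp <;> grind
        · refine key 3 ?_ ?_ <;> simp <;> grind
      · have : (x + e ^ 2) * (x + e ^ 3) = 0 := by grind
        rcases mul_eq_zero.mp this with hx | hx
        · refine key 1 ?_ ?_ <;> simp <;> grind
        · refine key 2 ?_ ?_ <;> simp <;> grind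

end Exhaustion

end CriticalPoints

/-! ### The sixteen points as explicit families: values, injectivity and counting. -/

section CriticalPoints

open MvPolynomial

variable {D : Type*} [CommRing D]

/-- The critical points with value `6`. -/
def critPtsSix (e : D) (i : Fin 2) : Fin 2 → D := critSix (e ^ (i.val + 1))

/-- The critical points with value `-3`. -/
def critPtsThree (e w : D) (i : Fin 2 × Fin 2) : Fin 2 → D :=
  critThree (e ^ (i.1.val + 1)) (w ^ (i.2.val + 1))

/-- The critical points with value `-2`. -/
def critPtsTwo (e : D) : Fin 2 ⊕ Fin 4 ⊕ Fin 4 → Fin 2 → D :=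
  Sum.elim (fun i => critTwoDiag (e ^ (i.val + 1)))
    (Sum.elim (fun i => critTwoLine (e ^ (i.val + 1))) fun i => critTwoConic (e ^ (i.val + 1)))

/-- The critical points. -/
def critPtsAll (e w : D) : Fin 2 ⊕ (Fin 2 × Fin 2) ⊕ (Fin 2 ⊕ Fin 4 ⊕ Fin 4) → Fin 2 → D :=
  Sum.elim (critPtsSix e) (Sum.elim (critPtsThree e w) (critPtsTwo e))

theorem map_critPtsAll {D' : Type*} [CommRing D'] (φ : D →+* D') (e w : D)
    (i : Fin 2 ⊕ (Fin 2 × Fin 2) ⊕ (Fin 2 ⊕ Fin 4 ⊕ Fin 4)) :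
    (fun j => φ (critPtsAll e w i j)) = critPtsAll (φ e) (φ w) i := by
  funext j
  rcases i with i | i | i | i | i <;> fin_cases j <;>
    simp [critPtsAll, critPtsSix, critPtsThree, critPtsTwo, critSix, critThree, critTwoDiag,
      critTwoLine, critTwoConic]

theorem geom_pow_eq_zero {e : D} (he : 1 + e + e ^ 2 + e ^ 3 + e ^ 4 = 0) (i : Fin 4) :
    1 + e ^ (i.val + 1) + (e ^ (i.val + 1)) ^ 2 + (e ^ (i.val + 1)) ^ 3 +
      (e ^ (i.val + 1)) ^ 4 = 0 := by
  fin_cases i <;> simp <;> grind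

theorem geom_pow_eq_zero_two {w : D} (hw : 1 + w + w ^ 2 = 0) (i : Fin 2) :
    1 + w ^ (i.val + 1) + (w ^ (i.val + 1)) ^ 2 = 0 := by
  fin_cases i <;> simp <;> grind

theorem pow_five_eq_one {e : D} (he : 1 + e + e ^ 2 + e ^ 3 + e ^ 4 = 0) : e ^ 5 = 1 := by
  linear_combination (e - 1) * he

/-- The two sums are the roots of `t² + t - 1`, whose discriminant is `5`. -/
theorem injective_sum (h5 : (5 : D) ≠ 0) {e : D} (he : 1 + e + e ^ 2 + e ^ 3 + e ^ 4 = 0) :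
    Function.Injective fun i : Fin 2 => e ^ (i.val + 1) + (e ^ (i.val + 1)) ^ 4 := by
  have h1 : e + e ^ 4 ≠ e ^ 2 + (e ^ 2) ^ 4 := fun h => h5 (by grind)
  intro i j h
  fin_cases i <;> fin_cases j <;> simp at h ⊢
  · exact h1 h
  · exact h1 h.symm

theorem injective_pow (h5 : (5 : D) ≠ 0) {e : D} (he : 1 + e + e ^ 2 + e ^ 3 + e ^ 4 = 0) :
    Function.Injective fun i : Fin 4 => e ^ (i.val + 1) := by
  have h1 : e ≠ 1 := by rintro rfl; exact h5 (by linear_combination he)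
  have : Fact (Nat.Prime 5) := ⟨by norm_num⟩
  have ho : orderOf e = 5 := orderOf_eq_prime (p := 5) (pow_five_eq_one he) h1
  intro i j h
  have := pow_injOn_Iio_orderOf (x := e) (by rw [ho, Set.mem_Iio]; omega)
    (by rw [ho, Set.mem_Iio]; omega) h
  exact Fin.ext (by omega)

theorem critPtsSix_injective (h5 : (5 : D) ≠ 0) {e : D} (he : 1 + e + e ^ 2 + e ^ 3 + e ^ 4 = 0) :
    Function.Injective (critPtsSix e) := fun i j h => injective_sum h5 he <| by
  have h0 := congrFun h 0
  simp only [critPtsSix, critSix, Matrix.cons_val_zero] at h0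
  linear_combination h0

section Domain

variable [IsDomain D]

theorem critPtsSix_mem (h30 : (30 : D) ≠ 0) {e : D} (he : 1 + e + e ^ 2 + e ^ 3 + e ^ 4 = 0)
    (i : Fin 2) : critPtsSix e i ∈ critPtsWithValue D 6 := by
  have hu := quintic_critSix (geom_pow_eq_zero he (i.castLE (by norm_num)))
  exact ⟨(mem_critPts (ne_zero_of_thirty h30).2.2).mpr ⟨hu.1, hu.1⟩, (eval_P5 _).trans hu.2⟩

theorem critPtsThree_mem (h30 : (30 : D) ≠ 0) {e w : D} (he : 1 + e + e ^ 2 + e ^ 3 + e ^ 4 = 0)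
    (hw : 1 + w + w ^ 2 = 0) (i : Fin 2 × Fin 2) :
    critPtsThree e w i ∈ critPtsWithValue D (-3) := by
  have hu := quintic_critThree (geom_pow_eq_zero he (i.1.castLE (by norm_num)))
    (geom_pow_eq_zero_two hw i.2)
  exact ⟨(mem_critPts (ne_zero_of_thirty h30).2.2).mpr ⟨hu.1, hu.2.1⟩, (eval_P5 _).trans hu.2.2⟩

theorem critPtsTwo_mem (h30 : (30 : D) ≠ 0) {e : D} (he : 1 + e + e ^ 2 + e ^ 3 + e ^ 4 = 0)
    (i : Fin 2 ⊕ Fin 4 ⊕ Fin 4) : critPtsTwo e i ∈ critPtsWithValue D (-2) := by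
  have h5 := (ne_zero_of_thirty h30).2.2
  rcases i with i | i | i
  · have hu := quintic_critTwoDiag (geom_pow_eq_zero he (i.castLE (by norm_num)))
    exact ⟨(mem_critPts h5).mpr ⟨hu.1, hu.1⟩, (eval_P5 _).trans hu.2⟩
  · have hu := quintic_critTwoLine (geom_pow_eq_zero he i)
    exact ⟨(mem_critPts h5).mpr ⟨hu.1, hu.2.1⟩, (eval_P5 _).trans hu.2.2⟩
  · have hu := quintic_critTwoConic (geom_pow_eq_zero he i)
    exact ⟨(mem_critPts h5).mpr ⟨hu.1, hu.2.1⟩, (eval_P5 _).trans hu.2.2⟩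

/-- The differences are `1`, `-8` and `-9`. -/
theorem values_ne (h30 : (30 : D) ≠ 0) : (-2 : D) ≠ -3 ∧ (-2 : D) ≠ 6 ∧ (-3 : D) ≠ 6 := by
  obtain ⟨h2, h3, -⟩ := ne_zero_of_thirty h30
  refine ⟨fun h => one_ne_zero (α := D) (by linear_combination h),
    fun h => pow_ne_zero 3 h2 (by linear_combination -h),
    fun h => pow_ne_zero 2 h3 (by linear_combination -h)⟩

theorem range_critPtsAll (h30 : (30 : D) ≠ 0) {e w : D}
    (he : 1 + e + e ^ 2 + e ^ 3 + e ^ 4 = 0) (hw : 1 + w + w ^ 2 = 0) :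
    Set.range (critPtsAll e w) = critPts D := by
  ext v
  constructor
  · rintro ⟨i | i | i, rfl⟩
    exacts [(critPtsSix_mem h30 he i).1, (critPtsThree_mem h30 he hw i).1,
      (critPtsTwo_mem h30 he i).1]
  · intro hv
    obtain ⟨h2, -, h5⟩ := ne_zero_of_thirty h30
    obtain ⟨h, h'⟩ := (mem_critPts h5).mp hv
    rcases critical_cases h2 he hw h h' with ⟨i, hi⟩ | ⟨i, hi⟩ | ⟨i, hi⟩ | ⟨i, hi⟩ | ⟨i, hi⟩
    · exact ⟨.inl i, hi⟩
    · exact ⟨.inr (.inl i), hi⟩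
    · exact ⟨.inr (.inr (.inl i)), hi⟩
    · exact ⟨.inr (.inr (.inr (.inl i))), hi⟩
    · exact ⟨.inr (.inr (.inr (.inr i))), hi⟩

/-- The three families together exhaust the critical points, and each has a constant value. Since
the values are distinct, each family is a full fibre. -/
theorem range_critPts (h30 : (30 : D) ≠ 0) {e w : D}
    (he : 1 + e + e ^ 2 + e ^ 3 + e ^ 4 = 0) (hw : 1 + w + w ^ 2 = 0) :
    Set.range (critPtsSix e) = critPtsWithValue D 6 ∧
    Set.range (critPtsThree e w) = critPtsWithValue D (-3) ∧
    Set.range (critPtsTwo e) = critPtsWithValue D (-2) := by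
  obtain ⟨h23, h26, h36⟩ := values_ne h30
  have hr := range_critPtsAll h30 he hw
  refine ⟨Set.Subset.antisymm (Set.range_subset_iff.mpr fun i => critPtsSix_mem h30 he i) ?_,
    Set.Subset.antisymm (Set.range_subset_iff.mpr fun i => critPtsThree_mem h30 he hw i) ?_,
    Set.Subset.antisymm (Set.range_subset_iff.mpr fun i => critPtsTwo_mem h30 he i) ?_⟩
  all_goals
    rintro v ⟨hv, hc⟩
    rw [← hr] at hv
    obtain ⟨i | i | i, rfl⟩ := hv
    all_goals first
      | exact ⟨i, rfl⟩
      | exact absurd ((critPtsSix_mem h30 he i).2.symm.trans hc) (by first | exact h26.symm | exact h36.symm)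
      | exact absurd ((critPtsThree_mem h30 he hw i).2.symm.trans hc) (by first | exact h23.symm | exact h36)
      | exact absurd ((critPtsTwo_mem h30 he i).2.symm.trans hc) (by first | exact h26 | exact h23)

/-- Equality of the first coordinates says `u⁻¹ - u = v⁻¹ - v`, that is `(v - u)(1 + u v) = 0`. The
case `u v = -1` contradicts `(u v)⁵ = 1`. -/
theorem eq_of_critTwoLine_eq (h2 : (2 : D) ≠ 0) {u v : D} (hu : u ^ 5 = 1) (hv : v ^ 5 = 1)
    (h : critTwoLine u = critTwoLine v) : u = v := by
  have h0 := congrFun h 0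
  simp only [critTwoLine, Matrix.cons_val_zero] at h0
  have h1 : (v - u) * (1 + u * v) = 0 := by
    linear_combination u * v * h0 - v * hu + u * hv
  rcases mul_eq_zero.mp h1 with h1 | h1
  · exact (sub_eq_zero.mp h1).symm
  · have h3 : (u * v) ^ 5 = 1 := by rw [mul_pow, hu, hv, one_mul]
    rw [eq_neg_of_add_eq_zero_right h1] at h3
    exact absurd (by linear_combination -h3) h2

theorem critPtsTwo_injective (h30 : (30 : D) ≠ 0) {e : D}
    (he : 1 + e + e ^ 2 + e ^ 3 + e ^ 4 = 0) : Function.Injective (critPtsTwo e) := by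
  obtain ⟨h2, -, h5⟩ := ne_zero_of_thirty h30
  have hpow (i : Fin 4) := pow_five_eq_one (geom_pow_eq_zero he i)
  have hne (i : Fin 4) : (e ^ (i.val + 1)) ^ 4 ≠ e ^ (i.val + 1) := by
    have hu := geom_pow_eq_zero he i
    generalize e ^ (i.val + 1) = u at hu
    intro h
    exact h5 (by grind)
  refine .sumElim (fun i j h => injective_sum h5 he ?_) (.sumElim (fun i j h => injective_pow h5 he
    (eq_of_critTwoLine_eq h2 (hpow i) (hpow j) h))
    (fun i j h => injective_pow h5 he ?_) fun i j h => ?_) (fun i j h => ?_)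
  · have h0 := congrFun h 0
    simp only [critTwoDiag, Matrix.cons_val_zero] at h0
    linear_combination -h0
  · have h0 := congrFun h 0
    simp only [critTwoConic, Matrix.cons_val_zero] at h0
    exact neg_injective h0
  · have h0 := congrFun h 0
    have h1 := congrFun h 1
    have hu := hpow j
    have hg := geom_pow_eq_zero he j
    simp only [critTwoLine, critTwoConic, Matrix.cons_val_zero, Matrix.cons_val_one] at h0 h1
    generalize e ^ (j.val + 1) = v at *
    -- Points on the line have coordinate sum `-2`, and those on the conic have `-(v + v⁻¹)`.
    -- Equality forces `v = 1`, which is not a root of the fifth cyclotomic polynomial.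
    have hv : (v - 1) ^ 2 = 0 := by linear_combination v * (h0 + h1) - hu
    rw [sub_eq_zero.mp (pow_eq_zero_iff two_ne_zero |>.mp hv)] at hg
    exact h5 (by linear_combination hg)
  -- Only the diagonal family has equal coordinates; in the other two equality would give `v⁴ = v`
  -- for a primitive fifth root of unity.
  · have h0 : critTwoDiag (e ^ (i.val + 1)) 0 = critTwoDiag (e ^ (i.val + 1)) 1 := rfl
    rcases j with j | j
    · rw [h] at h0
      simp only [Sum.elim_inl, critTwoLine, Matrix.cons_val_zero, Matrix.cons_val_one] at h0
      exact hne j (mul_left_cancel₀ h2 (by linear_combination h0))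
    · rw [h] at h0
      simp only [Sum.elim_inr, critTwoConic, Matrix.cons_val_zero, Matrix.cons_val_one] at h0
      exact hne j (neg_injective h0).symm

/-- The sum of the coordinates is `(w + w²) b = -b`, which determines the index of `e`. Cancelling
`b ≠ 0` in the first coordinate then determines the power of `w`. -/
theorem critPtsThree_injective (h30 : (30 : D) ≠ 0) {e w : D}
    (he : 1 + e + e ^ 2 + e ^ 3 + e ^ 4 = 0) (hw : 1 + w + w ^ 2 = 0) :
    Function.Injective (critPtsThree e w) := by
  obtain ⟨h2, h3, h5⟩ := ne_zero_of_thirty h30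
  have hw' : w ≠ w ^ 2 := fun h => h3 (by grind)
  rintro ⟨i, k⟩ ⟨j, l⟩ h
  have h0 := congrFun h 0
  have h1 := congrFun h 1
  simp only [critPtsThree, critThree, Matrix.cons_val_zero, Matrix.cons_val_one] at h0 h1
  have hij : i = j := injective_sum h5 he (by
    linear_combination -h0 - h1
      + (1 + e ^ (i.val + 1) + (e ^ (i.val + 1)) ^ 4) * geom_pow_eq_zero_two hw k
      - (1 + e ^ (j.val + 1) + (e ^ (j.val + 1)) ^ 4) * geom_pow_eq_zero_two hw l)
  subst hij
  have hb : 1 + e ^ (i.val + 1) + (e ^ (i.val + 1)) ^ 4 ≠ 0 := by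
    have hu := geom_pow_eq_zero he (i.castLE (by norm_num))
    simp only [Fin.val_castLE] at hu
    generalize e ^ (i.val + 1) = u at hu
    intro hb
    exact one_ne_zero (α := D) (by grind)
  have h4 := mul_right_cancel₀ hb h0
  refine Prod.ext rfl ?_
  fin_cases k <;> fin_cases l <;> simp at h4 ⊢
  · exact hw' h4
  · exact hw' h4.symm

theorem critPtsAll_injective (h30 : (30 : D) ≠ 0) {e w : D}
    (he : 1 + e + e ^ 2 + e ^ 3 + e ^ 4 = 0) (hw : 1 + w + w ^ 2 = 0) :
    Function.Injective (critPtsAll e w) := by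
  obtain ⟨h23, h26, h36⟩ := values_ne h30
  refine .sumElim (critPtsSix_injective (ne_zero_of_thirty h30).2.2 he)
    (.sumElim (critPtsThree_injective h30 he hw) (critPtsTwo_injective h30 he) fun i j h => ?_)
    fun i j h => ?_
  · have h1 := (critPtsThree_mem h30 he hw i).2
    rw [h] at h1
    exact h23 ((critPtsTwo_mem h30 he j).2.symm.trans h1)
  · have h1 := (critPtsSix_mem h30 he i).2
    rw [h] at h1
    rcases j with j | j
    · exact h36 ((critPtsThree_mem h30 he hw j).2.symm.trans h1)
    · exact h26 ((critPtsTwo_mem h30 he j).2.symm.trans h1)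

theorem ncard_range_of_injective {ι α : Type*} {f : ι → α} (hf : Function.Injective f) :
    (Set.range f).ncard = Nat.card ι := by
  rw [← Set.image_univ, Set.ncard_image_of_injective _ hf, Set.ncard_univ]

theorem ncard_critPts (h30 : (30 : D) ≠ 0) {e w : D}
    (he : 1 + e + e ^ 2 + e ^ 3 + e ^ 4 = 0) (hw : 1 + w + w ^ 2 = 0) :
    (critPts D).ncard = 16 ∧ (critPtsWithValue D (-2)).ncard = 10 ∧
      (critPtsWithValue D (-3)).ncard = 4 ∧ (critPtsWithValue D 6).ncard = 2 := by
  obtain ⟨h6, h3, h2⟩ := range_critPts h30 he hw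
  rw [← range_critPtsAll h30 he hw, ← h6, ← h3, ← h2,
    ncard_range_of_injective (critPtsAll_injective h30 he hw),
    ncard_range_of_injective (critPtsThree_injective h30 he hw),
    ncard_range_of_injective (critPtsTwo_injective h30 he),
    ncard_range_of_injective (critPtsSix_injective (ne_zero_of_thirty h30).2.2 he)]
  simp

/-- A ring homomorphism maps the critical points bijectively onto the critical points, if the
source contains enough roots of unity. -/
theorem bijOn_critPts {D' : Type*} [CommRing D'] [IsDomain D'] (φ : D →+* D') (h30 : (30 : D') ≠ 0)
    {e w : D} (he : 1 + e + e ^ 2 + e ^ 3 + e ^ 4 = 0) (hw : 1 + w + w ^ 2 = 0) :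
    Set.BijOn (fun v i => φ (v i)) (critPts D) (critPts D') := by
  have h30' : (30 : D) ≠ 0 := fun h => h30 (by rw [← map_ofNat φ, h, map_zero])
  have he' : 1 + φ e + φ e ^ 2 + φ e ^ 3 + φ e ^ 4 = 0 := by simpa using congrArg φ he
  have hw' : 1 + φ w + φ w ^ 2 = 0 := by simpa using congrArg φ hw
  rw [← range_critPtsAll h30' he hw, ← range_critPtsAll h30 he' hw']
  refine ⟨?_, ?_, ?_⟩
  · rintro _ ⟨i, rfl⟩
    exact ⟨i, (map_critPtsAll φ e w i).symm⟩
  · rintro _ ⟨i, rfl⟩ _ ⟨j, rfl⟩ h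
    rw [critPtsAll_injective h30 he' hw'
      ((map_critPtsAll φ e w i).symm.trans (h.trans (map_critPtsAll φ e w j)))]
  · rintro _ ⟨i, rfl⟩
    exact ⟨_, ⟨i, rfl⟩, map_critPtsAll φ e w i⟩

end Domain

end CriticalPoints

/-! ### Hessians, points at infinity and the supply of roots of unity. -/

section CriticalPoints

open MvPolynomial

theorem thirty_ne_zero {k : Type*} [Field k] (h : ringChar k = 0 ∨ 5 < ringChar k) :
    (30 : k) ≠ 0 := by
  intro h30
  have hd : ringChar k ∣ 2 * 3 * 5 := (ringChar.spec k 30).mp (by exact_mod_cast h30)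
  rcases h with h | h
  · rw [h] at hd; norm_num at hd
  · have hp : (ringChar k).Prime := (CharP.char_is_prime_or_zero k (ringChar k)).resolve_right
      (by omega)
    rw [hp.dvd_mul, hp.dvd_mul] at hd
    rcases hd with (hd | hd) | hd <;> exact absurd (Nat.le_of_dvd (by norm_num) hd) (by omega)

theorem hessian_eq {A : Type*} [CommRing A] (v : Fin 2 → A) : hessian v =
    !![5 * quinticDxx (v 0) (v 1), 5 * quinticDxy (v 0) (v 1);
      5 * quinticDxy (v 0) (v 1), 5 * quinticDxx (v 1) (v 0)] := by
  have hD (j : Fin 2) : pderiv j (P5 A) =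
      5 * quinticDeriv (X 0) (X 1) * (Pi.single (M := fun _ => MvPolynomial (Fin 2) A) j 1 0) +
      5 * quinticDeriv (X 1) (X 0) * (Pi.single (M := fun _ => MvPolynomial (Fin 2) A) j 1 1) := by
    rw [P5_eq, derivation_quintic, pderiv_X, pderiv_X]
  have h5 : (5 : MvPolynomial (Fin 2) A) = C 5 := (map_ofNat C 5).symm
  ext i j
  rw [hessian, Matrix.of_apply, hD]
  fin_cases i <;> fin_cases j <;>
    simp [h5, derivation_quinticDeriv, pderiv_X, map_quinticDxx, map_quinticDxy]
  exact congrArg _ (quinticDxy_comm (v 1) (v 0))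

theorem hessian_det_ne_zero {k : Type*} [Field k] (h30 : (30 : k) ≠ 0) {v : Fin 2 → k}
    (hv : v ∈ critPts k) : (hessian v).det ≠ 0 := by
  have h5 := (ne_zero_of_thirty h30).2.2
  obtain ⟨h, h'⟩ := (mem_critPts h5).mp hv
  have := (cert_hessian_ne_zero h30 h h').2
  rw [hessian_eq, Matrix.det_fin_two_of]
  refine fun h0 => mul_ne_zero (pow_ne_zero 2 h5) this ?_
  linear_combination h0

theorem exists_pderiv_F5_ne_zero {k : Type*} [Field k] (h5 : (5 : k) ≠ 0) {v : Fin 5 → k}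
    (hv : v ≠ 0) (h0 : v 0 = 0) : ∃ i, eval v (pderiv i (F5 k)) ≠ 0 := by
  obtain ⟨i, hi⟩ : ∃ i : Fin 4, v i.succ ≠ 0 := by
    by_contra! h
    exact hv (funext (Fin.cases h0 h))
  obtain ⟨a, c, ha, hc⟩ := pderiv_F5 k i
  refine ⟨i.succ, ?_⟩
  rw [hc]
  have ha' : a ≠ 0 := by rcases ha with rfl | rfl; exacts [h5, neg_ne_zero.mpr h5]
  simp [h0, ha', hi]

theorem exists_roots_of_isAlgClosed (k : Type*) [Field k] [IsAlgClosed k] :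
    ∃ e w : k, 1 + e + e ^ 2 + e ^ 3 + e ^ 4 = 0 ∧ 1 + w + w ^ 2 = 0 := by
  obtain ⟨e, he⟩ := IsAlgClosed.exists_root
    (1 + Polynomial.X + Polynomial.X ^ 2 + Polynomial.X ^ 3 + Polynomial.X ^ 4 : Polynomial k) (by
      have : (1 + Polynomial.X + Polynomial.X ^ 2 + Polynomial.X ^ 3 + Polynomial.X ^ 4 :
        Polynomial k).degree = 4 := by compute_degree!
      rw [this]; norm_num)
  obtain ⟨w, hw⟩ := IsAlgClosed.exists_root
    (1 + Polynomial.X + Polynomial.X ^ 2 : Polynomial k) (by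
      have : (1 + Polynomial.X + Polynomial.X ^ 2 : Polynomial k).degree = 2 := by compute_degree!
      rw [this]; norm_num)
  exact ⟨e, w, by simpa using he, by simpa using hw⟩

/-- For a primitive fifteenth root of unity `ζ`, take `ζ³` and `ζ⁵`; both are algebraic integers. -/
theorem exists_roots_ringOfIntegers :
    ∃ e w : NumberField.RingOfIntegers (CyclotomicField 15 ℚ),
      1 + e + e ^ 2 + e ^ 3 + e ^ 4 = 0 ∧ 1 + w + w ^ 2 = 0 := by
  obtain ⟨ζ, hζ'⟩ := (CyclotomicField.isCyclotomicExtension 15 ℚ).exists_isPrimitiveRoot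
    (Set.mem_singleton 15) (by norm_num)
  have hζ := hζ'.toInteger_isPrimitiveRoot
  have h5 := (hζ.pow (by norm_num) (show 15 = 3 * 5 by norm_num)).geom_sum_eq_zero (by norm_num)
  have h3 := (hζ.pow (by norm_num) (show 15 = 5 * 3 by norm_num)).geom_sum_eq_zero (by norm_num)
  simp only [Finset.sum_range_succ, Finset.sum_range_zero, zero_add, pow_zero, pow_one] at h5 h3
  exact ⟨_, _, h5, h3⟩

/-- Since `p` and `30` are coprime, a Bézout relation would put `1` into the prime ideal. -/
theorem thirty_notMem {A : Type*} [CommRing A] {P : Ideal A} (hP : P.IsPrime) {p : ℕ}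
    (hp : p.Prime) (h5 : 5 < p) (hpP : (p : A) ∈ P) : (30 : A) ∉ P := by
  intro h
  have hc : p.Coprime 30 := (Nat.Prime.coprime_iff_not_dvd hp).mpr fun hd => by
    have hd : p ∣ 2 * 3 * 5 := hd
    rw [hp.dvd_mul, hp.dvd_mul] at hd
    rcases hd with (hd | hd) | hd <;> exact absurd (Nat.le_of_dvd (by norm_num) hd) (by omega)
  obtain ⟨a, b, hab⟩ := (Nat.isCoprime_iff_coprime.mpr hc).map (Int.castRingHom A)
  refine hP.ne_top ((Ideal.eq_top_iff_one P).mpr ?_)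
  rw [← hab]
  exact add_mem (Ideal.mul_mem_left _ _ (by simpa using hpP))
    (Ideal.mul_mem_left _ _ (by simpa using h))

end CriticalPoints

end ChebyshevQuintic

end

/-! ### Assembly of the main theorem. -/

open ChebyshevQuintic in
theorem mainTheorem5 :
    -- the blow-up of the nodes of the quintic exists, and it has good reduction outside 2, 3 and 5
    ((∃ (Xt : Scheme.{0}) (π : Xt ⟶ Xbar ℚ), IsXtilde π) ∧
      ∀ (Xt : Scheme.{0}) (π : Xt ⟶ Xbar ℚ), IsXtilde π →
        ∀ (p : ℕ) [Fact p.Prime], p ≠ 2 → p ≠ 3 → p ≠ 5 →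
          HasGoodReductionAt (π ≫ XbarHom ℚ) p) ∧
    -- in characteristic zero and in every characteristic `p > 5`:
    (∀ (k : Type*) [Field k], (ringChar k = 0 ∨ 5 < ringChar k) →
      -- all critical points of `P₅` are nondegenerate
      (∀ v ∈ critPts k, (hessian v).det ≠ 0) ∧
      -- there are 16 of them over an algebraically closed field, with critical values -2, -3 and 6
      (IsAlgClosed k →
        (critPts k).ncard = 16 ∧
        (critPtsWithValue k (-2)).ncard = 10 ∧
        (critPtsWithValue k (-3)).ncard = 4 ∧
        (critPtsWithValue k 6).ncard = 2) ∧
      -- the three critical values are distinct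
      ((-2 : k) ≠ -3 ∧ (-2 : k) ≠ 6 ∧ (-3 : k) ≠ 6) ∧
      -- the projective quintic has no singular point on the hyperplane at infinity
      (∀ v : Fin 5 → k, v ≠ 0 → v 0 = 0 → MvPolynomial.eval v (F5 k) = 0 →
        ∃ i, MvPolynomial.eval v (MvPolynomial.pderiv i (F5 k)) ≠ 0)) ∧
    -- the critical points in characteristic zero are defined over the ring of integers of `ℚ(ζ₁₅)`
    ((critPts (NumberField.RingOfIntegers (CyclotomicField 15 ℚ))).ncard = 16 ∧
      ∀ (k : Type*) [Field k] [IsAlgClosed k] [CharZero k]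
        (φ : NumberField.RingOfIntegers (CyclotomicField 15 ℚ) →+* k),
        Set.BijOn (fun v i => φ (v i))
          (critPts (NumberField.RingOfIntegers (CyclotomicField 15 ℚ))) (critPts k)) ∧
    -- modulo a prime above `p > 5` they stay distinct, and they reduce onto the critical points of
    -- the reduction of `P₅`
    (∀ (p : ℕ), p.Prime → 5 < p →
      ∀ (P : Ideal (NumberField.RingOfIntegers (CyclotomicField 15 ℚ))), P.IsPrime →
        (p : NumberField.RingOfIntegers (CyclotomicField 15 ℚ)) ∈ P →
        Set.BijOn (fun v i => Ideal.Quotient.mk P (v i))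
          (critPts (NumberField.RingOfIntegers (CyclotomicField 15 ℚ)))
          (critPts (NumberField.RingOfIntegers (CyclotomicField 15 ℚ) ⧸ P))) := by
  refine ⟨⟨?_, fun Xt π hπ p _ h2 h3 h5 => ?_⟩, fun k _ hk => ?_, ⟨?_, fun k _ _ _ φ => ?_⟩,
    fun p hp h5 P hP hpP => ?_⟩
  -- Over `ℚ` the blow-up of the explicit ideal sheaf of the nodes is the required one, since that
  -- sheaf is the reduced ideal of the singular locus.
  · obtain ⟨M, π, hπ, -⟩ := exists_nodeBlowup ℚ (isUnit_iff_ne_zero.mpr (by norm_num))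
    exact ⟨M, π, by rwa [IsXtilde, vanishingIdeal_singularLocus ℚ (by norm_num)]⟩
  · rw [IsXtilde, vanishingIdeal_singularLocus ℚ (by norm_num)] at hπ
    exact hasGoodReductionAt_of_isBlowup hπ p h2 h3 h5
  · have h30 := thirty_ne_zero hk
    refine ⟨fun v hv => hessian_det_ne_zero h30 hv, fun _ => ?_, values_ne h30,
      fun v hv h0 _ => exists_pderiv_F5_ne_zero (ne_zero_of_thirty h30).2.2 hv h0⟩
    obtain ⟨e, w, he, hw⟩ := exists_roots_of_isAlgClosed k
    exact ncard_critPts h30 he hw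
  · obtain ⟨e, w, he, hw⟩ := exists_roots_ringOfIntegers
    exact (ncard_critPts (by norm_num) he hw).1
  · obtain ⟨e, w, he, hw⟩ := exists_roots_ringOfIntegers
    exact bijOn_critPts φ (by norm_num) he hw
  · obtain ⟨e, w, he, hw⟩ := exists_roots_ringOfIntegers
    -- The residue ring is a domain and already contains the reductions of both roots of unity, so
    -- no algebraic closure is needed.
    refine bijOn_critPts (Ideal.Quotient.mk P) (fun h => ?_) he hw
    rw [← map_ofNat (Ideal.Quotient.mk P), Ideal.Quotient.eq_zero_iff_mem] at h
    exact thirty_notMem hP hp h5 hpP h
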